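/- **Setting.** Let $(\mathbb G,\mathbb G_T)$ be groups of prime order $p$ with a map $e:\mathbb G\times\mathbb G\to\mathbb G_T$ such that $e(x^a,y^b)=e(x,y)^{ab}$ for $a,b\in\mathbb Z$ and $e(x,y)\ne 1$ for $x,y\neq 1$. Identities are elements of $\mathbb Z_p$, and $N\ge 0$ bounds the number of receivers. For a set $S$ of at most $N$ identities write $\prod_{\mathsf{ID}\in S}(X-\mathsf{ID})=\sum_k\rho_kX^k$ and $H(S)=z\prod_k h_k^{\rho_k}$. *Boneh–Hamburg IBBE (BH).* Setup picks a random generator $g$, random $g_2,z\in\mathbb G$, $\mathbf a\in\mathbb Z_p^{N+1}$, $\alpha\in\mathbb Z_p^*$; the public key is $(g,g_1=g^\alpha,g_2,z,(h_i=g^{a_i})_{0\le i\le N})$. The key of $\mathsf{ID}$ is $(g_2^{\alpha}z^r,\,g^r,\,(h_{i+1}^{r}h_i^{-\mathsf{ID}\,r})_{0\le i<N})$ with random $r\in\mathbb Z_p^*$. An encryption of $m\in\mathbb G_T$ for $S$ is $(m\,e(g_1,g_2)^s,\,g^s,\,H(S)^s)$ with random $s\in\mathbb Z_p^*$. *Accountable-authority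 IBBE (A-IBBE).* The public key has a further random $g_3\in\mathbb G$. To get a key for $\mathsf{ID}$ the user sends $R=g_2^{t_0}g^{\theta}$ and proves knowledge of $(t_0,\theta)$ by Okamoto's three-move witness-indistinguishable protocol (first message $U\in\mathbb G$; random challenge $c\in\mathbb Z_p$; response $(x,y)\in\mathbb Z_p^2$; check $g_2^xg^y=UR^c$). If the check fails the authority answers $\bot$; otherwise it picks random $r,t_1\in\mathbb Z_p^*$ and returns $((g_2^{t_1}Rg_3)^\alpha z^r,\,g^r,\,(h_{i+1}^{r}h_i^{-\mathsf{ID}\,r})_{0\le i<N},\,t_1)$; the key then has family number $t_{\mathsf{ID}}=t_0+t_1$. An encryption of $m$ for $S$ is $(m\,e(g_1,g_3)^s,\,g^s,\,H(S)^s,\,e(g_1,g_2)^s)$ with random $s\in\mathbb Z_p^*$. *Games.* In both games the adversary first announces a set $S^\star$ of at most $N$ identities and then receives the public key; before and after the challenge it may ask for keys of identities outside $S^\star$ (other queries are refused), in A-IBBE by running the key generation protocol, as the user, in sequential executions. In the IND-sID-CPA game against A-IBBE it chooses $m_0,m_1$, receives an encryption of $m_d$ for $S^\star$, $d$ a random bit,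 and outputs $d'$; its advantage is $\mathbf{Adv}(\mathcal A)=|\Pr[d'=d]-\tfrac12|$. In the real-or-random game against BH it chooses one message $m$ and receives an encryption for $S^\star$ of $m$ ("real") or of a uniformly random element of $\mathbb G_T$ ("random"); its advantage $\mathbf{Adv}^{\mathrm{BH}}(\mathcal B)$ is the absolute difference of the probabilities that it says "real" in the two cases. The $\ell$-DBDHE advantage of a distinguisher is the absolute difference of its acceptance probabilities on $(g,g^{\alpha},\dots,g^{\alpha^\ell},g^{\alpha^{\ell+2}},\dots,g^{\alpha^{2\ell}},h,T)$ for $T=e(g,h)^{\alpha^{\ell+1}}$ and for uniformly random $T\in\mathbb G_T$, where $g$ is a random generator, $\alpha\in\mathbb Z_p^*$ and $h\in\mathbb G$ are random. *Efficiency.* Adversaries and distinguishers are probabilistic straight-line programs (non-uniform; interactive in the games) whose instructions are group operations, exponentiations and pairings, arithmetic and sampling in $\mathbb Z_p$, Boolean gates, coin tosses, equality tests, selection, reading the bits of the encodings of elements and decoding bit strings. The size is the number of instructions (decoding also pays for the length of its input) plus the number of key queries. **Theorem.** 1. Let $(\mathbb G,\mathbb G_T)$ range over a family of such groups indexed by the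 security parameter $\lambda$, of prime order $p>2^\lambda$, and let $N=N(\lambda)$ be polynomially bounded. If every distinguisher of polynomial size has negligible $(N+1)$-DBDHE advantage, then every adversary of polynomial size has negligible IND-sID-CPA advantage against A-IBBE. 2. There is an absolute constant $c$ such that for all such groups, all $N$, every IND-sID-CPA adversary $\mathcal A$ against A-IBBE making $q$ key queries, and every $K\in\mathbb N$, there is a real-or-random adversary $\mathcal B$ against BH that makes $q$ key queries, has size at most $(\mathrm{size}(\mathcal A)+N+K+2)^c$, and satisfies $$\Bigl|\mathbf{Adv}^{\mathrm{BH}}(\mathcal B)-\bigl(1-\tfrac1p\bigr)\mathbf{Adv}(\mathcal A)\Bigr|\le \frac q2\Bigl(\frac1{K+1}+\frac1p\Bigr).$$ -/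

import Mathlib

noncomputable section

namespace AIBBE

/-! ### Bilinear groups -/

/-- Symmetric bilinear groups `(G, GT)` of prime order `p`, together with a binary encoding of
their elements (the bits of the natural numbers `encG x` and `encT y`). -/
structure BilinearGroup where
  p : ℕ
  prime : Fact p.Prime
  G : Type
  GT : Type
  commG : CommGroup G
  commT : CommGroup GT
  finG : Fintype G
  finT : Fintype GT
  cardG : Fintype.card G = p
  cardT : Fintype.card GT = p
  e : G → G → GT
  bilin : ∀ (x y : G) (a b : ℤ), e (x ^ a) (y ^ b) = e x y ^ (a * b)
  nondeg : ∀ x y : G, x ≠ 1 → y ≠ 1 → e x y ≠ 1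
  encG : G → ℕ
  encG_inj : Function.Injective encG
  encT : GT → ℕ
  encT_inj : Function.Injective encT

attribute [instance] BilinearGroup.prime BilinearGroup.commG BilinearGroup.commT
  BilinearGroup.finG BilinearGroup.finT

variable (Γ : BilinearGroup)

/-- The field of exponents `ℤ_p`. -/
abbrev BilinearGroup.Z : Type := ZMod Γ.p

/-- The generators of `G`: as the order is prime, these are the elements other than `1`. -/
abbrev BilinearGroup.Gen : Type := {x : Γ.G // x ≠ 1}

instance : Fintype Γ.Gen := Fintype.ofFinite _

instance : Nonempty Γ.Gen := by
  have h : 1 < Fintype.card Γ.G := by rw [Γ.cardG]; exact Γ.prime.out.one_lt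
  obtain ⟨x, hx⟩ := Fintype.exists_ne_of_one_lt_card h 1
  exact ⟨⟨x, hx⟩⟩

variable {Γ}

/-- `x ^ a` for an exponent `a ∈ ℤ_p`, in a group of order `p`. -/
def pw {M : Type} [Monoid M] (x : M) (a : Γ.Z) : M := x ^ a.val

variable (Γ)

/-- The uniform distribution on a finite nonempty type. -/
abbrev unif (α : Type) [Fintype α] [Nonempty α] : PMF α := PMF.uniformOfFintype α

/-! ### The machine model: probabilistic straight-line programs over `Γ`

A program is a finite list of instructions acting on registers for elements of `G`, `GT`, `ℤ_p`
and bits.  Besides the operations of `Γ` a program can read the bits of the encodings of group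
elements, decode bit strings to group elements, compute with bits, use constants as advice, branch
by selection, and flip coins. -/

/-- The contents of the registers. -/
@[ext] structure Mem where
  g : ℕ → Γ.G
  t : ℕ → Γ.GT
  z : ℕ → Γ.Z
  b : ℕ → Bool

/-- The initial memory. -/
def Mem.init : Mem Γ := ⟨fun _ => 1, fun _ => 1, fun _ => 0, fun _ => false⟩

/-- Instructions; the first argument is the register that receives the result. -/
inductive Instr where
  | gConst (d : ℕ) (x : Γ.G)
  | gMul (d i j : ℕ)
  | gInv (d i : ℕ)
  | gPow (d i k : ℕ)
  | gSel (d c i j : ℕ)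
  | gDec (d : ℕ) (l : List ℕ)
  | tConst (d : ℕ) (x : Γ.GT)
  | tMul (d i j : ℕ)
  | tInv (d i : ℕ)
  | tPow (d i k : ℕ)
  | tSel (d c i j : ℕ)
  | tDec (d : ℕ) (l : List ℕ)
  | pair (d i j : ℕ)
  | zConst (d : ℕ) (x : Γ.Z)
  | zAdd (d i j : ℕ)
  | zMul (d i j : ℕ)
  | zNeg (d i : ℕ)
  | zInv (d i : ℕ)
  | zSel (d c i j : ℕ)
  | zRand (d : ℕ)
  | zRandUnit (d : ℕ)
  | bConst (d : ℕ) (x : Bool)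
  | bNand (d i j : ℕ)
  | bRand (d : ℕ)
  | gEq (d i j : ℕ)
  | tEq (d i j : ℕ)
  | zEq (d i j : ℕ)
  | gBit (d i n : ℕ)
  | tBit (d i n : ℕ)
  | zBit (d i n : ℕ)

variable {Γ}

/-- Every instruction costs one step; decoding a bit string also pays for its length. -/
def Instr.cost : Instr Γ → ℕ
  | .gDec _ l => l.length + 1
  | .tDec _ l => l.length + 1
  | _ => 1

/-- The natural number with the binary digits `l`, least significant digit first. -/
def ofBits (l : List Bool) : ℕ := l.foldr (fun b n => 2 * n + b.toNat) 0

/-- The element with code `n`, or the default `x₀` if `n` is not a code. -/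
def decodeWith {M : Type} (enc : M → ℕ) (x₀ : M) (n : ℕ) : M :=
  open Classical in if h : ∃ x, enc x = n then h.choose else x₀

def Mem.setG (m : Mem Γ) (d : ℕ) (x : Γ.G) : Mem Γ := { m with g := Function.update m.g d x }
def Mem.setT (m : Mem Γ) (d : ℕ) (x : Γ.GT) : Mem Γ := { m with t := Function.update m.t d x }
def Mem.setZ (m : Mem Γ) (d : ℕ) (x : Γ.Z) : Mem Γ := { m with z := Function.update m.z d x }
def Mem.setB (m : Mem Γ) (d : ℕ) (x : Bool) : Mem Γ := { m with b := Function.update m.b d x }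

/-- Execution of one instruction. -/
def Instr.exec (m : Mem Γ) : Instr Γ → PMF (Mem Γ)
  | .gConst d x => PMF.pure (m.setG d x)
  | .gMul d i j => PMF.pure (m.setG d (m.g i * m.g j))
  | .gInv d i => PMF.pure (m.setG d (m.g i)⁻¹)
  | .gPow d i k => PMF.pure (m.setG d (pw (m.g i) (m.z k)))
  | .gSel d c i j => PMF.pure (m.setG d (if m.b c then m.g i else m.g j))
  | .gDec d l => PMF.pure (m.setG d (decodeWith Γ.encG 1 (ofBits (l.map m.b))))
  | .tConst d x => PMF.pure (m.setT d x)
  | .tMul d i j => PMF.pure (m.setT d (m.t i * m.t j))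
  | .tInv d i => PMF.pure (m.setT d (m.t i)⁻¹)
  | .tPow d i k => PMF.pure (m.setT d (pw (m.t i) (m.z k)))
  | .tSel d c i j => PMF.pure (m.setT d (if m.b c then m.t i else m.t j))
  | .tDec d l => PMF.pure (m.setT d (decodeWith Γ.encT 1 (ofBits (l.map m.b))))
  | .pair d i j => PMF.pure (m.setT d (Γ.e (m.g i) (m.g j)))
  | .zConst d x => PMF.pure (m.setZ d x)
  | .zAdd d i j => PMF.pure (m.setZ d (m.z i + m.z j))
  | .zMul d i j => PMF.pure (m.setZ d (m.z i * m.z j))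
  | .zNeg d i => PMF.pure (m.setZ d (-m.z i))
  | .zInv d i => PMF.pure (m.setZ d (m.z i)⁻¹)
  | .zSel d c i j => PMF.pure (m.setZ d (if m.b c then m.z i else m.z j))
  | .zRand d => (unif Γ.Z).map fun x => m.setZ d x
  | .zRandUnit d => (unif Γ.Zˣ).map fun x => m.setZ d (x : Γ.Z)
  | .bConst d x => PMF.pure (m.setB d x)
  | .bNand d i j => PMF.pure (m.setB d (!(m.b i && m.b j)))
  | .bRand d => (unif Bool).map fun x => m.setB d x
  | .gEq d i j => PMF.pure (m.setB d (open Classical in decide (m.g i = m.g j)))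
  | .tEq d i j => PMF.pure (m.setB d (open Classical in decide (m.t i = m.t j)))
  | .zEq d i j => PMF.pure (m.setB d (open Classical in decide (m.z i = m.z j)))
  | .gBit d i n => PMF.pure (m.setB d ((Γ.encG (m.g i)).testBit n))
  | .tBit d i n => PMF.pure (m.setB d ((Γ.encT (m.t i)).testBit n))
  | .zBit d i n => PMF.pure (m.setB d ((m.z i).val.testBit n))

variable (Γ) in
/-- Straight-line programs. -/
abbrev Prog : Type := List (Instr Γ)

/-- The number of steps of a program. -/
def Prog.cost (P : Prog Γ) : ℕ := (P.map Instr.cost).sum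

/-- Running a program on a memory gives a distribution on memories. -/
def Prog.run : Prog Γ → Mem Γ → PMF (Mem Γ)
  | [], m => PMF.pure m
  | i :: P, m => (i.exec m).bind (Prog.run P)

/-- Messages are delivered to a party by overwriting its registers `0, …, l.length - 1`. -/
def Mem.putG (l : List Γ.G) (m : Mem Γ) : Mem Γ := { m with g := fun i => l.getD i (m.g i) }
def Mem.putT (l : List Γ.GT) (m : Mem Γ) : Mem Γ := { m with t := fun i => l.getD i (m.t i) }

/-! ### The decision bilinear Diffie-Hellman exponent problem -/

/-- The input `(g, g^α, …, g^(α^ℓ), g^(α^(ℓ+2)), …, g^(α^(2ℓ)), h, T)`: register `i` of `G` holds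
`g^(α^i)` for `i ≤ 2ℓ`, `i ≠ ℓ + 1`, register `ℓ + 1` holds `h`, and register `0` of `GT` holds
`T`. -/
def dbdheInput (ℓ : ℕ) (g : Γ.G) (α : Γ.Z) (h : Γ.G) (T : Γ.GT) : Mem Γ :=
  ((Mem.init Γ).putG
      ((List.range (ℓ + 1)).map (fun i => pw g (α ^ i)) ++ [h] ++
        (List.range (ℓ - 1)).map (fun i => pw g (α ^ (ℓ + 2 + i))))).putT [T]

/-- The output bit of a distinguisher on an instance with `T = e(g,h)^(α^(ℓ+1))` if `real` is
true, and with a uniformly random `T ∈ GT` otherwise. -/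
def dbdheGame (ℓ : ℕ) (real : Bool) (D : Prog Γ) : PMF Bool :=
  (unif Γ.Gen).bind fun g =>
  (unif Γ.Zˣ).bind fun α =>
  (unif Γ.G).bind fun h =>
  (if real then PMF.pure (pw (Γ.e g h) ((α : Γ.Z) ^ (ℓ + 1))) else unif Γ.GT).bind fun T =>
  (D.run (dbdheInput ℓ g α h T)).map fun m => m.b 0

/-- The advantage of a distinguisher for the `ℓ`-DBDHE problem. -/
def dbdheAdv (ℓ : ℕ) (D : Prog Γ) : ℝ :=
  |(dbdheGame ℓ true D true).toReal - (dbdheGame ℓ false D true).toReal|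

/-! ### The Boneh-Hamburg identity-based broadcast encryption scheme

Identities are elements of `ℤ_p`. -/

variable (Γ) in
/-- The values chosen by the setup algorithm for at most `N` receivers per ciphertext. The master
secret key is `(a, α)`. -/
structure Setup (N : ℕ) where
  g : Γ.G
  g2 : Γ.G
  z : Γ.G
  a : Fin (N + 1) → Γ.Z
  α : Γ.Z

variable {N : ℕ}

def Setup.g1 (s : Setup Γ N) : Γ.G := pw s.g s.α
def Setup.h (s : Setup Γ N) (i : Fin (N + 1)) : Γ.G := pw s.g (s.a i)

variable (Γ N) in
/-- Random setup. -/
def setup : PMF (Setup Γ N) :=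
  (unif Γ.Gen).bind fun g =>
  (unif Γ.G).bind fun g2 =>
  (unif Γ.G).bind fun z =>
  (unif (Fin (N + 1) → Γ.Z)).bind fun a =>
  (unif Γ.Zˣ).map fun α => ⟨g, g2, z, a, α⟩

/-- The list of group elements `(W^α z^r, g^r, T_0, …, T_(N-1))` with
`T_i = h_(i+1)^r h_i^(-ID r)`. -/
def Setup.keyFor (s : Setup Γ N) (W : Γ.G) (ID r : Γ.Z) : List Γ.G :=
  [pw W s.α * pw s.z r, pw s.g r] ++
    List.ofFn fun i : Fin N => pw (s.h i.succ) r * pw (s.h i.castSucc) (-ID * r)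

/-- Key generation of the Boneh-Hamburg scheme. -/
def Setup.bhKeygen (s : Setup Γ N) (ID : Γ.Z) : PMF (List Γ.G) :=
  (unif Γ.Zˣ).map fun r => s.keyFor s.g2 ID r

/-- The coefficient `ρ_k` of the polynomial `∏ (X - ID)` over the identities in `S`. -/
def rho (S : Finset Γ.Z) (k : ℕ) : Γ.Z :=
  (∏ ID ∈ S, (Polynomial.X - Polynomial.C ID)).coeff k

/-- The product `z h_0^(ρ_0) ⋯ h_n^(ρ_n)`; note that `ρ_k = 0` for `k > n = |S|`. -/
def Setup.hash (s : Setup Γ N) (S : Finset Γ.Z) : Γ.G :=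
  s.z * ∏ k : Fin (N + 1), pw (s.h k) (rho S k)

/-- Encryption in the Boneh-Hamburg scheme: `((C_0), (C_1, C_2))`. -/
def Setup.bhEncrypt (s : Setup Γ N) (S : Finset Γ.Z) (M : Γ.GT) : PMF (Γ.GT × Γ.G × Γ.G) :=
  (unif Γ.Zˣ).map fun x =>
    (M * pw (Γ.e s.g1 s.g2) (x : Γ.Z), pw s.g (x : Γ.Z), pw (s.hash S) (x : Γ.Z))

/-! ### The accountable authority scheme

The public key has a further random element `g3`. -/

/-- The third message of the key generation protocol: after the commitment `R` the authority
chooses `r, t_1` and returns the blinded key. -/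
def Setup.aKeygen (s : Setup Γ N) (g3 R : Γ.G) (ID : Γ.Z) : PMF (List Γ.G × Γ.Z) :=
  (unif Γ.Zˣ).bind fun r =>
  (unif Γ.Zˣ).map fun t1 => (s.keyFor (pw s.g2 (t1 : Γ.Z) * R * g3) ID r, (t1 : Γ.Z))

/-- The authority's check in Okamoto's witness indistinguishable three-move proof of knowledge of
`(t_0, θ)` with `R = g2^(t_0) g^θ`: first message `U`, challenge `c`, response `(x, y)`. -/
def Setup.verify (s : Setup Γ N) (R U : Γ.G) (c x y : Γ.Z) : Prop :=
  pw s.g2 x * pw s.g y = U * pw R c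

/-- Encryption in the accountable authority scheme: `((C_0, C_3), (C_1, C_2))`. -/
def Setup.aEncrypt (s : Setup Γ N) (g3 : Γ.G) (S : Finset Γ.Z) (M : Γ.GT) :
    PMF ((Γ.GT × Γ.GT) × Γ.G × Γ.G) :=
  (unif Γ.Zˣ).map fun x =>
    ((M * pw (Γ.e s.g1 g3) (x : Γ.Z), pw (Γ.e s.g1 s.g2) (x : Γ.Z)),
      pw s.g (x : Γ.Z), pw (s.hash S) (x : Γ.Z))

/-! ### Selective-identity chosen-plaintext games

An adversary is a sequence of programs that share one memory; between two programs the challenger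
reads the adversary's message from its registers and writes the answer to them. -/

/-- The set of target identities that an adversary announces: at most `N` identities, in the
registers `0, …, N - 1`, of which those with a raised flag are taken. -/
def targets (N : ℕ) (m : Mem Γ) : Finset Γ.Z :=
  ((Finset.range N).filter fun i => m.b i = true).image m.z

variable (Γ) in
/-- An adversary in the real-or-random game against the Boneh-Hamburg scheme: announce the target
identities; ask for keys, one program for each query; choose a message; ask for further keys;
guess. -/
structure BHAdversary where
  start : Prog Γ
  pre : List (Prog Γ)
  choose : Prog Γ
  post : List (Prog Γ)
  guess : Prog Γ

def BHAdversary.queries (B : BHAdversary Γ) : ℕ := B.pre.length + B.post.length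

def BHAdversary.size (B : BHAdversary Γ) : ℕ :=
  B.start.cost + (B.pre.map Prog.cost).sum + B.choose.cost + (B.post.map Prog.cost).sum +
    B.guess.cost + B.queries

open Classical in
/-- Private key queries: the identity is in register `0`; the key is delivered, with flag `true`,
if it is not a target identity, and the query is refused, with flag `false`, otherwise. -/
def bhQueries (s : Setup Γ N) (S : Finset Γ.Z) : List (Prog Γ) → Mem Γ → PMF (Mem Γ)
  | [], m => PMF.pure m
  | Q :: Qs, m =>
    (Q.run m).bind fun m =>
    (if m.z 0 ∈ S then PMF.pure (m.setB 0 false)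
      else (s.bhKeygen (m.z 0)).map fun K => (m.putG K).setB 0 true).bind (bhQueries s S Qs)

/-- The real-or-random game: the challenge encrypts the adversary's message if `real` is true, and
a uniformly random element of `GT` otherwise.  The result is the adversary's output bit, where
`true` stands for "real". -/
def bhGame (N : ℕ) (real : Bool) (B : BHAdversary Γ) : PMF Bool :=
  (B.start.run (Mem.init Γ)).bind fun m =>
  let S := targets N m
  (setup Γ N).bind fun s =>
  (bhQueries s S B.pre (m.putG ([s.g, s.g1, s.g2, s.z] ++ List.ofFn s.h))).bind fun m =>
  (B.choose.run m).bind fun m =>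
  (if real then PMF.pure (m.t 0) else unif Γ.GT).bind fun M =>
  (s.bhEncrypt S M).bind fun C =>
  (bhQueries s S B.post ((m.putT [C.1]).putG [C.2.1, C.2.2])).bind fun m =>
  (B.guess.run m).map fun m => m.b 0

/-- The real-or-random advantage. -/
def bhAdv (N : ℕ) (B : BHAdversary Γ) : ℝ :=
  |(bhGame N true B true).toReal - (bhGame N false B true).toReal|

variable (Γ) in
/-- The adversary's part of one execution of the key generation protocol. -/
structure AQuery where
  /-- Outputs the identity (register `0` of `ℤ_p`), the commitment `R` and the first message of the
  proof of knowledge (registers `0` and `1` of `G`). -/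
  commit : Prog Γ
  /-- Given the challenge of the proof in register `0` of `ℤ_p`, outputs the response in registers
  `0` and `1` of `ℤ_p`. -/
  respond : Prog Γ

variable (Γ) in
/-- An adversary in the indistinguishability game against the accountable authority scheme:
announce the target identities; run the key generation protocol several times; choose two messages;
run the key generation protocol further times; guess. -/
structure AAdversary where
  start : Prog Γ
  pre : List (AQuery Γ)
  choose : Prog Γ
  post : List (AQuery Γ)
  guess : Prog Γ

def AAdversary.queries (A : AAdversary Γ) : ℕ := A.pre.length + A.post.length

def AQuery.cost (Q : AQuery Γ) : ℕ := Q.commit.cost + Q.respond.cost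

def AAdversary.size (A : AAdversary Γ) : ℕ :=
  A.start.cost + (A.pre.map AQuery.cost).sum + A.choose.cost + (A.post.map AQuery.cost).sum +
    A.guess.cost + A.queries

open Classical in
/-- Sequential executions of the key generation protocol with the authority, which challenges the
proof of knowledge with a random `c ∈ ℤ_p`.  The blinded key and `t_1` are delivered, with flag
`true`, if the identity is not a target identity and the proof is valid; otherwise the query is
refused, with flag `false`. -/
def aQueries (s : Setup Γ N) (g3 : Γ.G) (S : Finset Γ.Z) :
    List (AQuery Γ) → Mem Γ → PMF (Mem Γ)
  | [], m => PMF.pure m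
  | Q :: Qs, m =>
    (Q.commit.run m).bind fun m =>
    let ID := m.z 0
    let R := m.g 0
    let U := m.g 1
    (unif Γ.Z).bind fun c =>
    (Q.respond.run (m.setZ 0 c)).bind fun m =>
    (if ID ∉ S ∧ s.verify R U c (m.z 0) (m.z 1) then
        (s.aKeygen g3 R ID).map fun K => ((m.putG K.1).setZ 0 K.2).setB 0 true
      else PMF.pure (m.setB 0 false)).bind (aQueries s g3 S Qs)

/-- The indistinguishability game: the result is `true` if the adversary guesses which of its two
messages was encrypted for the target identities. -/
def aGame (N : ℕ) (A : AAdversary Γ) : PMF Bool :=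
  (A.start.run (Mem.init Γ)).bind fun m =>
  let S := targets N m
  (setup Γ N).bind fun s =>
  (unif Γ.G).bind fun g3 =>
  (aQueries s g3 S A.pre (m.putG ([s.g, s.g1, s.g2, g3, s.z] ++ List.ofFn s.h))).bind fun m =>
  (A.choose.run m).bind fun m =>
  (unif Bool).bind fun d =>
  (s.aEncrypt g3 S (if d then m.t 1 else m.t 0)).bind fun C =>
  (aQueries s g3 S A.post ((m.putT [C.1.1, C.1.2]).putG [C.2.1, C.2.2])).bind fun m =>
  (A.guess.run m).map fun m => m.b 0 == d

/-- The advantage in the indistinguishability game. -/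
def aAdv (N : ℕ) (A : AAdversary Γ) : ℝ := |(aGame N A true).toReal - 1 / 2|

/-! ### Asymptotic security -/

/-- Bounded by a polynomial in the security parameter. -/
def PolyBounded (f : ℕ → ℕ) : Prop := ∃ P : Polynomial ℕ, ∀ n, f n ≤ P.eval n

/-- Negligible functions of the security parameter. -/
def Negligible (f : ℕ → ℝ) : Prop :=
  Asymptotics.SuperpolynomialDecay Filter.atTop (fun n : ℕ => (n : ℝ)) f

/-- The `ℓ`-DBDHE assumption in a family of bilinear groups: every distinguisher of polynomial size
has negligible advantage. -/
def DBDHEAssumption (Γ : ℕ → BilinearGroup) (ℓ : ℕ → ℕ) : Prop :=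
  ∀ D : ∀ n, Prog (Γ n), PolyBounded (fun n => (D n).cost) →
    Negligible fun n => dbdheAdv (ℓ n) (D n)

/-- IND-sID-CPA security of the accountable authority scheme: every adversary of polynomial size
has negligible advantage. -/
def IndSidCpaSecure (Γ : ℕ → BilinearGroup) (N : ℕ → ℕ) : Prop :=
  ∀ A : ∀ n, AAdversary (Γ n), PolyBounded (fun n => (A n).size) →
    Negligible fun n => aAdv (N n) (A n)

end AIBBE

end

/-! Both parts rest on a reduction to BH that plants a secret in g3 = g2^γ g^δ, with γ and δ random.
Since δ alone makes g3 uniform, γ remains uniform given g3. The BH challenge for the message 1 is (T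
e(g1,g2)^s, g^s, H(S)^s), where T = 1 or T is random. Its first component becomes the last component
of the A-IBBE ciphertext, and m_d (T e(g1,g2)^s)^γ e(g1,g^s)^δ = m_d T^γ e(g1,g3)^s becomes the
first. If T = 1, this is a genuine encryption. If T ≠ 1, then T^γ is a uniform mask and the bit d is
hidden perfectly (`rewindGame_bind_mix`). A random T equals 1 with probability 1/p, which explains
the factor 1 - 1/p (`bhAdv_close`).

A user with commitment R = g2^t0 g^θ is owed g2^(ατ) g1^(θ+δ) z^r with τ = t0 + t1 + γ. The τ-th
power of a BH key, multiplied by g1^(θ+δ), is such a key with randomness rτ; for τ = 0 no BH key is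
needed at all (`keyList_eq`, `rel_answer`). The witness (t0,θ) is extracted by rewinding the user K
times with fresh challenges (`extract`). If A is the probability of acceptance after the commitment,
the probability that the actual run is accepted while all rewindings are useless is at most A(1 - (A
- 1/p))^K ≤ 1/(K+1) + 1/p (`rewindCore_fail_le`). After such a failure the output is a coin, so that
a failure costs only half its probability (`rewindGame_mix_close`); this gives the bound
(q/2)(1/(K+1) + 1/p).

For the first part BH itself is reduced to (N+1)-DBDHE (`bhAdv_le`). With random u_k, v, w the
distinguisher sets h_k = g^(α^(k+1)+u_k), g2 = g^(α^(N+1)+v), and chooses z such that H(S) = g^w.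
Let P be the polynomial that vanishes on S. For an identity ID outside S the key randomness is
shifted by E = P(ID)^(-1) ∑_j α^j ID^(N+1-j), because (α - ID)E = P(ID)^(-1)(α^(N+2) - ID^(N+2)).
The unknown power α^(N+2) then cancels between g2^α and z^E, and the remaining key components
telescope (`key_exponent`, `geom_exponent`). The challenge uses h as g^s, and T takes the place of
e(g,h)^(α^(N+2)). Errors arise only because exponents required to be nonzero are simulated by
uniform ones: 1/p per query and once for h. With K a suitable polynomial depending on the desired
rate of decay, the two reductions combine to the asymptotic statement (`aAdv_le`,
`indSidCpaSecure`).

Two tools make this formal. Games are compared by `Rel`, an approximate coupling stated through test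
functions, which composes along `bind` with additive errors. Reductions are written as kernels on
named registers, and a small calculus (`Comp`, `Impl`) compiles these to straight-line programs
whose cost is a fixed power of a size parameter X. -/

noncomputable section

namespace AIBBE

open scoped ENNReal

/-! ### Expectations and a relational lifting for discrete distributions -/

section Probability

variable {α β γ δ' : Type}

/-- The expectation of a nonnegative function. -/
def ev (μ : PMF α) (f : α → ℝ≥0∞) : ℝ≥0∞ := ∑' a, μ a * f a

theorem ev_pure (a : α) (f : α → ℝ≥0∞) : ev (PMF.pure a) f = f a := by
  rw [ev, tsum_eq_single a]
  · simp
  · intro b hb; simp [PMF.pure_apply, hb]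

theorem ev_bind (μ : PMF α) (κ : α → PMF β) (f : β → ℝ≥0∞) :
    ev (μ.bind κ) f = ev μ fun a => ev (κ a) f := by
  simp only [ev, PMF.bind_apply, ← ENNReal.tsum_mul_right, ← ENNReal.tsum_mul_left]
  rw [ENNReal.tsum_comm]
  simp only [mul_assoc]

theorem ev_map (μ : PMF α) (φ : α → β) (f : β → ℝ≥0∞) :
    ev (μ.map φ) f = ev μ fun a => f (φ a) := by
  rw [← PMF.bind_pure_comp, ev_bind]
  simp [ev_pure]

theorem ev_mono (μ : PMF α) {f g : α → ℝ≥0∞} (h : ∀ a, f a ≤ g a) : ev μ f ≤ ev μ g :=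
  ENNReal.tsum_le_tsum fun a => mul_le_mul_right (h a) _

theorem ev_mono_support (μ : PMF α) {f g : α → ℝ≥0∞} (h : ∀ a ∈ μ.support, f a ≤ g a) :
    ev μ f ≤ ev μ g := by
  refine ENNReal.tsum_le_tsum fun a => ?_
  by_cases ha : a ∈ μ.support
  · exact mul_le_mul_right (h a ha) _
  · rw [PMF.mem_support_iff, not_not] at ha; simp [ha]

theorem ev_const (μ : PMF α) (c : ℝ≥0∞) : ev μ (fun _ => c) = c := by
  rw [ev, ENNReal.tsum_mul_right, μ.tsum_coe, one_mul]

theorem ev_add (μ : PMF α) (f g : α → ℝ≥0∞) : ev μ (fun a => f a + g a) = ev μ f + ev μ g := by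
  simp only [ev, mul_add, ENNReal.tsum_add]

theorem ev_mul_left (μ : PMF α) (c : ℝ≥0∞) (f : α → ℝ≥0∞) :
    ev μ (fun a => c * f a) = c * ev μ f := by
  simp only [ev, ← ENNReal.tsum_mul_left, mul_left_comm]

theorem ev_le_one (μ : PMF α) {f : α → ℝ≥0∞} (h : ∀ a, f a ≤ 1) : ev μ f ≤ 1 :=
  (ev_mono μ h).trans (ev_const μ 1).le

theorem ev_unif [Fintype α] [Nonempty α] (f : α → ℝ≥0∞) :
    ev (unif α) f = (∑ a, f a) / Fintype.card α := by
  simp only [ev, PMF.uniformOfFintype_apply, tsum_fintype, ← Finset.mul_sum]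
  rw [mul_comm, div_eq_mul_inv]

theorem ev_indicator_true (μ : PMF Bool) : ev μ (fun b => if b then 1 else 0) = μ true := by
  simp [ev, tsum_fintype]

theorem ev_not (μ : PMF α) {f : α → ℝ≥0∞} (h : ∀ a, f a ≤ 1) :
    ev μ f + ev μ (fun a => 1 - f a) = 1 := by
  rw [← ev_add]
  simp only [add_tsub_cancel_of_le (h _), ev_const]

theorem pmf_ext_ev {μ ν : PMF α} (h : ∀ f : α → ℝ≥0∞, (∀ a, f a ≤ 1) → ev μ f ≤ ev ν f)
    (h' : ∀ f : α → ℝ≥0∞, (∀ a, f a ≤ 1) → ev ν f ≤ ev μ f) : μ = ν := by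
  classical
  have key : ∀ (μ : PMF α) a, ev μ (fun b => if b = a then 1 else 0) = μ a := by
    intro μ a
    rw [ev, tsum_eq_single a]
    · simp
    · intro b hb; simp [hb]
  ext a
  rw [← key μ, ← key ν]
  have h1 : ∀ b, (if b = a then (1 : ℝ≥0∞) else 0) ≤ 1 := fun b => by split_ifs <;> simp
  exact le_antisymm (h _ h1) (h' _ h1)

/-- The relational lifting of `R` up to an error `δ`, in dual form. -/
def Rel (δ : ℝ≥0∞) (R : α → β → Prop) (μ : PMF α) (ν : PMF β) : Prop :=
  ∀ (f : α → ℝ≥0∞) (g : β → ℝ≥0∞), (∀ a, f a ≤ 1) → (∀ b, g b ≤ 1) →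
    (∀ a b, R a b → f a ≤ g b) → ev μ f ≤ ev ν g + δ

variable {R : α → β → Prop} {δ ε : ℝ≥0∞}

theorem Rel.pure {a : α} {b : β} (h : R a b) : Rel 0 R (PMF.pure a) (PMF.pure b) := by
  intro f g _ _ hfg
  simpa [ev_pure] using hfg a b h

/-- The conditional expectation of `f` is lowered by `ε`, truncated at 0. It is then still a test
function bounded by 1 and is dominated along `R`, so that the first relation applies; adding `ε`
back gives the sum of the errors. -/
theorem Rel.bind {α₂ β₂ : Type} {R' : α₂ → β₂ → Prop} {μ : PMF α} {ν : PMF β}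
    {κ : α → PMF α₂} {κ' : β → PMF β₂} (h : Rel δ R μ ν)
    (h' : ∀ a b, R a b → Rel ε R' (κ a) (κ' b)) : Rel (δ + ε) R' (μ.bind κ) (ν.bind κ') := by
  intro f g hf hg hfg
  rw [ev_bind, ev_bind]
  have h1 := h (fun a => ev (κ a) f - ε) (fun b => ev (κ' b) g)
    (fun a => tsub_le_self.trans (ev_le_one _ hf)) (fun b => ev_le_one _ hg)
    (fun a b hab => tsub_le_iff_right.2 (h' a b hab f g hf hg hfg))
  calc ev μ (fun a => ev (κ a) f) ≤ ev μ (fun a => (ev (κ a) f - ε) + ε) :=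
        ev_mono _ fun a => le_tsub_add
    _ = ev μ (fun a => ev (κ a) f - ε) + ε := by rw [ev_add, ev_const]
    _ ≤ ev ν (fun b => ev (κ' b) g) + δ + ε := by gcongr
    _ = _ := by rw [add_assoc]

theorem Rel.bind_exact {α₂ β₂ : Type} {R' : α₂ → β₂ → Prop} {μ : PMF α} {ν : PMF β}
    {κ : α → PMF α₂} {κ' : β → PMF β₂} (h : Rel 0 R μ ν)
    (h' : ∀ a b, R a b → Rel ε R' (κ a) (κ' b)) : Rel ε R' (μ.bind κ) (ν.bind κ') := by
  simpa using Rel.bind h h'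

theorem Rel.mono {R' : α → β → Prop} {μ : PMF α} {ν : PMF β} (h : Rel δ R μ ν) (hδ : δ ≤ ε)
    (hR : ∀ a b, R a b → R' a b) : Rel ε R' μ ν := fun f g hf hg hfg =>
  (h f g hf hg fun a b hab => hfg a b (hR a b hab)).trans (by gcongr)

theorem Rel.imp {R' : α → β → Prop} {μ : PMF α} {ν : PMF β} (h : Rel δ R μ ν)
    (hR : ∀ a b, R a b → R' a b) : Rel δ R' μ ν := h.mono le_rfl hR

theorem Rel.refl {R : α → α → Prop} (μ : PMF α) (h : ∀ a, R a a) : Rel 0 R μ μ := by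
  intro f g _ _ hfg
  rw [add_zero]
  exact ev_mono _ fun a => hfg a a (h a)

theorem Rel.map {α₂ β₂ : Type} {R' : α₂ → β₂ → Prop} {μ : PMF α} {ν : PMF β}
    {φ : α → α₂} {ψ : β → β₂} (h : Rel δ R μ ν) (h' : ∀ a b, R a b → R' (φ a) (ψ b)) :
    Rel δ R' (μ.map φ) (ν.map ψ) := by
  intro f g hf hg hfg
  rw [ev_map, ev_map]
  exact h _ _ (fun _ => hf _) (fun _ => hg _) fun a b hab => hfg _ _ (h' a b hab)

/-- The definition looks one-sided, but applying it to the complements `1 - g` and `1 - f` reverses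
the inequality. -/
theorem Rel.symm {μ : PMF α} {ν : PMF β} (h : Rel δ R μ ν) : Rel δ (fun b a => R a b) ν μ := by
  intro f g hf hg hfg
  have h1 := h (fun a => 1 - g a) (fun b => 1 - f b) (fun _ => tsub_le_self)
    (fun _ => tsub_le_self) (fun a b hab => tsub_le_tsub_left (hfg b a hab) 1)
  have e1 := ev_not μ hg
  have e2 := ev_not ν hf
  have ft : ev ν (fun b => 1 - f b) ≠ ⊤ :=
    ((ev_le_one ν fun _ => tsub_le_self).trans_lt ENNReal.one_lt_top).ne
  have : ev ν f + ev ν (fun b => 1 - f b) ≤ ev μ g + δ + ev ν (fun b => 1 - f b) := by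
    calc _ = ev μ g + ev μ (fun a => 1 - g a) := by rw [e2, e1]
      _ ≤ ev μ g + (ev ν (fun b => 1 - f b) + δ) := by gcongr
      _ = _ := by ring
  exact (ENNReal.add_le_add_iff_right ft).1 this

/-- Transfer along a function on the left-hand side. -/
theorem Rel.of_map_left {φ : α → γ} {R : γ → β → Prop} {μ : PMF α} {ν : PMF β}
    (h : Rel δ R (μ.map φ) ν) : Rel δ (fun a b => R (φ a) b) μ ν := by
  intro f g hf hg hfg
  -- The least test function on the image that dominates `f` is the supremum over the fibres of `φ`.
  have h1 := h (fun c => ⨆ (a) (_ : φ a = c), f a) g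
    (fun c => iSup₂_le fun a _ => hf a) hg (fun c b hcb => iSup₂_le fun a ha => hfg a b (by subst ha; exact hcb))
  rw [ev_map] at h1
  exact (ev_mono μ fun a => le_iSup₂_of_le (f := fun a' (_ : φ a' = φ a) => f a') a rfl le_rfl).trans h1

/-- Setting the test function to 0 off the support leaves its expectation unchanged. This lets a
coupling remember facts that hold for all possible outputs, such as the registers a program cannot
have changed. -/
theorem Rel.support_left {μ : PMF α} {ν : PMF β} (h : Rel δ R μ ν) :
    Rel δ (fun a b => R a b ∧ a ∈ μ.support) μ ν := by
  classical
  intro f g hf hg hfg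
  refine le_trans ?_ (h (fun a => if a ∈ μ.support then f a else 0) g
    (fun a => by split_ifs <;> simp [hf]) hg fun a b hab => ?_)
  · exact ev_mono_support _ fun a ha => by simp only [if_pos ha]; exact le_rfl
  · split_ifs with ha
    · exact hfg a b ⟨hab, ha⟩
    · exact zero_le

/-- Sampling on the left-hand side only. -/
theorem Rel.bind_left {μ : PMF γ} {κ : γ → PMF α} {ν : PMF β}
    (h : ∀ c, Rel δ R (κ c) ν) : Rel δ R (μ.bind κ) ν := by
  intro f g hf hg hfg
  rw [ev_bind]
  exact (ev_mono μ fun c => h c f g hf hg hfg).trans (ev_const _ _).le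

theorem Rel.unif_equiv [Fintype α] [Nonempty α] [Fintype β] [Nonempty β] (e : α ≃ β) :
    Rel 0 (fun a b => b = e a) (unif α) (unif β) := by
  intro f g _ _ hfg
  rw [add_zero, ev_unif, ev_unif, Fintype.card_congr e]
  gcongr 1
  rw [← Equiv.sum_comp e g]
  exact Finset.sum_le_sum fun a _ => hfg _ _ rfl

theorem Rel.bind_equiv {α₂ β₂ : Type} {R' : α₂ → β₂ → Prop} [Fintype α] [Nonempty α]
    [Fintype β] [Nonempty β] (e : α ≃ β) {κ : α → PMF α₂} {κ' : β → PMF β₂}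
    (h : ∀ a, Rel ε R' (κ a) (κ' (e a))) : Rel ε R' ((unif α).bind κ) ((unif β).bind κ') :=
  (Rel.unif_equiv e).bind_exact fun a _ hb => by subst hb; exact h a

theorem Rel.bind_same {α₂ β₂ : Type} {R' : α₂ → β₂ → Prop} (μ : PMF α)
    {κ : α → PMF α₂} {κ' : α → PMF β₂}
    (h : ∀ a, Rel ε R' (κ a) (κ' a)) : Rel ε R' (μ.bind κ) (μ.bind κ') :=
  (Rel.refl (R := fun a b => a = b) μ fun _ => rfl).bind_exact fun a b hb => by subst hb; exact h a

theorem Rel.eq {μ ν : PMF α} (h : Rel 0 (· = ·) μ ν) : μ = ν :=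
  pmf_ext_ev (fun f hf => by simpa using h f f hf hf fun a b hab => by rw [hab])
    fun f hf => by simpa using h.symm f f hf hf fun a b hab => by rw [hab]

theorem Rel.abs_sub_le {μ ν : PMF Bool} (h : Rel δ (· = ·) μ ν) (hδ : δ ≠ ⊤) :
    |(μ true).toReal - (ν true).toReal| ≤ δ.toReal := by
  have key : ∀ {μ ν : PMF Bool}, Rel δ (· = ·) μ ν →
      (μ true).toReal ≤ (ν true).toReal + δ.toReal := by
    intro μ ν h
    have h1 := h (fun b => if b then 1 else 0) (fun b => if b then 1 else 0)
      (fun b => by split_ifs <;> simp) (fun b => by split_ifs <;> simp)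
      (fun a b hab => by rw [hab])
    rw [ev_indicator_true, ev_indicator_true] at h1
    rw [← ENNReal.toReal_add (PMF.apply_ne_top _ _) hδ]
    exact ENNReal.toReal_mono (ENNReal.add_ne_top.2 ⟨PMF.apply_ne_top _ _, hδ⟩) h1
  have h1 := key h
  have h2 := key (h.symm.imp fun _ _ hab => hab.symm)
  rw [_root_.abs_sub_le_iff]
  constructor <;> linarith

/-- The uniform distribution is preserved by bijections. -/
theorem unif_bind_equiv [Fintype α] [Nonempty α] [Fintype β] [Nonempty β] (e : α ≃ β)
    (κ : β → PMF γ) : ((unif α).bind fun a => κ (e a)) = (unif β).bind κ :=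
  Rel.eq (Rel.bind_equiv e fun _ => Rel.refl _ fun _ => rfl)

end Probability

end AIBBE

end

noncomputable section

namespace AIBBE

open Classical

variable {Γ : BilinearGroup}

/-! ### Registers of all kinds, uniformly -/

inductive Kind | g | t | z | b

variable (Γ) in
abbrev Val : Kind → Type
  | .g => Γ.G
  | .t => Γ.GT
  | .z => Γ.Z
  | .b => Bool

def Mem.get (m : Mem Γ) : (k : Kind) → ℕ → Val Γ k
  | .g => m.g
  | .t => m.t
  | .z => m.z
  | .b => m.b

def Mem.set (m : Mem Γ) : (k : Kind) → ℕ → Val Γ k → Mem Γ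
  | .g => m.setG
  | .t => m.setT
  | .z => m.setZ
  | .b => m.setB

/-- The memory with given contents. -/
def Mem.ofGet (v : (k : Kind) → ℕ → Val Γ k) : Mem Γ := ⟨v .g, v .t, v .z, v .b⟩

@[simp] theorem Mem.get_ofGet (v : (k : Kind) → ℕ → Val Γ k) (k : Kind) (i : ℕ) :
    (Mem.ofGet v).get k i = v k i := by cases k <;> rfl

theorem Mem.ext_get {m m' : Mem Γ} (h : ∀ k i, m.get k i = m'.get k i) : m = m' := by
  ext i
  · exact h .g i
  · exact h .t i
  · exact h .z i
  · exact h .b i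

@[simp] theorem Mem.get_set_same (m : Mem Γ) (k : Kind) (d : ℕ) (x : Val Γ k) :
    (m.set k d x).get k d = x := by
  cases k <;> simp [Mem.get, Mem.set, Mem.setG, Mem.setT, Mem.setZ, Mem.setB]

theorem Mem.get_set_of_ne (m : Mem Γ) {k k' : Kind} {d i : ℕ} (x : Val Γ k)
    (h : (k', i) ≠ (k, d)) : (m.set k d x).get k' i = m.get k' i := by
  cases k <;> cases k' <;>
    simp_all [Mem.get, Mem.set, Mem.setG, Mem.setT, Mem.setZ, Mem.setB]

/-! ### Renaming the registers of a program -/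

/-- The register that an instruction writes to. -/
def Instr.dst : Instr Γ → Kind × ℕ
  | .gConst d _ => (.g, d)
  | .gMul d _ _ => (.g, d)
  | .gInv d _ => (.g, d)
  | .gPow d _ _ => (.g, d)
  | .gSel d _ _ _ => (.g, d)
  | .gDec d _ => (.g, d)
  | .tConst d _ => (.t, d)
  | .tMul d _ _ => (.t, d)
  | .tInv d _ => (.t, d)
  | .tPow d _ _ => (.t, d)
  | .tSel d _ _ _ => (.t, d)
  | .tDec d _ => (.t, d)
  | .pair d _ _ => (.t, d)
  | .zConst d _ => (.z, d)
  | .zAdd d _ _ => (.z, d)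
  | .zMul d _ _ => (.z, d)
  | .zNeg d _ => (.z, d)
  | .zInv d _ => (.z, d)
  | .zSel d _ _ _ => (.z, d)
  | .zRand d => (.z, d)
  | .zRandUnit d => (.z, d)
  | .bConst d _ => (.b, d)
  | .bNand d _ _ => (.b, d)
  | .bRand d => (.b, d)
  | .gEq d _ _ => (.b, d)
  | .tEq d _ _ => (.b, d)
  | .zEq d _ _ => (.b, d)
  | .gBit d _ _ => (.b, d)
  | .tBit d _ _ => (.b, d)
  | .zBit d _ _ => (.b, d)

def Instr.rename (f : ℕ → ℕ) : Instr Γ → Instr Γ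
  | .gConst d x => .gConst (f d) x
  | .gMul d i j => .gMul (f d) (f i) (f j)
  | .gInv d i => .gInv (f d) (f i)
  | .gPow d i k => .gPow (f d) (f i) (f k)
  | .gSel d c i j => .gSel (f d) (f c) (f i) (f j)
  | .gDec d l => .gDec (f d) (l.map f)
  | .tConst d x => .tConst (f d) x
  | .tMul d i j => .tMul (f d) (f i) (f j)
  | .tInv d i => .tInv (f d) (f i)
  | .tPow d i k => .tPow (f d) (f i) (f k)
  | .tSel d c i j => .tSel (f d) (f c) (f i) (f j)
  | .tDec d l => .tDec (f d) (l.map f)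
  | .pair d i j => .pair (f d) (f i) (f j)
  | .zConst d x => .zConst (f d) x
  | .zAdd d i j => .zAdd (f d) (f i) (f j)
  | .zMul d i j => .zMul (f d) (f i) (f j)
  | .zNeg d i => .zNeg (f d) (f i)
  | .zInv d i => .zInv (f d) (f i)
  | .zSel d c i j => .zSel (f d) (f c) (f i) (f j)
  | .zRand d => .zRand (f d)
  | .zRandUnit d => .zRandUnit (f d)
  | .bConst d x => .bConst (f d) x
  | .bNand d i j => .bNand (f d) (f i) (f j)
  | .bRand d => .bRand (f d)
  | .gEq d i j => .gEq (f d) (f i) (f j)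
  | .tEq d i j => .tEq (f d) (f i) (f j)
  | .zEq d i j => .zEq (f d) (f i) (f j)
  | .gBit d i n => .gBit (f d) (f i) n
  | .tBit d i n => .tBit (f d) (f i) n
  | .zBit d i n => .zBit (f d) (f i) n

def Mem.comap (f : ℕ → ℕ) (m : Mem Γ) : Mem Γ := Mem.ofGet fun k i => m.get k (f i)

/-- The memory `m` with the registers in the range of `f` replaced by those of `a`. -/
def Mem.overlay (f : ℕ → ℕ) (m a : Mem Γ) : Mem Γ :=
  Mem.ofGet fun k j => if h : ∃ i, f i = j then a.get k h.choose else m.get k j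

theorem Mem.overlay_get_apply {f : ℕ → ℕ} (hf : Function.Injective f) (m a : Mem Γ) (k : Kind)
    (i : ℕ) : (m.overlay f a).get k (f i) = a.get k i := by
  have h : ∃ j, f j = f i := ⟨i, rfl⟩
  rw [overlay, get_ofGet, dif_pos h, hf h.choose_spec]

theorem Mem.overlay_get_of_ne {f : ℕ → ℕ} (m a : Mem Γ) (k : Kind)
    {j : ℕ} (h : ∀ i, f i ≠ j) : (m.overlay f a).get k j = m.get k j := by
  rw [overlay, get_ofGet, dif_neg (by simpa using h)]

/-- The instruction `i` writes a value that is chosen according to `F` to the register `(k, d)`. -/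
def Instr.HasForm (i : Instr Γ) (k : Kind) (d : ℕ) (F : Mem Γ → PMF (Val Γ k)) : Prop :=
  i.dst = (k, d) ∧ (∀ m, i.exec m = (F m).map (m.set k d)) ∧
    ∀ f m, (i.rename f).exec m = (F (m.comap f)).map (m.set k (f d))

theorem Instr.hasForm_of_pure {i : Instr Γ} {k : Kind} {d : ℕ} (F : Mem Γ → Val Γ k)
    (h₁ : i.dst = (k, d)) (h₂ : ∀ m, i.exec m = PMF.pure (m.set k d (F m)))
    (h₃ : ∀ f m, (i.rename f).exec m = PMF.pure (m.set k (f d) (F (m.comap f)))) :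
    ∃ k d F, i.HasForm k d F :=
  ⟨k, d, fun m => PMF.pure (F m), h₁, fun m => by rw [h₂, PMF.pure_map],
    fun f m => by rw [h₃, PMF.pure_map]⟩

/-- This is the only case analysis over the instruction set needed for renaming and for framing:
everything else uses just that one register is overwritten by a value sampled from the memory, and
that this commutes with renaming. -/
theorem Instr.exists_hasForm (i : Instr Γ) : ∃ k d F, i.HasForm k d F := by
  cases i
  case zRand d => exact ⟨.z, d, fun _ => unif Γ.Z, rfl, fun m => rfl, fun f m => rfl⟩
  case zRandUnit d =>
    exact ⟨.z, d, fun _ => (unif Γ.Zˣ).map Units.val, rfl, fun m => rfl, fun f m => rfl⟩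
  case bRand d => exact ⟨.b, d, fun _ => unif Bool, rfl, fun m => rfl, fun f m => rfl⟩
  case gDec d l =>
    exact hasForm_of_pure (k := .g) (fun m => decodeWith Γ.encG (1 : Γ.G) (ofBits (l.map m.b))) rfl
      (fun m => rfl) (fun f m => by rw [Instr.rename, Instr.exec, List.map_map]; rfl)
  case tDec d l =>
    exact hasForm_of_pure (k := .t) (fun m => decodeWith Γ.encT (1 : Γ.GT) (ofBits (l.map m.b))) rfl
      (fun m => rfl) (fun f m => by rw [Instr.rename, Instr.exec, List.map_map]; rfl)
  case gConst d x =>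
    exact hasForm_of_pure (k := .g) (fun _ => x) rfl (fun _ => rfl) fun _ _ => rfl
  case gMul d i j =>
    exact hasForm_of_pure (k := .g) (fun m => m.g i * m.g j) rfl (fun _ => rfl) fun _ _ => rfl
  case gInv d i =>
    exact hasForm_of_pure (k := .g) (fun m => (m.g i)⁻¹) rfl (fun _ => rfl) fun _ _ => rfl
  case gPow d i k =>
    exact hasForm_of_pure (k := .g) (fun m => pw (m.g i) (m.z k)) rfl (fun _ => rfl) fun _ _ => rfl
  case gSel d c i j =>
    exact hasForm_of_pure (k := .g) (fun m => if m.b c then m.g i else m.g j) rfl (fun _ => rfl) fun _ _ => rfl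
  case tConst d x =>
    exact hasForm_of_pure (k := .t) (fun _ => x) rfl (fun _ => rfl) fun _ _ => rfl
  case tMul d i j =>
    exact hasForm_of_pure (k := .t) (fun m => m.t i * m.t j) rfl (fun _ => rfl) fun _ _ => rfl
  case tInv d i =>
    exact hasForm_of_pure (k := .t) (fun m => (m.t i)⁻¹) rfl (fun _ => rfl) fun _ _ => rfl
  case tPow d i k =>
    exact hasForm_of_pure (k := .t) (fun m => pw (m.t i) (m.z k)) rfl (fun _ => rfl) fun _ _ => rfl
  case tSel d c i j =>
    exact hasForm_of_pure (k := .t) (fun m => if m.b c then m.t i else m.t j) rfl (fun _ => rfl) fun _ _ => rfl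
  case pair d i j =>
    exact hasForm_of_pure (k := .t) (fun m => Γ.e (m.g i) (m.g j)) rfl (fun _ => rfl) fun _ _ => rfl
  case zConst d x =>
    exact hasForm_of_pure (k := .z) (fun _ => x) rfl (fun _ => rfl) fun _ _ => rfl
  case zAdd d i j =>
    exact hasForm_of_pure (k := .z) (fun m => m.z i + m.z j) rfl (fun _ => rfl) fun _ _ => rfl
  case zMul d i j =>
    exact hasForm_of_pure (k := .z) (fun m => m.z i * m.z j) rfl (fun _ => rfl) fun _ _ => rfl
  case zNeg d i =>
    exact hasForm_of_pure (k := .z) (fun m => -m.z i) rfl (fun _ => rfl) fun _ _ => rfl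
  case zInv d i =>
    exact hasForm_of_pure (k := .z) (fun m => (m.z i)⁻¹) rfl (fun _ => rfl) fun _ _ => rfl
  case zSel d c i j =>
    exact hasForm_of_pure (k := .z) (fun m => if m.b c then m.z i else m.z j) rfl (fun _ => rfl) fun _ _ => rfl
  case bConst d x =>
    exact hasForm_of_pure (k := .b) (fun _ => x) rfl (fun _ => rfl) fun _ _ => rfl
  case bNand d i j =>
    exact hasForm_of_pure (k := .b) (fun m => !(m.b i && m.b j)) rfl (fun _ => rfl) fun _ _ => rfl
  case gEq d i j =>
    exact hasForm_of_pure (k := .b) (fun m => @decide (m.g i = m.g j) (propDecidable _)) rfl (fun _ => rfl) fun _ _ => rfl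
  case tEq d i j =>
    exact hasForm_of_pure (k := .b) (fun m => @decide (m.t i = m.t j) (propDecidable _)) rfl (fun _ => rfl) fun _ _ => rfl
  case zEq d i j =>
    exact hasForm_of_pure (k := .b) (fun m => decide (m.z i = m.z j)) rfl (fun _ => rfl) fun _ _ => rfl
  case gBit d i n =>
    exact hasForm_of_pure (k := .b) (fun m => (Γ.encG (m.g i)).testBit n) rfl (fun _ => rfl) fun _ _ => rfl
  case tBit d i n =>
    exact hasForm_of_pure (k := .b) (fun m => (Γ.encT (m.t i)).testBit n) rfl (fun _ => rfl) fun _ _ => rfl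
  case zBit d i n =>
    exact hasForm_of_pure (k := .b) (fun m => (m.z i).val.testBit n) rfl (fun _ => rfl) fun _ _ => rfl

theorem Instr.cost_rename (f : ℕ → ℕ) (i : Instr Γ) : (i.rename f).cost = i.cost := by
  cases i <;> simp [Instr.rename, Instr.cost]

def Prog.rename (f : ℕ → ℕ) (P : Prog Γ) : Prog Γ := P.map (Instr.rename f)

theorem Prog.cost_rename (f : ℕ → ℕ) (P : Prog Γ) : (P.rename f).cost = P.cost := by
  simp [Prog.rename, Prog.cost, Function.comp_def, Instr.cost_rename]

/-- By induction on the program. As `f` is injective, a write to `f d` is seen through `comap` as a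
write to `d` and nothing else, and the final `overlay` overwrites the register anyway. -/
theorem Prog.run_rename {f : ℕ → ℕ} (hf : Function.Injective f) (P : Prog Γ) (m : Mem Γ) :
    (P.rename f).run m = (P.run (m.comap f)).map (m.overlay f) := by
  induction P generalizing m with
  | nil =>
    simp only [rename, List.map_nil, run, PMF.pure_map]
    congr 1
    refine Mem.ext_get fun k j => ?_
    by_cases h : ∃ i, f i = j
    · obtain ⟨i, rfl⟩ := h
      rw [Mem.overlay_get_apply hf, Mem.comap, Mem.get_ofGet]
    · rw [Mem.overlay_get_of_ne _ _ _ (by simpa using h)]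
  | cons i P ih =>
    obtain ⟨k₀, d, F, -, h1, h2⟩ := i.exists_hasForm
    have hc : ∀ x, (m.set k₀ (f d) x).comap f = (m.comap f).set k₀ d x := by
      intro x
      refine Mem.ext_get fun k j => ?_
      rw [Mem.comap, Mem.get_ofGet]
      by_cases h : (k, j) = (k₀, d)
      · obtain ⟨rfl, rfl⟩ := Prod.mk.inj h
        rw [Mem.get_set_same, Mem.get_set_same]
      · rw [Mem.get_set_of_ne, Mem.get_set_of_ne, Mem.comap, Mem.get_ofGet]
        · exact h
        · intro h'
          rw [Prod.mk.injEq] at h'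
          exact h (Prod.ext h'.1 (hf h'.2))
    have ho : ∀ x, (m.set k₀ (f d) x).overlay f = m.overlay f := by
      intro x
      funext a
      refine Mem.ext_get fun k j => ?_
      by_cases h : ∃ i, f i = j
      · obtain ⟨i, rfl⟩ := h
        rw [Mem.overlay_get_apply hf, Mem.overlay_get_apply hf]
      · have h' : ∀ i, f i ≠ j := by simpa using h
        rw [Mem.overlay_get_of_ne _ _ _ h', Mem.overlay_get_of_ne _ _ _ h', Mem.get_set_of_ne]
        intro h2
        exact h' _ (Prod.mk.inj h2).2.symm
    have : (rename f (i :: P)).run m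
        = ((i.rename f).exec m).bind (rename f P).run := rfl
    rw [this, h2, run, h1, PMF.map_bind, PMF.bind_map, PMF.bind_map]
    congr 1
    funext x
    simp only [Function.comp]
    rw [ih, hc, ho]

theorem Prog.run_append (P Q : Prog Γ) (m : Mem Γ) :
    Prog.run (P ++ Q) m = (P.run m).bind Q.run := by
  induction P generalizing m with
  | nil => simp [run]
  | cons i P ih =>
    simp only [List.cons_append, run, PMF.bind_bind]
    congr 1
    funext m'
    exact ih m'

theorem Prog.cost_append (P Q : Prog Γ) : Prog.cost (P ++ Q) = P.cost + Q.cost := by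
  simp [Prog.cost]

/-- A program changes only the registers that it writes to. -/
theorem Prog.get_of_mem_support (P : Prog Γ) {m m' : Mem Γ} (h : m' ∈ (P.run m).support)
    {k : Kind} {i : ℕ} (hi : (k, i) ∉ P.map Instr.dst) : m'.get k i = m.get k i := by
  induction P generalizing m with
  | nil => simp only [run, PMF.support_pure, Set.mem_singleton_iff] at h; rw [h]
  | cons j P ih =>
    obtain ⟨k₀, d, F, h0, h1, -⟩ := j.exists_hasForm
    rw [List.map_cons, List.mem_cons, not_or, h0] at hi
    rw [run, h1, PMF.bind_map, PMF.mem_support_bind_iff] at h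
    obtain ⟨x, -, hx⟩ := h
    rw [ih hx hi.2, Mem.get_set_of_ne _ _ hi.1]

theorem Instr.one_le_cost (i : Instr Γ) : 1 ≤ i.cost := by
  cases i <;> simp [Instr.cost]

theorem Prog.length_le_cost (P : Prog Γ) : P.length ≤ P.cost := by
  induction P with
  | nil => simp
  | cons i P ih =>
    have := i.one_le_cost
    simp only [List.length_cons, Prog.cost, List.map_cons, List.sum_cons] at *
    omega

/-! ### Named registers -/

/-- An allocation of registers: named ones and auxiliary ones. -/
structure Layout (ι : Type) where
  reg : ι → ℕ
  tmp : ℕ → ℕ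
  reg_inj : Function.Injective reg
  tmp_inj : Function.Injective tmp
  reg_ne_tmp : ∀ x s, reg x ≠ tmp s

variable (Γ) in
/-- The contents of the named registers. -/
abbrev VM (ι : Type) : Type := (k : Kind) → ι → Val Γ k

variable {ι : Type}

def VM.set (v : VM Γ ι) (k : Kind) (x : ι) (a : Val Γ k) : VM Γ ι :=
  Function.update v k (Function.update (v k) x a)

@[simp] theorem VM.set_same (v : VM Γ ι) (k : Kind) (x : ι) (a : Val Γ k) : v.set k x a k x = a := by
  simp [VM.set]

theorem VM.set_of_ne (v : VM Γ ι) {k k' : Kind} {x x' : ι} (a : Val Γ k) (h : (k', x') ≠ (k, x)) :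
    v.set k x a k' x' = v k' x' := by
  by_cases hk : k' = k
  · subst hk
    have : x' ≠ x := fun h' => h (by rw [h'])
    simp [VM.set, this]
  · simp [VM.set, hk]

@[simp] theorem VM.set_ne_reg (v : VM Γ ι) {k k' : Kind} {x x' : ι} (a : Val Γ k) (h : x' ≠ x) :
    v.set k x a k' x' = v k' x' := VM.set_of_ne _ _ fun h' => h (Prod.mk.inj h').2

@[simp] theorem VM.set_ne_kind (v : VM Γ ι) {k k' : Kind} {x x' : ι} (a : Val Γ k) (h : k' ≠ k) :
    v.set k x a k' x' = v k' x' := VM.set_of_ne _ _ fun h' => h (Prod.mk.inj h').1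

variable (Λ : Layout ι)

def Layout.view (m : Mem Γ) : VM Γ ι := fun k x => m.get k (Λ.reg x)

theorem Layout.view_set_reg (m : Mem Γ) (k : Kind) (x : ι) (a : Val Γ k) :
    Λ.view (m.set k (Λ.reg x) a) = (Λ.view m).set k x a := by
  funext k' x'
  by_cases h : (k', x') = (k, x)
  · obtain ⟨rfl, rfl⟩ := Prod.mk.inj h
    simp [Layout.view]
  · rw [VM.set_of_ne _ _ h, Layout.view, Mem.get_set_of_ne]
    · rfl
    · intro h'
      rw [Prod.mk.injEq] at h'
      exact h (Prod.ext h'.1 (Λ.reg_inj h'.2))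

theorem Layout.view_set_tmp (m : Mem Γ) (k : Kind) (s : ℕ) (a : Val Γ k) :
    Λ.view (m.set k (Λ.tmp s) a) = Λ.view m := by
  funext k' x'
  rw [Layout.view, Mem.get_set_of_ne]
  · rfl
  · intro h'
    exact Λ.reg_ne_tmp _ _ (Prod.mk.inj h').2

/-- The named registers and the first `s` auxiliary ones are unchanged. -/
def Layout.Keeps (s : ℕ) (m m' : Mem Γ) : Prop :=
  Λ.view m' = Λ.view m ∧ ∀ k, ∀ r < s, m'.get k (Λ.tmp r) = m.get k (Λ.tmp r)

variable {Λ}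

theorem Layout.Keeps.trans {s s' : ℕ} {m m' m'' : Mem Γ} (h : Λ.Keeps s m m')
    (h' : Λ.Keeps s' m' m'') (hs : s ≤ s') : Λ.Keeps s m m'' :=
  ⟨h'.1.trans h.1, fun k r hr => (h'.2 k r (by omega)).trans (h.2 k r hr)⟩

theorem Layout.keeps_set_tmp (m : Mem Γ) (k : Kind) (s : ℕ) (a : Val Γ k) :
    Λ.Keeps s m (m.set k (Λ.tmp s) a) :=
  ⟨Λ.view_set_tmp m k s a, fun k' r hr => Mem.get_set_of_ne _ _ fun h' => by
    have := Λ.tmp_inj (Prod.mk.inj h').2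
    omega⟩

variable (Λ)

/-- The function `F` of the named registers can be evaluated in `n` steps, into an auxiliary
register, with the help of further auxiliary registers. -/
def CompN (n : ℕ) (k : Kind) (F : VM Γ ι → Val Γ k) : Prop :=
  ∀ s, ∃ P : Prog Γ, P.cost ≤ n ∧ ∀ m, ∃ m', P.run m = PMF.pure m' ∧
    m'.get k (Λ.tmp s) = F (Λ.view m) ∧ Λ.Keeps s m m'

/-- Some program of cost `n` acts as `κ` on the named registers. -/
def ImplN (n : ℕ) (κ : VM Γ ι → PMF (VM Γ ι)) : Prop :=
  ∃ P : Prog Γ, P.cost ≤ n ∧ ∀ m, (P.run m).map Λ.view = κ (Λ.view m)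

variable {Λ}

theorem CompN.mono {n n' : ℕ} {k : Kind} {F : VM Γ ι → Val Γ k} (h : CompN Λ n k F)
    (hn : n ≤ n') : CompN Λ n' k F := fun s => by
  obtain ⟨P, hP, h⟩ := h s
  exact ⟨P, hP.trans hn, h⟩

theorem ImplN.mono {n n' : ℕ} {κ : VM Γ ι → PMF (VM Γ ι)} (h : ImplN Λ n κ)
    (hn : n ≤ n') : ImplN Λ n' κ := by
  obtain ⟨P, hP, h⟩ := h
  exact ⟨P, hP.trans hn, h⟩

theorem Prog.run_singleton (i : Instr Γ) (m : Mem Γ) : Prog.run [i] m = i.exec m := by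
  simp only [Prog.run]
  exact PMF.bind_pure _

theorem Prog.cost_singleton (i : Instr Γ) : Prog.cost [i] = i.cost := by simp [Prog.cost]

theorem CompN.op₀ {k : Kind} (a : Val Γ k)
    (hI : ∀ d, ∃ I : Instr Γ, I.cost = 1 ∧ ∀ m, I.exec m = PMF.pure (m.set k d a)) :
    CompN Λ 1 k fun _ => a := by
  intro s
  obtain ⟨I, hc, hI⟩ := hI (Λ.tmp s)
  refine ⟨[I], by rw [Prog.cost_singleton, hc], fun m => ⟨m.set k (Λ.tmp s) a, ?_, by simp, Λ.keeps_set_tmp _ _ _ _⟩⟩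
  rw [Prog.run_singleton, hI]

theorem CompN.op₁ {k k₁ : Kind} {n : ℕ} {F : VM Γ ι → Val Γ k₁} (op : Val Γ k₁ → Val Γ k)
    (hI : ∀ d i, ∃ I : Instr Γ, I.cost = 1 ∧
      ∀ m, I.exec m = PMF.pure (m.set k d (op (m.get k₁ i)))) (h : CompN Λ n k₁ F) :
    CompN Λ (n + 1) k fun v => op (F v) := by
  intro s
  obtain ⟨I, hc, hI⟩ := hI (Λ.tmp s) (Λ.tmp s)
  obtain ⟨P, hP, h⟩ := h s
  refine ⟨P ++ [I], by rw [Prog.cost_append, Prog.cost_singleton, hc]; omega, fun m => ?_⟩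
  obtain ⟨m', h1, h2, h3⟩ := h m
  refine ⟨m'.set k (Λ.tmp s) (op (m'.get k₁ (Λ.tmp s))), ?_, by simp [h2],
    h3.trans (Λ.keeps_set_tmp _ _ _ _) le_rfl⟩
  rw [Prog.run_append, h1, PMF.pure_bind, Prog.run_singleton, hI]

/-- Auxiliary registers are used as a stack: the second operand is evaluated from level `s + 1` on
and therefore keeps the first operand, which waits at level `s`. -/
theorem CompN.op₂ {k k₁ k₂ : Kind} {n₁ n₂ : ℕ} {F₁ : VM Γ ι → Val Γ k₁} {F₂ : VM Γ ι → Val Γ k₂}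
    (op : Val Γ k₁ → Val Γ k₂ → Val Γ k)
    (hI : ∀ d i j, ∃ I : Instr Γ, I.cost = 1 ∧
      ∀ m, I.exec m = PMF.pure (m.set k d (op (m.get k₁ i) (m.get k₂ j))))
    (h₁ : CompN Λ n₁ k₁ F₁) (h₂ : CompN Λ n₂ k₂ F₂) :
    CompN Λ (n₁ + n₂ + 1) k fun v => op (F₁ v) (F₂ v) := by
  intro s
  obtain ⟨I, hc, hI⟩ := hI (Λ.tmp s) (Λ.tmp s) (Λ.tmp (s + 1))
  obtain ⟨P, hP, h⟩ := h₁ s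
  obtain ⟨Q, hQ, h'⟩ := h₂ (s + 1)
  refine ⟨P ++ (Q ++ [I]), by
    rw [Prog.cost_append, Prog.cost_append, Prog.cost_singleton, hc]; omega, fun m => ?_⟩
  obtain ⟨m', h1, h2, h3⟩ := h m
  obtain ⟨m'', h1', h2', h3'⟩ := h' m'
  refine ⟨m''.set k (Λ.tmp s) (op (m''.get k₁ (Λ.tmp s)) (m''.get k₂ (Λ.tmp (s + 1)))), ?_, ?_,
    (h3.trans h3' (by omega)).trans (Λ.keeps_set_tmp _ _ _ _) le_rfl⟩
  · rw [Prog.run_append, h1, PMF.pure_bind, Prog.run_append, h1', PMF.pure_bind,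
      Prog.run_singleton, hI]
  · rw [Mem.get_set_same, h2', h3'.2 _ s (by omega), h2, h3.1]

theorem CompN.op₃ {k k₁ k₂ k₃ : Kind} {n₁ n₂ n₃ : ℕ} {F₁ : VM Γ ι → Val Γ k₁}
    {F₂ : VM Γ ι → Val Γ k₂} {F₃ : VM Γ ι → Val Γ k₃}
    (op : Val Γ k₁ → Val Γ k₂ → Val Γ k₃ → Val Γ k)
    (hI : ∀ d i j l, ∃ I : Instr Γ, I.cost = 1 ∧
      ∀ m, I.exec m = PMF.pure (m.set k d (op (m.get k₁ i) (m.get k₂ j) (m.get k₃ l))))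
    (h₁ : CompN Λ n₁ k₁ F₁) (h₂ : CompN Λ n₂ k₂ F₂) (h₃ : CompN Λ n₃ k₃ F₃) :
    CompN Λ (n₁ + n₂ + n₃ + 1) k fun v => op (F₁ v) (F₂ v) (F₃ v) := by
  intro s
  obtain ⟨I, hc, hI⟩ := hI (Λ.tmp s) (Λ.tmp s) (Λ.tmp (s + 1)) (Λ.tmp (s + 2))
  obtain ⟨P, hP, h⟩ := h₁ s
  obtain ⟨Q, hQ, h'⟩ := h₂ (s + 1)
  obtain ⟨S, hS, h''⟩ := h₃ (s + 2)
  refine ⟨P ++ (Q ++ (S ++ [I])), by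
    rw [Prog.cost_append, Prog.cost_append, Prog.cost_append, Prog.cost_singleton, hc]; omega,
    fun m => ?_⟩
  obtain ⟨m₁, e1, a1, b1⟩ := h m
  obtain ⟨m₂, e2, a2, b2⟩ := h' m₁
  obtain ⟨m₃, e3, a3, b3⟩ := h'' m₂
  refine ⟨m₃.set k (Λ.tmp s) (op (m₃.get k₁ (Λ.tmp s)) (m₃.get k₂ (Λ.tmp (s + 1)))
    (m₃.get k₃ (Λ.tmp (s + 2)))), ?_, ?_,
    ((b1.trans b2 (by omega)).trans b3 (by omega)).trans (Λ.keeps_set_tmp _ _ _ _) le_rfl⟩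
  · rw [Prog.run_append, e1, PMF.pure_bind, Prog.run_append, e2, PMF.pure_bind, Prog.run_append, e3,
      PMF.pure_bind, Prog.run_singleton, hI]
  · rw [Mem.get_set_same, a3, b3.2 _ s (by omega), b3.2 _ (s + 1) (by omega), a2,
      b2.2 _ s (by omega), a1, b2.1, b1.1]

/-- Copying a register. -/
theorem exists_copy (k : Kind) (d i : ℕ) : ∃ P : Prog Γ, P.cost ≤ 2 ∧
    ∀ m, P.run m = PMF.pure (m.set k d (m.get k i)) := by
  cases k
  case g =>
    exact ⟨[.gSel d 0 i i], by simp [Prog.cost, Instr.cost], fun m => by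
      rw [Prog.run_singleton, Instr.exec, ite_self]; rfl⟩
  case t =>
    exact ⟨[.tSel d 0 i i], by simp [Prog.cost, Instr.cost], fun m => by
      rw [Prog.run_singleton, Instr.exec, ite_self]; rfl⟩
  case z =>
    exact ⟨[.zSel d 0 i i], by simp [Prog.cost, Instr.cost], fun m => by
      rw [Prog.run_singleton, Instr.exec, ite_self]; rfl⟩
  case b =>
    -- There is no selection instruction for bits; a double negation copies them.
    refine ⟨[.bNand d i i, .bNand d d d], by simp [Prog.cost, Instr.cost], fun m => ?_⟩
    simp only [Prog.run, Instr.exec, PMF.pure_bind]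
    congr 1
    simp [Mem.setB, Mem.set, Mem.get]

theorem CompN.reg (k : Kind) (x : ι) : CompN Λ 2 k fun v : VM Γ ι => v k x := by
  intro s
  obtain ⟨P, hP, h⟩ := exists_copy (Γ := Γ) k (Λ.tmp s) (Λ.reg x)
  exact ⟨P, hP, fun m => ⟨_, h m, by simp [Layout.view], Λ.keeps_set_tmp _ _ _ _⟩⟩

/-- Parallel assignment. -/
theorem ImplN.assign_aux (n : ℕ) (W : List (Kind × ι)) (Φ : VM Γ ι → VM Γ ι)
    (hC : ∀ k x, (k, x) ∈ W → CompN Λ n k fun v => Φ v k x) (s : ℕ) :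
    ∃ P : Prog Γ, P.cost ≤ W.length * (n + 2) ∧ ∀ m, ∃ m', P.run m = PMF.pure m' ∧
      (Λ.view m' = fun k x => if (k, x) ∈ W then Φ (Λ.view m) k x else Λ.view m k x) ∧
      ∀ k, ∀ r < s, m'.get k (Λ.tmp r) = m.get k (Λ.tmp r) := by
  induction W generalizing s with
  | nil => exact ⟨[], by simp [Prog.cost], fun m => ⟨m, rfl, by simp, fun _ _ _ => rfl⟩⟩
  | cons y W ih =>
    obtain ⟨k, x⟩ := y
    obtain ⟨P, hP, h⟩ := hC k x (by simp) s
    obtain ⟨Q, hQ, h'⟩ := ih (fun k x hx => hC k x (by simp [hx])) (s + 1)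
    obtain ⟨S, hS, h''⟩ := exists_copy (Γ := Γ) k (Λ.reg x) (Λ.tmp s)
    -- By this nesting all evaluations precede all copies, so every right-hand side is read in the
    -- old state. The value for the head of the list is kept at level `s`, which `Q` does not touch.
    refine ⟨P ++ (Q ++ S), ?_, fun m => ?_⟩
    · rw [Prog.cost_append, Prog.cost_append, List.length_cons, add_mul]
      omega
    · obtain ⟨m₁, e1, a1, b1⟩ := h m
      obtain ⟨m₂, e2, a2, b2⟩ := h' m₁
      refine ⟨m₂.set k (Λ.reg x) (m₂.get k (Λ.tmp s)), ?_, ?_, fun k' r hr => ?_⟩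
      · rw [Prog.run_append, e1, PMF.pure_bind, Prog.run_append, e2, PMF.pure_bind, h'']
      · rw [Layout.view_set_reg, b2 k s (by omega), a1, a2, b1.1]
        funext k' x'
        by_cases hx : (k', x') = (k, x)
        · obtain ⟨rfl, rfl⟩ := Prod.mk.inj hx
          simp
        · rw [VM.set_of_ne _ _ hx]
          simp only [List.mem_cons, hx, false_or]
      · rw [Mem.get_set_of_ne, b2 k' r (by omega), b1.2 k' r hr]
        intro h'
        exact Λ.reg_ne_tmp _ _ (Prod.mk.inj h').2.symm

theorem ImplN.assign (n : ℕ) (W : List (Kind × ι)) (Φ : VM Γ ι → VM Γ ι)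
    (hW : ∀ v k x, (k, x) ∉ W → Φ v k x = v k x)
    (hC : ∀ k x, (k, x) ∈ W → CompN Λ n k fun v => Φ v k x) :
    ImplN Λ (W.length * (n + 2)) fun v => PMF.pure (Φ v) := by
  obtain ⟨P, hP, h⟩ := ImplN.assign_aux n W Φ hC 0
  refine ⟨P, hP, fun m => ?_⟩
  obtain ⟨m', h1, h2, -⟩ := h m
  rw [h1, PMF.pure_map, h2]
  congr 1
  funext k x
  split_ifs with hx
  · rfl
  · exact (hW _ _ _ hx).symm

theorem ImplN.seq {n n' : ℕ} {κ κ' : VM Γ ι → PMF (VM Γ ι)} (h : ImplN Λ n κ)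
    (h' : ImplN Λ n' κ') : ImplN Λ (n + n') fun v => (κ v).bind κ' := by
  obtain ⟨P, hP, h⟩ := h
  obtain ⟨Q, hQ, h'⟩ := h'
  refine ⟨P ++ Q, by rw [Prog.cost_append]; omega, fun m => ?_⟩
  rw [Prog.run_append, PMF.map_bind]
  simp only [← h, PMF.bind_map]
  congr 1
  funext m'
  exact h' m'

theorem ImplN.skip : ImplN Λ 0 fun v : VM Γ ι => PMF.pure v :=
  ⟨[], by simp [Prog.cost], fun m => by simp [Prog.run, PMF.pure_map]⟩

theorem ImplN.instr {I : Instr Γ} {κ : VM Γ ι → PMF (VM Γ ι)} (hc : I.cost = 1)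
    (h : ∀ m, (I.exec m).map Λ.view = κ (Λ.view m)) : ImplN Λ 1 κ :=
  ⟨[I], by simp [Prog.cost, hc], fun m => by rw [Prog.run_singleton, h]⟩

theorem ImplN.rand (x : ι) :
    ImplN Λ 1 fun v : VM Γ ι => (unif Γ.Z).map fun a => v.set .z x a :=
  ImplN.instr (I := .zRand (Λ.reg x)) rfl fun m => by
    rw [Instr.exec, PMF.map_comp]
    congr 1
    funext a
    exact Λ.view_set_reg m .z x a

variable (Γ) in
/-- A random nonzero exponent. -/
def unitZ : PMF Γ.Z := (unif Γ.Zˣ).map Units.val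

theorem ImplN.randUnit (x : ι) :
    ImplN Λ 1 fun v : VM Γ ι => (unitZ Γ).map fun a => v.set .z x a :=
  ImplN.instr (I := .zRandUnit (Λ.reg x)) rfl fun m => by
    have : Instr.exec m (.zRandUnit (Λ.reg x)) = (unitZ Γ).map fun a => m.setZ (Λ.reg x) a := rfl
    rw [this, PMF.map_comp]
    congr 1
    funext a
    exact Λ.view_set_reg m .z x a

theorem ImplN.coin (x : ι) :
    ImplN Λ 1 fun v : VM Γ ι => (unif Bool).map fun a => v.set .b x a :=
  ImplN.instr (I := .bRand (Λ.reg x)) rfl fun m => by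
    rw [Instr.exec, PMF.map_comp]
    congr 1
    funext a
    exact Λ.view_set_reg m .b x a

/-- A kernel iterated `r` times. -/
def iter {σ : Type} (κ : ℕ → σ → PMF σ) : ℕ → σ → PMF σ
  | 0, v => PMF.pure v
  | r + 1, v => (iter κ r v).bind (κ r)

theorem ImplN.iter {n : ℕ} {κ : ℕ → VM Γ ι → PMF (VM Γ ι)} (r : ℕ)
    (h : ∀ i < r, ImplN Λ n (κ i)) : ImplN Λ (r * n) (iter κ r) := by
  induction r with
  | zero => exact ImplN.skip.mono (by simp)
  | succ r ih =>
    have := (ih fun i hi => h i (by omega)).seq (h r (by omega))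
    exact this.mono (by rw [add_mul, one_mul])

/-- The part of the memory that is stored in the registers `A 0, A 1, …`. -/
def VM.pull (A : ℕ → ι) (v : VM Γ ι) : Mem Γ := Mem.ofGet fun k i => v k (A i)

def VM.push (A : ℕ → ι) (v : VM Γ ι) (a : Mem Γ) : VM Γ ι :=
  fun k x => if h : ∃ i, A i = x then a.get k h.choose else v k x

theorem VM.push_apply {A : ℕ → ι} (hA : Function.Injective A) (v : VM Γ ι) (a : Mem Γ) (k : Kind)
    (i : ℕ) : v.push A a k (A i) = a.get k i := by
  have h : ∃ j, A j = A i := ⟨i, rfl⟩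
  rw [push, dif_pos h, hA h.choose_spec]

theorem VM.push_of_ne {A : ℕ → ι} (v : VM Γ ι) (a : Mem Γ) (k : Kind)
    {x : ι} (h : ∀ i, A i ≠ x) : v.push A a k x = v k x := by
  rw [push, dif_neg (by simpa using h)]

/-- A foreign program is simulated by renaming its registers into the block `A`; this is how the
adversary is run inside a reduction. -/
theorem ImplN.prog {A : ℕ → ι} (hA : Function.Injective A) (P : Prog Γ) :
    ImplN Λ P.cost fun v => (P.run (v.pull A)).map (v.push A) := by
  have hf : Function.Injective fun i => Λ.reg (A i) := Λ.reg_inj.comp hA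
  refine ⟨P.rename fun i => Λ.reg (A i), by rw [Prog.cost_rename], fun m => ?_⟩
  rw [Prog.run_rename hf, PMF.map_comp]
  congr 1
  funext a k x
  simp only [Function.comp, Layout.view]
  by_cases h : ∃ i, A i = x
  · obtain ⟨i, rfl⟩ := h
    rw [VM.push_apply hA]
    exact Mem.overlay_get_apply hf m a k i
  · have h' : ∀ i, A i ≠ x := by simpa using h
    rw [VM.push_of_ne _ _ _ h']
    exact Mem.overlay_get_of_ne _ _ _ fun i hi => h' i (Λ.reg_inj hi)

end AIBBE

end

noncomputable section

namespace AIBBE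

open Classical

variable {Γ : BilinearGroup} {ι : Type} {Λ : Layout ι}

/-! ### Functions and kernels computable at polynomial cost -/

variable (Λ) in
/-- `F` can be evaluated at cost `X ^ c`. -/
def Comp (X c : ℕ) (k : Kind) (F : VM Γ ι → Val Γ k) : Prop := CompN Λ (X ^ c) k F

variable (Λ) in
/-- The predicate `p` can be decided at cost `X ^ c`. -/
def CompP (X c : ℕ) (p : VM Γ ι → Prop) : Prop :=
  Comp Λ X c .b fun v => @decide (p v) (propDecidable _)

variable (Λ) in
/-- The kernel `κ` can be implemented at cost `X ^ c`. -/
def Impl (X c : ℕ) (κ : VM Γ ι → PMF (VM Γ ι)) : Prop := ImplN Λ (X ^ c) κ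

variable {X : ℕ} [hX : Fact (2 ≤ X)] {a b c : ℕ}

theorem pow_le_of_le {X : ℕ} [hX : Fact (2 ≤ X)] {a b : ℕ} (h : a ≤ b) : X ^ a ≤ X ^ b :=
  Nat.pow_le_pow_right (by have := hX.out; omega) h

theorem one_le_pow_of_fact (X a : ℕ) [hX : Fact (2 ≤ X)] : 1 ≤ X ^ a :=
  Nat.one_le_pow _ _ (by have := hX.out; omega)

/-- As `X ≥ 2`, constant factors are absorbed by a bounded increase of the exponent. Costs are thus
tracked by exponents alone, independently of the adversary and of the group. -/
theorem four_mul_pow_le (X a : ℕ) [hX : Fact (2 ≤ X)] : 4 * X ^ a ≤ X ^ (a + 2) := by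
  have : 4 ≤ X ^ 2 := by have := Nat.pow_le_pow_left hX.out 2; omega
  calc 4 * X ^ a ≤ X ^ 2 * X ^ a := Nat.mul_le_mul_right _ this
    _ = _ := by ring

theorem Comp.mono {k : Kind} {F : VM Γ ι → Val Γ k} (h : Comp Λ X a k F) (hab : a ≤ b) :
    Comp Λ X b k F := CompN.mono h (pow_le_of_le hab)

theorem CompP.mono {p : VM Γ ι → Prop} (h : CompP Λ X a p) (hab : a ≤ b) : CompP Λ X b p :=
  Comp.mono h hab

theorem Impl.mono {κ : VM Γ ι → PMF (VM Γ ι)} (h : Impl Λ X a κ) (hab : a ≤ b) : Impl Λ X b κ :=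
  ImplN.mono h (pow_le_of_le hab)

omit hX in
theorem Comp.op₀ {k : Kind} (x : Val Γ k)
    (hI : ∀ d, ∃ I : Instr Γ, I.cost = 1 ∧ ∀ m, I.exec m = PMF.pure (m.set k d x)) :
    Comp Λ X 0 k fun _ => x := CompN.mono (CompN.op₀ x hI) (by simp)

theorem Comp.op₁ {k k₁ : Kind} {F : VM Γ ι → Val Γ k₁} (op : Val Γ k₁ → Val Γ k)
    (hI : ∀ d i, ∃ I : Instr Γ, I.cost = 1 ∧
      ∀ m, I.exec m = PMF.pure (m.set k d (op (m.get k₁ i)))) (h : Comp Λ X a k₁ F) :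
    Comp Λ X (a + 2) k fun v => op (F v) :=
  CompN.mono (CompN.op₁ op hI h) <| by
    have := one_le_pow_of_fact X a
    have := four_mul_pow_le X a
    omega

theorem Comp.op₂ {k k₁ k₂ : Kind} {F₁ : VM Γ ι → Val Γ k₁} {F₂ : VM Γ ι → Val Γ k₂}
    (op : Val Γ k₁ → Val Γ k₂ → Val Γ k)
    (hI : ∀ d i j, ∃ I : Instr Γ, I.cost = 1 ∧
      ∀ m, I.exec m = PMF.pure (m.set k d (op (m.get k₁ i) (m.get k₂ j))))
    (h₁ : Comp Λ X a k₁ F₁) (h₂ : Comp Λ X b k₂ F₂) :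
    Comp Λ X (max a b + 2) k fun v => op (F₁ v) (F₂ v) :=
  CompN.mono (CompN.op₂ op hI h₁ h₂) <| by
    have := one_le_pow_of_fact X (max a b)
    have := four_mul_pow_le X (max a b)
    have := pow_le_of_le (X := X) (le_max_left a b)
    have := pow_le_of_le (X := X) (le_max_right a b)
    omega

theorem Comp.op₃ {k k₁ k₂ k₃ : Kind} {F₁ : VM Γ ι → Val Γ k₁}
    {F₂ : VM Γ ι → Val Γ k₂} {F₃ : VM Γ ι → Val Γ k₃}
    (op : Val Γ k₁ → Val Γ k₂ → Val Γ k₃ → Val Γ k)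
    (hI : ∀ d i j l, ∃ I : Instr Γ, I.cost = 1 ∧
      ∀ m, I.exec m = PMF.pure (m.set k d (op (m.get k₁ i) (m.get k₂ j) (m.get k₃ l))))
    (h₁ : Comp Λ X a k₁ F₁) (h₂ : Comp Λ X b k₂ F₂) (h₃ : Comp Λ X c k₃ F₃) :
    Comp Λ X (max a (max b c) + 2) k fun v => op (F₁ v) (F₂ v) (F₃ v) :=
  CompN.mono (CompN.op₃ op hI h₁ h₂ h₃) <| by
    have := one_le_pow_of_fact X (max a (max b c))
    have := four_mul_pow_le X (max a (max b c))
    have := pow_le_of_le (X := X) (le_max_left a (max b c))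
    have := pow_le_of_le (X := X) ((le_max_left b c).trans (le_max_right a (max b c)))
    have := pow_le_of_le (X := X) ((le_max_right b c).trans (le_max_right a (max b c)))
    omega

theorem Comp.reg (k : Kind) (x : ι) : Comp Λ X 1 k fun v : VM Γ ι => v k x :=
  CompN.mono (CompN.reg k x) (by have := hX.out; simpa using this)

section Operations

variable {F F' : VM Γ ι → Γ.G} {T T' : VM Γ ι → Γ.GT} {Z Z' : VM Γ ι → Γ.Z}
  {B B' : VM Γ ι → Bool} {p q : VM Γ ι → Prop}

omit hX in
theorem Comp.constG (x : Γ.G) : Comp Λ X 0 .g fun _ : VM Γ ι => x :=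
  Comp.op₀ (k := .g) x fun d => ⟨.gConst d x, rfl, fun _ => rfl⟩

omit hX in
theorem Comp.constT (x : Γ.GT) : Comp Λ X 0 .t fun _ : VM Γ ι => x :=
  Comp.op₀ (k := .t) x fun d => ⟨.tConst d x, rfl, fun _ => rfl⟩

omit hX in
theorem Comp.constZ (x : Γ.Z) : Comp Λ X 0 .z fun _ : VM Γ ι => x :=
  Comp.op₀ (k := .z) x fun d => ⟨.zConst d x, rfl, fun _ => rfl⟩

omit hX in
theorem Comp.constB (x : Bool) : Comp Λ X 0 .b fun _ : VM Γ ι => x :=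
  Comp.op₀ (k := .b) x fun d => ⟨.bConst d x, rfl, fun _ => rfl⟩

theorem Comp.mulG (h : Comp Λ X a .g F) (h' : Comp Λ X b .g F') :
    Comp Λ X (max a b + 2) .g fun v => F v * F' v :=
  Comp.op₂ (k := .g) (k₁ := .g) (k₂ := .g) (fun x y : Γ.G => x * y)
    (fun d i j => ⟨.gMul d i j, rfl, fun _ => rfl⟩) h h'

theorem Comp.pwG (h : Comp Λ X a .g F) (h' : Comp Λ X b .z Z) :
    Comp Λ X (max a b + 2) .g fun v => pw (F v) (Z v) :=
  Comp.op₂ (k := .g) (k₁ := .g) (k₂ := .z) (fun (x : Γ.G) (y : Γ.Z) => pw x y)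
    (fun d i j => ⟨.gPow d i j, rfl, fun _ => rfl⟩) h h'

theorem Comp.mulT (h : Comp Λ X a .t T) (h' : Comp Λ X b .t T') :
    Comp Λ X (max a b + 2) .t fun v => T v * T' v :=
  Comp.op₂ (k := .t) (k₁ := .t) (k₂ := .t) (fun x y : Γ.GT => x * y)
    (fun d i j => ⟨.tMul d i j, rfl, fun _ => rfl⟩) h h'

theorem Comp.pwT (h : Comp Λ X a .t T) (h' : Comp Λ X b .z Z) :
    Comp Λ X (max a b + 2) .t fun v => pw (T v) (Z v) :=
  Comp.op₂ (k := .t) (k₁ := .t) (k₂ := .z) (fun (x : Γ.GT) (y : Γ.Z) => pw x y)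
    (fun d i j => ⟨.tPow d i j, rfl, fun _ => rfl⟩) h h'

theorem Comp.pair (h : Comp Λ X a .g F) (h' : Comp Λ X b .g F') :
    Comp Λ X (max a b + 2) .t fun v => Γ.e (F v) (F' v) :=
  Comp.op₂ (k := .t) (k₁ := .g) (k₂ := .g) (fun x y : Γ.G => Γ.e x y)
    (fun d i j => ⟨.pair d i j, rfl, fun _ => rfl⟩) h h'

theorem Comp.addZ (h : Comp Λ X a .z Z) (h' : Comp Λ X b .z Z') :
    Comp Λ X (max a b + 2) .z fun v => Z v + Z' v :=
  Comp.op₂ (k := .z) (k₁ := .z) (k₂ := .z) (fun x y : Γ.Z => x + y)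
    (fun d i j => ⟨.zAdd d i j, rfl, fun _ => rfl⟩) h h'

theorem Comp.mulZ (h : Comp Λ X a .z Z) (h' : Comp Λ X b .z Z') :
    Comp Λ X (max a b + 2) .z fun v => Z v * Z' v :=
  Comp.op₂ (k := .z) (k₁ := .z) (k₂ := .z) (fun x y : Γ.Z => x * y)
    (fun d i j => ⟨.zMul d i j, rfl, fun _ => rfl⟩) h h'

theorem Comp.negZ (h : Comp Λ X a .z Z) : Comp Λ X (a + 2) .z fun v => -Z v :=
  Comp.op₁ (k := .z) (k₁ := .z) (fun x : Γ.Z => -x)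
    (fun d i => ⟨.zNeg d i, rfl, fun _ => rfl⟩) h

theorem Comp.subZ (h : Comp Λ X a .z Z) (h' : Comp Λ X b .z Z') :
    Comp Λ X (max a (b + 2) + 2) .z fun v => Z v - Z' v := by
  simpa only [sub_eq_add_neg] using h.addZ h'.negZ

theorem Comp.invZ (h : Comp Λ X a .z Z) : Comp Λ X (a + 2) .z fun v => (Z v)⁻¹ :=
  Comp.op₁ (k := .z) (k₁ := .z) (fun x : Γ.Z => x⁻¹)
    (fun d i => ⟨.zInv d i, rfl, fun _ => rfl⟩) h

theorem Comp.divZ (h : Comp Λ X a .z Z) (h' : Comp Λ X b .z Z') :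
    Comp Λ X (max a (b + 2) + 2) .z fun v => Z v / Z' v := by
  simpa only [div_eq_mul_inv] using h.mulZ h'.invZ

theorem Comp.nand (h : Comp Λ X a .b B) (h' : Comp Λ X b .b B') :
    Comp Λ X (max a b + 2) .b fun v => !(B v && B' v) :=
  Comp.op₂ (k := .b) (k₁ := .b) (k₂ := .b) (fun x y : Bool => !(x && y))
    (fun d i j => ⟨.bNand d i j, rfl, fun _ => rfl⟩) h h'

omit hX in
theorem Comp.ofP [∀ v, Decidable (p v)] (h : CompP Λ X a p) :
    Comp Λ X a .b fun v => decide (p v) := by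
  unfold CompP at h
  convert h

omit hX in
theorem CompP.isTrue (h : Comp Λ X a .b B) : CompP Λ X a fun v => B v = true := by
  unfold CompP
  convert h using 2 with v
  simp

theorem CompP.reg (x : ι) : CompP Λ X 1 fun v : VM Γ ι => v .b x = true :=
  CompP.isTrue (B := fun v => v .b x) (Comp.reg .b x)

theorem CompP.eqG (h : Comp Λ X a .g F) (h' : Comp Λ X b .g F') :
    CompP Λ X (max a b + 2) fun v => F v = F' v :=
  Comp.op₂ (k := .b) (k₁ := .g) (k₂ := .g) (fun x y : Γ.G => @decide (x = y) (propDecidable _))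
    (fun d i j => ⟨.gEq d i j, rfl, fun _ => rfl⟩) h h'

theorem CompP.eqZ (h : Comp Λ X a .z Z) (h' : Comp Λ X b .z Z') :
    CompP Λ X (max a b + 2) fun v => Z v = Z' v := by
  have := Comp.op₂ (k := .b) (k₁ := .z) (k₂ := .z) (fun x y : Γ.Z => decide (x = y))
    (fun d i j => ⟨.zEq d i j, rfl, fun _ => rfl⟩) h h'
  unfold CompP
  convert this

theorem CompP.not (h : CompP Λ X a p) : CompP Λ X (a + 2) fun v => ¬p v := by
  have := Comp.nand h h
  rw [max_self] at this
  unfold CompP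
  convert this using 2 with v
  by_cases h : p v <;> simp [h]

theorem CompP.nand (h : CompP Λ X a p) (h' : CompP Λ X b q) :
    CompP Λ X (max a b + 2) fun v => ¬(p v ∧ q v) := by
  have := Comp.nand h h'
  unfold CompP
  convert this using 2 with v
  by_cases h : p v <;> by_cases h' : q v <;> simp [h, h']

theorem CompP.and (h : CompP Λ X a p) (h' : CompP Λ X b q) :
    CompP Λ X (max a b + 4) fun v => p v ∧ q v := by
  simpa only [not_not] using (h.nand h').not

theorem CompP.or (h : CompP Λ X a p) (h' : CompP Λ X b q) :
    CompP Λ X (max a b + 4) fun v => p v ∨ q v := by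
  have := h.not.nand h'.not
  simp only [not_and_or, not_not] at this
  exact this.mono (by omega)

theorem Comp.ite (k : Kind) {F F' : VM Γ ι → Val Γ k} [∀ v, Decidable (p v)]
    (hp : CompP Λ X a p) (h : Comp Λ X b k F) (h' : Comp Λ X c k F') :
    Comp Λ X (max a (max b c) + 6) k fun v => if p v then F v else F' v := by
  have e : ∀ (k : Kind) {F F' : VM Γ ι → Val Γ k},
      Comp Λ X (max a (max b c) + 2) k
        (fun v => if @decide (p v) (propDecidable _) = true then F v else F' v) →
      Comp Λ X (max a (max b c) + 6) k fun v => if p v then F v else F' v := by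
    intro k F F' h
    refine Comp.mono ?_ (show max a (max b c) + 2 ≤ _ by omega)
    convert h using 2 with v
    by_cases h : p v <;> simp [h]
  cases k
  case g =>
    exact e .g (Comp.op₃ (k := .g) (k₁ := .b) (k₂ := .g) (k₃ := .g)
      (fun (c : Bool) (x y : Γ.G) => if c = true then x else y)
      (fun d i j l => ⟨.gSel d i j l, rfl, fun _ => rfl⟩) hp h h')
  case t =>
    exact e .t (Comp.op₃ (k := .t) (k₁ := .b) (k₂ := .t) (k₃ := .t)
      (fun (c : Bool) (x y : Γ.GT) => if c = true then x else y)
      (fun d i j l => ⟨.tSel d i j l, rfl, fun _ => rfl⟩) hp h h')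
  case z =>
    exact e .z (Comp.op₃ (k := .z) (k₁ := .b) (k₂ := .z) (k₃ := .z)
      (fun (c : Bool) (x y : Γ.Z) => if c = true then x else y)
      (fun d i j l => ⟨.zSel d i j l, rfl, fun _ => rfl⟩) hp h h')
  -- Selection between bits is expressed by NAND gates: (p NAND F) NAND (¬p NAND F').
  case b =>
    have h1 : CompP Λ X b fun v => F v = true := CompP.isTrue (B := F) h
    have h2 : CompP Λ X c fun v => F' v = true := CompP.isTrue (B := F') h'
    have := (hp.nand h1).nand (hp.not.nand h2)
    refine Comp.mono ?_ (show _ ≤ max a (max b c) + 6 by omega)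
      (a := max (max a b + 2) (max (a + 2) c + 2) + 2)
    unfold CompP at this
    convert this using 2 with v
    by_cases h : p v <;> cases hF : F v <;> cases hF' : F' v <;> simp [h] <;> assumption

/-- A finite iteration of a binary operation. -/
theorem CompN.fold {k : Kind} {n n₀ : ℕ} (e : Val Γ k) (op : Val Γ k → Val Γ k → Val Γ k)
    (he : CompN Λ n₀ k fun _ : VM Γ ι => e)
    (hop : ∀ {m m' : ℕ} {F F' : VM Γ ι → Val Γ k}, CompN Λ m k F → CompN Λ m' k F' →
      CompN Λ (m + m' + 2) k fun v => op (F v) (F' v))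
    (G : ℕ → VM Γ ι → Val Γ k) (r : ℕ) (hG : ∀ i < r, CompN Λ n k (G i)) (H : ℕ → VM Γ ι → Val Γ k)
    (h0 : ∀ v, H 0 v = e) (hs : ∀ i v, H (i + 1) v = op (H i v) (G i v)) :
    CompN Λ (r * (n + 2) + n₀) k (H r) := by
  induction r with
  | zero =>
    have : H 0 = fun _ => e := funext h0
    rw [this]
    exact he.mono (by omega)
  | succ r ih =>
    have : H (r + 1) = fun v => op (H r v) (G r v) := funext (hs r)
    rw [this]
    exact (hop (ih fun i hi => hG i (by omega)) (hG r (by omega))).mono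
      (by rw [add_mul, one_mul]; omega)

theorem fold_cost_le {r : ℕ} (hr : r ≤ X) (a : ℕ) : r * (X ^ a + 2) + 1 ≤ X ^ (a + 3) := by
  have h1 := one_le_pow_of_fact X a
  have h2 := one_le_pow_of_fact X (a + 1)
  have h3 := four_mul_pow_le X (a + 1)
  have : r * (X ^ a + 2) ≤ X * (X ^ a + 2 * X ^ a) := Nat.mul_le_mul hr (by omega)
  have e : X * (X ^ a + 2 * X ^ a) = 3 * X ^ (a + 1) := by ring
  rw [show a + 3 = a + 1 + 2 by omega]
  omega

theorem Comp.prodG {G : ℕ → VM Γ ι → Γ.G} {r : ℕ} (hr : r ≤ X)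
    (h : ∀ i < r, Comp Λ X a .g (G i)) :
    Comp Λ X (a + 3) .g fun v => ∏ i ∈ Finset.range r, G i v :=
  CompN.mono (CompN.fold (k := .g) (n₀ := 1) (1 : Γ.G) (fun x y : Γ.G => x * y)
    (by simpa using show CompN Λ (X ^ 0) .g _ from Comp.constG (X := X) (Λ := Λ) (1 : Γ.G))
    (fun h h' => (CompN.op₂ (k := .g) (k₁ := .g) (k₂ := .g) (fun x y : Γ.G => x * y)
      (fun d i j => ⟨.gMul d i j, rfl, fun _ => rfl⟩) h h').mono (by omega)) G r h
    (fun r v => ∏ i ∈ Finset.range r, G i v) (fun _ => by simp)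
    (fun i v => Finset.prod_range_succ _ _)) (fold_cost_le hr a)

theorem Comp.sumZ {G : ℕ → VM Γ ι → Γ.Z} {r : ℕ} (hr : r ≤ X)
    (h : ∀ i < r, Comp Λ X a .z (G i)) :
    Comp Λ X (a + 3) .z fun v => ∑ i ∈ Finset.range r, G i v :=
  CompN.mono (CompN.fold (k := .z) (n₀ := 1) (0 : Γ.Z) (fun x y : Γ.Z => x + y)
    (by simpa using show CompN Λ (X ^ 0) .z _ from Comp.constZ (X := X) (Λ := Λ) (0 : Γ.Z))
    (fun h h' => (CompN.op₂ (k := .z) (k₁ := .z) (k₂ := .z) (fun x y : Γ.Z => x + y)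
      (fun d i j => ⟨.zAdd d i j, rfl, fun _ => rfl⟩) h h').mono (by omega)) G r h
    (fun r v => ∑ i ∈ Finset.range r, G i v) (fun _ => by simp)
    (fun i v => Finset.sum_range_succ _ _)) (fold_cost_le hr a)

theorem Comp.powZ {r : ℕ} (hr : r ≤ X) (h : Comp Λ X a .z Z) :
    Comp Λ X (a + 3) .z fun v => Z v ^ r :=
  CompN.mono (CompN.fold (k := .z) (n₀ := 1) (1 : Γ.Z) (fun x y : Γ.Z => x * y)
    (by simpa using show CompN Λ (X ^ 0) .z _ from Comp.constZ (X := X) (Λ := Λ) (1 : Γ.Z))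
    (fun h h' => (CompN.op₂ (k := .z) (k₁ := .z) (k₂ := .z) (fun x y : Γ.Z => x * y)
      (fun d i j => ⟨.zMul d i j, rfl, fun _ => rfl⟩) h h').mono (by omega)) (fun _ => Z) r (fun _ _ => h)
    (fun r v => Z v ^ r) (fun _ => by simp)
    (fun i v => pow_succ _ _)) (fold_cost_le hr a)

theorem CompP.exists_lt {q : ℕ → VM Γ ι → Prop} {r : ℕ} (hr : r ≤ X)
    (h : ∀ i < r, CompP Λ X a (q i)) : CompP Λ X (a + 7) fun v => ∃ i < r, q i v := by
  -- The negation is a bounded universal statement, which is a fold of conjunctions.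
  have key : CompP Λ X (a + 2 + 3) fun v => ∀ i < r, ¬q i v :=
    CompN.mono (CompN.fold (k := .b) (n₀ := 1) true (fun x y : Bool => x && y)
      (by simpa using show CompN Λ (X ^ 0) .b _ from Comp.constB (X := X) (Λ := Λ) true)
      (fun {_ _ F F'} h h' => by
        have := CompN.op₁ (k := .b) (k₁ := .b) (fun x : Bool => !x)
          (fun d i => ⟨.bNand d i i, rfl, fun m => by simp [Instr.exec, Mem.set, Mem.get]⟩)
          (CompN.op₂ (k := .b) (k₁ := .b) (k₂ := .b) (fun x y : Bool => !(x && y))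
            (fun d i j => ⟨.bNand d i j, rfl, fun _ => rfl⟩) h h')
        simpa only [Bool.not_not] using this)
      (fun i v => @decide (¬q i v) (propDecidable _)) r (fun i hi => (h i hi).not)
      (fun r v => @decide (∀ i < r, ¬q i v) (propDecidable _)) (fun _ => by simp)
      (fun i v => by
        rw [← Bool.decide_and]
        congr 1
        rw [Nat.forall_lt_succ_right])) (fold_cost_le hr (a + 2))
  simpa using key.not

end Operations

theorem Impl.assign {w : ℕ} (W : List (Kind × ι)) (hw : W.length ≤ X ^ w) (Φ : VM Γ ι → VM Γ ι)
    (hW : ∀ v k x, (k, x) ∉ W → Φ v k x = v k x)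
    (hC : ∀ k x, (k, x) ∈ W → Comp Λ X c k fun v => Φ v k x) :
    Impl Λ X (w + (c + 2)) fun v => PMF.pure (Φ v) :=
  ImplN.mono (ImplN.assign _ W Φ hW hC) <| by
    rw [pow_add]
    have := four_mul_pow_le X c
    have := one_le_pow_of_fact X c
    exact Nat.mul_le_mul hw (by omega)

theorem Impl.seq {κ κ' : VM Γ ι → PMF (VM Γ ι)} (h : Impl Λ X a κ) (h' : Impl Λ X b κ') :
    Impl Λ X (max a b + 1) fun v => (κ v).bind κ' :=
  ImplN.mono (ImplN.seq h h') <| by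
    have := pow_le_of_le (X := X) (le_max_left a b)
    have := pow_le_of_le (X := X) (le_max_right a b)
    calc X ^ a + X ^ b ≤ 2 * X ^ max a b := by omega
      _ ≤ X * X ^ max a b := Nat.mul_le_mul_right _ hX.out
      _ = _ := by ring

omit hX in
theorem Impl.iter {w : ℕ} {κ : ℕ → VM Γ ι → PMF (VM Γ ι)} {r : ℕ} (hr : r ≤ X ^ w)
    (h : ∀ i < r, Impl Λ X a (κ i)) : Impl Λ X (w + a) (iter κ r) :=
  ImplN.mono (ImplN.iter r h) <| by
    rw [pow_add]
    exact Nat.mul_le_mul_right _ hr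

omit hX in
theorem Impl.rand (x : ι) : Impl Λ X 0 fun v : VM Γ ι => (unif Γ.Z).map fun y => v.set .z x y :=
  ImplN.mono (ImplN.rand x) (by simp)

omit hX in
theorem Impl.randUnit (x : ι) :
    Impl Λ X 0 fun v : VM Γ ι => (unitZ Γ).map fun y => v.set .z x y :=
  ImplN.mono (ImplN.randUnit x) (by simp)

omit hX in
theorem Impl.coin (x : ι) :
    Impl Λ X 0 fun v : VM Γ ι => (unif Bool).map fun y => v.set .b x y :=
  ImplN.mono (ImplN.coin x) (by simp)

omit hX in
theorem Impl.prog {A : ℕ → ι} (hA : Function.Injective A) {P : Prog Γ} (hP : P.cost ≤ X) :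
    Impl Λ X 1 fun v => (P.run (v.pull A)).map (v.push A) :=
  ImplN.mono (ImplN.prog hA P) (by simpa using hP)

end AIBBE

end

noncomputable section

namespace AIBBE

open Classical
open scoped ENNReal

variable {Γ : BilinearGroup} {N : ℕ}

/-! ### Exponents -/

variable (Γ) in
/-- Groups in which the exponents form `ℤ_p`. -/
class ExponentP (M : Type) [CommGroup M] : Prop where
  pow_p : ∀ x : M, x ^ Γ.p = 1

instance : ExponentP Γ Γ.G := ⟨fun x => by rw [← Γ.cardG]; exact pow_card_eq_one⟩

instance : ExponentP Γ Γ.GT := ⟨fun x => by rw [← Γ.cardT]; exact pow_card_eq_one⟩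

section Pw

variable {M : Type} [CommGroup M] [hM : ExponentP Γ M]

/-- Since x^p = 1, powers with exponents in ℤ_p may be computed with any natural representative; the
laws below are thereby lifted from natural exponents. -/
theorem pw_natCast (x : M) (n : ℕ) : pw x (n : Γ.Z) = x ^ n := by
  rw [pw, ZMod.val_natCast]
  conv_rhs => rw [← Nat.mod_add_div n Γ.p, pow_add, pow_mul, hM.pow_p, one_pow, mul_one]

theorem exists_natCast (a : Γ.Z) : ∃ n : ℕ, (n : Γ.Z) = a := ⟨a.val, ZMod.natCast_zmod_val a⟩

theorem pw_add (x : M) (a b : Γ.Z) : pw x (a + b) = pw x a * pw x b := by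
  obtain ⟨m, rfl⟩ := exists_natCast a
  obtain ⟨n, rfl⟩ := exists_natCast b
  rw [← Nat.cast_add, pw_natCast, pw_natCast, pw_natCast, pow_add]

theorem pw_mul (x : M) (a b : Γ.Z) : pw x (a * b) = pw (pw x a) b := by
  obtain ⟨m, rfl⟩ := exists_natCast a
  obtain ⟨n, rfl⟩ := exists_natCast b
  rw [← Nat.cast_mul, pw_natCast, pw_natCast, pw_natCast, pow_mul]

@[simp] theorem pw_zero (x : M) : pw x (0 : Γ.Z) = 1 := by
  simpa using pw_natCast (Γ := Γ) x 0

@[simp] theorem pw_one (x : M) : pw x (1 : Γ.Z) = x := by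
  simpa using pw_natCast (Γ := Γ) x 1

omit hM in
@[simp] theorem one_pw (a : Γ.Z) : pw (1 : M) a = 1 := one_pow _

omit hM in
theorem mul_pw (x y : M) (a : Γ.Z) : pw (x * y) a = pw x a * pw y a := mul_pow _ _ _

theorem pw_neg (x : M) (a : Γ.Z) : pw x (-a) = (pw x a)⁻¹ := by
  rw [eq_inv_iff_mul_eq_one, ← pw_add, neg_add_cancel, pw_zero]

theorem pw_sum {κ : Type} (x : M) (f : κ → Γ.Z) (s : Finset κ) :
    pw x (∑ i ∈ s, f i) = ∏ i ∈ s, pw x (f i) := by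
  induction s using Finset.cons_induction with
  | empty => simp
  | cons i s hi ih => rw [Finset.sum_cons, Finset.prod_cons, pw_add, ih]

theorem pw_injective {x : M} (hx : x ≠ 1) : Function.Injective fun a : Γ.Z => pw x a := by
  intro a b hab
  have hab : pw x a = pw x b := hab
  by_contra hne
  have h : a - b ≠ 0 := sub_ne_zero.2 hne
  have h1 : pw x (a - b) = 1 := by rw [sub_eq_add_neg, pw_add, pw_neg, hab, mul_inv_cancel]
  apply hx
  rw [← pw_one (Γ := Γ) x, ← mul_inv_cancel₀ h, pw_mul, h1, one_pw]

end Pw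

theorem e_pw (x y : Γ.G) (a b : Γ.Z) : Γ.e (pw x a) (pw y b) = pw (Γ.e x y) (a * b) := by
  obtain ⟨m, rfl⟩ := exists_natCast a
  obtain ⟨n, rfl⟩ := exists_natCast b
  rw [← Nat.cast_mul, pw_natCast, pw_natCast, pw_natCast]
  have := Γ.bilin x y m n
  rw [zpow_natCast, zpow_natCast] at this
  rw [this, ← Nat.cast_mul, zpow_natCast]

theorem card_Z : Fintype.card Γ.Z = Γ.p := ZMod.card _

/-- The discrete logarithm to a nontrivial base. -/
def pwEquiv {x : Γ.G} (hx : x ≠ 1) : Γ.Z ≃ Γ.G :=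
  Equiv.ofBijective (fun a => pw x a) <|
    (Fintype.bijective_iff_injective_and_card _).2 ⟨pw_injective hx, by rw [card_Z, Γ.cardG]⟩

def pwEquivT {x : Γ.GT} (hx : x ≠ 1) : Γ.Z ≃ Γ.GT :=
  Equiv.ofBijective (fun a => pw x a) <|
    (Fintype.bijective_iff_injective_and_card _).2 ⟨pw_injective hx, by rw [card_Z, Γ.cardT]⟩

theorem exists_pw {x : Γ.G} (hx : x ≠ 1) (y : Γ.G) : ∃ a : Γ.Z, y = pw x a :=
  let ⟨a, h⟩ := (pwEquiv hx).surjective y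
  ⟨a, h.symm⟩

/-- Two accepting conversations with the same first message and different challenges yield a
representation of the commitment. -/
theorem extract {g g2 R U : Γ.G} {c c' x y x' y' : Γ.Z} (hc : c' ≠ c)
    (h : pw g2 x * pw g y = U * pw R c) (h' : pw g2 x' * pw g y' = U * pw R c') :
    R = pw g2 ((x - x') / (c - c')) * pw g ((y - y') / (c - c')) := by
  have hd : c - c' ≠ 0 := sub_ne_zero.2 (Ne.symm hc)
  -- Dividing the two verification equations eliminates `U`; the exponent `c - c'` is then inverted
  -- in the field.
  have h1 : pw R (c - c') = pw g2 (x - x') * pw g (y - y') := by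
    simp only [sub_eq_add_neg, pw_add, pw_neg]
    calc pw R c * (pw R c')⁻¹ = (U * pw R c) * (U * pw R c')⁻¹ := by
          rw [mul_inv, mul_mul_mul_comm, mul_inv_cancel, one_mul]
      _ = (pw g2 x * pw g y) * (pw g2 x' * pw g y')⁻¹ := by rw [h, h']
      _ = _ := by rw [mul_inv, mul_mul_mul_comm]
  calc R = pw (pw R (c - c')) (c - c')⁻¹ := by rw [← pw_mul, mul_inv_cancel₀ hd, pw_one]
    _ = _ := by rw [h1, mul_pw, ← pw_mul, ← pw_mul, div_eq_mul_inv, div_eq_mul_inv]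

/-! ### More rules for the relational lifting -/

section Rules

variable {α β σ τ κ : Type}

/-- Independent sampling is a coupling. It serves after an extraction failure, when the two games
have diverged and only the flags matter. -/
theorem Rel.trivial {R : α → β → Prop} (μ : PMF α) (ν : PMF β) (h : ∀ a b, R a b) :
    Rel 0 R μ ν := by
  intro f g _ _ hfg
  rw [add_zero, ← ev_const ν (ev μ f)]
  refine ev_mono _ fun b => ?_
  rw [← ev_const μ (g b)]
  exact ev_mono _ fun a => hfg a b (h a b)

/-- A list of instructions executed one after the other. -/
def runList (step : κ → σ → PMF σ) : List κ → σ → PMF σ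
  | [], a => PMF.pure a
  | q :: qs, a => (step q a).bind (runList step qs)

theorem Rel.runList {R : σ → τ → Prop} {step : κ → σ → PMF σ} {step' : κ → τ → PMF τ} {ε : ℝ≥0∞}
    (h : ∀ q a b, R a b → Rel ε R (step q a) (step' q b)) (qs : List κ) :
    ∀ {a b}, R a b → Rel (qs.length * ε) R (runList step qs a) (runList step' qs b) := by
  induction qs with
  | nil => intro a b hab; exact (Rel.pure hab).mono (by simp) fun _ _ h => h
  | cons q qs ih =>
    intro a b hab
    refine (Rel.bind (h q a b hab) fun a' b' hab' => ih hab').mono (le_of_eq ?_) fun _ _ h => h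
    rw [List.length_cons]
    push_cast
    ring

end Rules

/-! ### The challenger's answers -/

section Steps

variable (s : Setup Γ N) (g3 : Γ.G) (S : Finset Γ.Z)

/-- A key query in the game against the Boneh-Hamburg scheme. -/
def bhAnswer (m : Mem Γ) : PMF (Mem Γ) :=
  if m.z 0 ∈ S then PMF.pure (m.setB 0 false)
  else (s.bhKeygen (m.z 0)).map fun K => (m.putG K).setB 0 true

def bhStep (Q : Prog Γ) (m : Mem Γ) : PMF (Mem Γ) := (Q.run m).bind (bhAnswer s S)

theorem bhQueries_eq (Qs : List (Prog Γ)) (m : Mem Γ) :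
    bhQueries s S Qs m = runList (bhStep s S) Qs m := by
  induction Qs generalizing m with
  | nil => rfl
  | cons Q Qs ih =>
    have h : bhQueries s S Qs = runList (bhStep s S) Qs := funext ih
    have h2 : bhQueries s S (Q :: Qs) m
        = (Q.run m).bind fun m => (bhAnswer s S m).bind (bhQueries s S Qs) := rfl
    rw [h2, h, runList, bhStep, PMF.bind_bind]

/-- The delivery of a blinded key. -/
def aAnswer (R : Γ.G) (ID : Γ.Z) (m : Mem Γ) : PMF (Mem Γ) :=
  (s.aKeygen g3 R ID).map fun K => ((m.putG K.1).setZ 0 K.2).setB 0 true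

/-- An execution of the key generation protocol. -/
def aStep (Q : AQuery Γ) (m : Mem Γ) : PMF (Mem Γ) :=
  (Q.commit.run m).bind fun m =>
  (unif Γ.Z).bind fun c =>
  (Q.respond.run (m.setZ 0 c)).bind fun m' =>
  if m.z 0 ∉ S ∧ s.verify (m.g 0) (m.g 1) c (m'.z 0) (m'.z 1) then
    aAnswer s g3 (m.g 0) (m.z 0) m'
  else PMF.pure (m'.setB 0 false)

theorem aQueries_eq (Qs : List (AQuery Γ)) (m : Mem Γ) :
    aQueries s g3 S Qs m = runList (aStep s g3 S) Qs m := by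
  induction Qs generalizing m with
  | nil => rfl
  | cons Q Qs ih =>
    have h : aQueries s g3 S Qs = runList (aStep s g3 S) Qs := funext ih
    rw [aQueries, h, runList, aStep]
    simp only [PMF.bind_bind]
    rfl

/-- One rewinding of the user with a fresh challenge; the result is `true` if it yields a second
accepting conversation with a different challenge. -/
def trial (R U : Γ.G) (c : Γ.Z) (P : Prog Γ) (m : Mem Γ) : PMF Bool :=
  (unif Γ.Z).bind fun c' =>
  (P.run (m.setZ 0 c')).map fun m' => decide (s.verify R U c' (m'.z 0) (m'.z 1) ∧ c' ≠ c)

/-- The success of `K` independent rewindings. -/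
def trials (R U : Γ.G) (c : Γ.Z) (P : Prog Γ) (m : Mem Γ) : ℕ → PMF Bool
  | 0 => PMF.pure false
  | K + 1 => (trials R U c P m K).bind fun b => (trial s R U c P m).map fun b' => b || b'

/-- An execution of the key generation protocol with `K` rewindings.  The second component reports
that a key was due but no rewinding was successful; then the query is refused unless `patch` is
true. -/
def rewindCore (patch : Bool) (K : ℕ) (Q : AQuery Γ) (m : Mem Γ) : PMF (Mem Γ × Bool) :=
  (Q.commit.run m).bind fun m =>
  (unif Γ.Z).bind fun c =>
  (trials s (m.g 0) (m.g 1) c Q.respond m K).bind fun found =>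
  (Q.respond.run (m.setZ 0 c)).bind fun m' =>
  if m.z 0 ∉ S ∧ s.verify (m.g 0) (m.g 1) c (m'.z 0) (m'.z 1) then
    if found || patch then (aAnswer s g3 (m.g 0) (m.z 0) m').map fun m => (m, !found)
    else PMF.pure (m'.setB 0 false, true)
  else PMF.pure (m'.setB 0 false, false)

def rewindStep (patch : Bool) (K : ℕ) (Q : AQuery Γ) (a : Mem Γ × Bool) : PMF (Mem Γ × Bool) :=
  (rewindCore s g3 S patch K Q a.1).map fun r => (r.1, a.2 || r.2)

end Steps

/-! ### The probability that all rewindings fail -/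

/-- Each of the K + 1 terms of the geometric sum ∑ (1 - x)^i is at least (1 - x)^K, and x times this
sum is 1 - (1 - x)^(K+1) ≤ 1. -/
theorem mul_one_sub_pow_le {x : ℝ} (h0 : 0 ≤ x) (h1 : x ≤ 1) (K : ℕ) :
    x * (1 - x) ^ K ≤ 1 / (K + 1) := by
  rw [le_div_iff₀ (by positivity)]
  have hg : (∑ i ∈ Finset.range (K + 1), (1 - x) ^ i) * x = 1 - (1 - x) ^ (K + 1) := by
    have := geom_sum_mul_neg (1 - x) (K + 1)
    rwa [sub_sub_cancel] at this
  have hle : ∑ i ∈ Finset.range (K + 1), (1 - x) ^ K ≤ ∑ i ∈ Finset.range (K + 1), (1 - x) ^ i := by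
    refine Finset.sum_le_sum fun i hi => ?_
    rw [Finset.mem_range] at hi
    exact pow_le_pow_of_le_one (by linarith) (by linarith) (by omega)
  rw [Finset.sum_const, Finset.card_range, nsmul_eq_mul] at hle
  push_cast at hle
  have h3 : 0 ≤ (1 - x) ^ (K + 1) := pow_nonneg (by linarith) _
  calc x * (1 - x) ^ K * (K + 1) = ((K + 1) * (1 - x) ^ K) * x := by ring
    _ ≤ _ := mul_le_mul_of_nonneg_right hle h0
    _ ≤ 1 := by rw [hg]; linarith

/-- Here `A` is the probability of acceptance and `δ = 1/p` the chance to repeat the old challenge.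
With x = A - δ (truncated), A ≤ x + δ; the first summand is controlled by the geometric sum and the
second by δ. -/
theorem ennreal_mul_one_sub_pow_le {A δ : ℝ≥0∞} (hA : A ≤ 1) (K : ℕ) :
    A * (1 - (A - δ)) ^ K ≤ (K + 1 : ℝ≥0∞)⁻¹ + δ := by
  set x := A - δ with hx
  have hx1 : x ≤ 1 := tsub_le_self.trans hA
  have h1 : x * (1 - x) ^ K ≤ (K + 1 : ℝ≥0∞)⁻¹ := by
    have hxt : x ≠ ⊤ := (hx1.trans_lt ENNReal.one_lt_top).ne
    rw [← ENNReal.toReal_le_toReal]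
    · rw [ENNReal.toReal_mul, ENNReal.toReal_pow, ENNReal.toReal_sub_of_le hx1 ENNReal.one_ne_top,
        ENNReal.toReal_inv, ENNReal.toReal_add (by simp) (by simp)]
      have := mul_one_sub_pow_le (ENNReal.toReal_nonneg (a := x))
        (by simpa using ENNReal.toReal_mono ENNReal.one_ne_top hx1) K
      simpa using this
    · exact ENNReal.mul_ne_top hxt (ENNReal.pow_ne_top (ne_top_of_le_ne_top ENNReal.one_ne_top
        tsub_le_self))
    · simp
  have h2 : (1 - x) ^ K ≤ 1 := pow_le_one₀ zero_le tsub_le_self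
  calc A * (1 - x) ^ K ≤ (x + δ) * (1 - x) ^ K := by gcongr; exact le_tsub_add
    _ = x * (1 - x) ^ K + δ * (1 - x) ^ K := add_mul _ _ _
    _ ≤ _ := add_le_add h1 ((mul_le_mul_right h2 δ).trans (mul_one δ).le)

theorem ev_bool (μ : PMF Bool) (f : Bool → ℝ≥0∞) : ev μ f = μ true * f true + μ false * f false := by
  simp [ev, tsum_fintype]

theorem pmf_bool_add (μ : PMF Bool) : μ true + μ false = 1 := by
  have := μ.tsum_coe
  simpa [tsum_fintype] using this

section Failure

variable (s : Setup Γ N) (S : Finset Γ.Z)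

/-- The indicator function of a predicate. -/
def ind {α : Type} (p : α → Prop) (a : α) : ℝ≥0∞ := if p a then 1 else 0

theorem ind_le_one {α : Type} (p : α → Prop) (a : α) : ind p a ≤ 1 := by
  rw [ind]; split_ifs <;> simp

/-- The rewindings all start from the same memory and are independent, so their failure
probabilities multiply. -/
theorem trials_false (R U : Γ.G) (c : Γ.Z) (P : Prog Γ) (m : Mem Γ) (K : ℕ) :
    trials s R U c P m K false = trial s R U c P m false ^ K := by
  have key : ∀ μ : PMF Bool, μ false = ev μ (ind fun b => b = false) := by
    intro μ; simp [ev_bool, ind]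
  induction K with
  | zero => simp [trials]
  | succ K ih =>
    rw [key, trials, ev_bind, ev_bool, ev_map, ev_map, ev_bool, ev_bool, ih]
    simp [ind, pow_succ]

/-- The probability that the user's response to `c` is accepted. -/
def accProb (R U : Γ.G) (P : Prog Γ) (m : Mem Γ) (c : Γ.Z) : ℝ≥0∞ :=
  ev (P.run (m.setZ 0 c)) (ind fun m' => s.verify R U c (m'.z 0) (m'.z 1))

/-- A rewinding is useful whenever it is accepted, except when the fresh challenge equals the old
one; this happens with probability 1/p. -/
theorem trial_false_le (R U : Γ.G) (c : Γ.Z) (P : Prog Γ) (m : Mem Γ) :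
    trial s R U c P m false ≤
      1 - (ev (unif Γ.Z) (accProb s R U P m) - (Γ.p : ℝ≥0∞)⁻¹) := by
  have h1 : trial s R U c P m true + (Γ.p : ℝ≥0∞)⁻¹ ≥ ev (unif Γ.Z) (accProb s R U P m) := by
    rw [← ev_indicator_true, trial, ev_bind]
    have h2 : (Γ.p : ℝ≥0∞)⁻¹ = ev (unif Γ.Z) (ind fun c' => c' = c) := by
      rw [ev_unif, card_Z, Finset.sum_eq_single c]
      · simp [ind]
      · intro b _ hb; simp [ind, hb]
      · simp
    rw [h2, ← ev_add]
    refine ev_mono _ fun c' => ?_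
    by_cases hc : c' = c
    · exact (ev_le_one _ fun _ => ind_le_one _ _).trans (by simp [ind, hc])
    · rw [ev_map, accProb]
      refine le_add_right (ev_mono _ fun m' => ?_)
      simp [ind, hc]
  have h2 := pmf_bool_add (trial s R U c P m)
  have h3 : trial s R U c P m false = 1 - trial s R U c P m true := by
    rw [← h2, ENNReal.add_sub_cancel_left (PMF.apply_ne_top _ _)]
  rw [h3]
  exact tsub_le_tsub_left (tsub_le_iff_right.2 h1) 1

/-- The bound on the probability that extraction fails in a single query. -/
def failBound (Γ : BilinearGroup) (K : ℕ) : ℝ≥0∞ := (K + 1 : ℝ≥0∞)⁻¹ + (Γ.p : ℝ≥0∞)⁻¹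

/-- After the commitment and for a fixed challenge `c`, the actual response and the rewindings are
independent. A failure therefore has probability at most acc(c) (1 - (A - 1/p))^K, and averaging
over `c` turns acc(c) into `A`. -/
theorem rewindCore_fail_le (g3 : Γ.G) (patch : Bool) (K : ℕ) (Q : AQuery Γ) (m : Mem Γ) :
    ev (rewindCore s g3 S patch K Q m) (ind fun r => r.2 = true) ≤ failBound Γ K := by
  rw [rewindCore, ev_bind]
  refine le_trans (ev_mono _ fun m => ?_) (ev_const _ _).le
  rw [ev_bind]
  set acc := accProb s (m.g 0) (m.g 1) Q.respond m with hacc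
  set A := ev (unif Γ.Z) acc with hA
  have hacc1 : ∀ c, acc c ≤ 1 := fun c => ev_le_one _ (ind_le_one _)
  have step : ∀ c, ev ((trials s (m.g 0) (m.g 1) c Q.respond m K).bind fun found =>
      (Q.respond.run (m.setZ 0 c)).bind fun m' =>
      if m.z 0 ∉ S ∧ s.verify (m.g 0) (m.g 1) c (m'.z 0) (m'.z 1) then
        if found || patch then (aAnswer s g3 (m.g 0) (m.z 0) m').map fun m => (m, !found)
        else PMF.pure (m'.setB 0 false, true)
      else PMF.pure (m'.setB 0 false, false)) (ind fun r => r.2 = true) ≤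
      (1 - (A - (Γ.p : ℝ≥0∞)⁻¹)) ^ K * acc c := by
    intro c
    rw [ev_bind, ev_bool]
    -- If some rewinding succeeded, the failure flag cannot be raised.
    have e1 : ∀ m' : Mem Γ, ev (if m.z 0 ∉ S ∧ s.verify (m.g 0) (m.g 1) c (m'.z 0) (m'.z 1) then
        if true || patch then (aAnswer s g3 (m.g 0) (m.z 0) m').map fun m => (m, !true)
        else PMF.pure (m'.setB 0 false, true)
      else PMF.pure (m'.setB 0 false, false)) (ind fun r => r.2 = true) = 0 := by
      intro m'
      split_ifs with h h'
      · rw [ev_map]; simp [ind, ev_const]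
      · simp at h'
      · simp [ev_pure, ind]
    rw [ev_bind]
    simp only [e1, ev_const, mul_zero, zero_add]
    rw [trials_false]
    gcongr
    · exact trial_false_le s (m.g 0) (m.g 1) c Q.respond m
    · rw [ev_bind, hacc, accProb]
      refine ev_mono _ fun m' => ?_
      by_cases h : m.z 0 ∉ S ∧ s.verify (m.g 0) (m.g 1) c (m'.z 0) (m'.z 1)
      · exact (ev_le_one _ (ind_le_one _)).trans (by simp [ind, h.2])
      · rw [if_neg h, ev_pure]; simp [ind]
  calc _ ≤ ev (unif Γ.Z) fun c => (1 - (A - (Γ.p : ℝ≥0∞)⁻¹)) ^ K * acc c := ev_mono _ step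
    _ = A * (1 - (A - (Γ.p : ℝ≥0∞)⁻¹)) ^ K := by rw [ev_mul_left, mul_comm]
    _ ≤ _ := ennreal_mul_one_sub_pow_le (ev_le_one _ hacc1) K

theorem rewindStep_fail_le (g3 : Γ.G) (patch : Bool) (K : ℕ) (Qs : List (AQuery Γ))
    (a : Mem Γ × Bool) :
    ev (runList (rewindStep s g3 S patch K) Qs a) (ind fun r => r.2 = true) ≤
      ind (fun r => r.2 = true) a + Qs.length * failBound Γ K := by
  induction Qs generalizing a with
  | nil => simp [runList, ev_pure]
  | cons Q Qs ih =>
    rw [runList, ev_bind]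
    refine (ev_mono _ ih).trans ?_
    rw [ev_add, ev_const, rewindStep, ev_map]
    have h1 : ∀ r : Mem Γ × Bool, ind (fun r : Mem Γ × Bool => r.2 = true) (r.1, a.2 || r.2) ≤
        ind (fun r => r.2 = true) a + ind (fun r => r.2 = true) r := by
      intro r
      simp only [ind, Bool.or_eq_true]
      by_cases h : a.2 = true <;> by_cases h' : r.2 = true <;> simp [h, h']
    calc _ ≤ (ind (fun r => r.2 = true) a + failBound Γ K) + Qs.length * failBound Γ K := by
          gcongr
          refine (ev_mono _ h1).trans ?_
          rw [ev_add, ev_const]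
          gcongr
          exact rewindCore_fail_le s S g3 patch K Q a.1
      _ = _ := by rw [List.length_cons]; push_cast; ring

end Failure

end AIBBE

end

noncomputable section

namespace AIBBE

open Classical
open scoped ENNReal

variable {Γ : BilinearGroup} {N : ℕ}

/-! ### The game with rewinding -/

/-- The public key of the accountable authority scheme. -/
def Setup.apk (s : Setup Γ N) (g3 : Γ.G) : List Γ.G :=
  [s.g, s.g1, s.g2, g3, s.z] ++ List.ofFn s.h

/-- The delivery of a ciphertext of the accountable authority scheme. -/
def putC (C : (Γ.GT × Γ.GT) × Γ.G × Γ.G) (m : Mem Γ) : Mem Γ :=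
  (m.putT [C.1.1, C.1.2]).putG [C.2.1, C.2.2]

/-- The ciphertext of `M` with randomness `x` for `g3 = g2 ^ γ * g ^ δ`, perturbed by `T`. -/
def Setup.ctx (s : Setup Γ N) (g3 : Γ.G) (S : Finset Γ.Z) (T W M : Γ.GT) (x : Γ.Z) :
    (Γ.GT × Γ.GT) × Γ.G × Γ.G :=
  ((M * W * pw (Γ.e s.g1 g3) x, T * pw (Γ.e s.g1 s.g2) x), pw s.g x, pw (s.hash S) x)

/-- The game from the point where the parameters are known.  The challenge ciphertext is multiplied
by `(W, T)`; the result tells whether the guess was correct and whether extraction has failed. -/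
def gameBody (patch : Bool) (K : ℕ) (A : AAdversary Γ) (m : Mem Γ) (s : Setup Γ N) (g3 : Γ.G)
    (μ : PMF (Γ.GT × Γ.GT)) : PMF (Bool × Bool) :=
  (runList (rewindStep s g3 (targets N m) patch K) A.pre (m.putG (s.apk g3), false)).bind fun a =>
  (A.choose.run a.1).bind fun m' =>
  μ.bind fun TW =>
  (unif Bool).bind fun d =>
  (unitZ Γ).bind fun x =>
  (runList (rewindStep s g3 (targets N m) patch K) A.post
    (putC (s.ctx g3 (targets N m) TW.1 TW.2 (if d then m'.t 1 else m'.t 0) x) m', a.2)).bind fun b =>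
  (A.guess.run b.1).map fun m' => (m'.b 0 == d, b.2)

theorem gameBody_eq_bind (patch : Bool) (K : ℕ) (A : AAdversary Γ) (m : Mem Γ) (s : Setup Γ N)
    (g3 : Γ.G) (μ : PMF (Γ.GT × Γ.GT)) :
    gameBody patch K A m s g3 μ = μ.bind fun TW => gameBody patch K A m s g3 (PMF.pure TW) := by
  simp only [gameBody, PMF.pure_bind]
  rw [PMF.bind_comm]
  congr 1; funext a
  rw [PMF.bind_comm]

/-- The game with rewinding; `g3 = g2 ^ γ * g ^ δ`. -/
def rewindGame (N : ℕ) (patch : Bool) (K : ℕ) (A : AAdversary Γ) (μ : PMF Γ.GT) :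
    PMF (Bool × Bool) :=
  (A.start.run (Mem.init Γ)).bind fun m =>
  (setup Γ N).bind fun s =>
  (unif Γ.Z).bind fun γ =>
  (unif Γ.Z).bind fun δ =>
  gameBody patch K A m s (pw s.g2 γ * pw s.g δ) (μ.map fun T => (T, pw T γ))

theorem rewindGame_eq_bind (patch : Bool) (K : ℕ) (A : AAdversary Γ) (μ : PMF Γ.GT) :
    rewindGame N patch K A μ = μ.bind fun T => rewindGame N patch K A (PMF.pure T) := by
  have h : ∀ m (s : Setup Γ N) (γ δ : Γ.Z),
      gameBody patch K A m s (pw s.g2 γ * pw s.g δ) (μ.map fun T => (T, pw T γ)) =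
      μ.bind fun T => gameBody patch K A m s (pw s.g2 γ * pw s.g δ)
        ((PMF.pure T).map fun T => (T, pw T γ)) := by
    intro m s γ δ
    rw [gameBody_eq_bind, PMF.bind_map]
    congr 1; funext T
    rw [PMF.pure_map]
    rfl
  simp only [rewindGame, h]
  symm
  rw [PMF.bind_comm]; congr 1; funext m
  rw [PMF.bind_comm]; congr 1; funext s
  rw [PMF.bind_comm]; congr 1; funext γ
  rw [PMF.bind_comm]

theorem setup_g_ne_one {s : Setup Γ N} (hs : s ∈ (setup Γ N).support) : s.g ≠ 1 := by
  simp only [setup, PMF.mem_support_bind_iff] at hs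
  obtain ⟨g, -, g2, -, z, -, a, -, h⟩ := hs
  rw [PMF.mem_support_map_iff] at h
  obtain ⟨α, -, rfl⟩ := h
  exact g.2

/-- For fixed `γ` the element `g2 ^ γ * g ^ δ` is uniform. -/
theorem unif_bind_mul_pw {α : Type} {g : Γ.G} (hg : g ≠ 1) (y : Γ.G) (κ : Γ.G → PMF α) :
    ((unif Γ.Z).bind fun δ => κ (y * pw g δ)) = (unif Γ.G).bind κ :=
  unif_bind_equiv ((pwEquiv hg).trans (Equiv.mulLeft y)) κ

theorem bind_congr_support {α β : Type} (μ : PMF α) {κ κ' : α → PMF β}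
    (h : ∀ a ∈ μ.support, κ a = κ' a) : μ.bind κ = μ.bind κ' := by
  ext b
  rw [PMF.bind_apply, PMF.bind_apply]
  refine tsum_congr fun a => ?_
  by_cases ha : a ∈ μ.support
  · rw [h a ha]
  · rw [PMF.mem_support_iff, not_not] at ha; simp [ha]

/-- For T = 1 the factor T^γ is trivial as well. Then γ enters only through g3, which is uniform for
every value of γ. -/
theorem rewindGame_one (patch : Bool) (K : ℕ) (A : AAdversary Γ) :
    rewindGame N patch K A (PMF.pure 1) =
      (A.start.run (Mem.init Γ)).bind fun m =>
      (setup Γ N).bind fun s =>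
      (unif Γ.G).bind fun g3 => gameBody patch K A m s g3 (PMF.pure (1, 1)) := by
  rw [rewindGame]
  congr 1; funext m
  refine bind_congr_support _ fun s hs => ?_
  simp only [PMF.pure_map, one_pw]
  rw [← unif_bind_mul_pw (setup_g_ne_one hs) 1]
  simp only [one_mul]
  have : ∀ γ : Γ.Z, ((unif Γ.Z).bind fun δ =>
      gameBody patch K A m s (pw s.g2 γ * pw s.g δ) (PMF.pure (1, 1))) =
      (unif Γ.G).bind fun g3 => gameBody patch K A m s g3 (PMF.pure (1, 1)) := fun γ =>
    unif_bind_mul_pw (setup_g_ne_one hs) (pw s.g2 γ)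
      fun g3 => gameBody patch K A m s g3 (PMF.pure (1, 1))
  simp only [this, PMF.bind_const]
  rw [← unif_bind_mul_pw (setup_g_ne_one hs) 1]
  simp only [one_mul]

/-- In the patched game the rewindings influence nothing but the flag, so they may be sampled on one
side only and forgotten. -/
theorem rel_rewindStep_fst (s : Setup Γ N) (g3 : Γ.G) (S : Finset Γ.Z) (K : ℕ) (Q : AQuery Γ)
    (a : Mem Γ × Bool) (b : Mem Γ) (h : a.1 = b) :
    Rel 0 (fun a b => a.1 = b) (rewindStep s g3 S true K Q a) (aStep s g3 S Q b) := by
  subst h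
  rw [rewindStep, rewindCore, aStep, PMF.map_bind]
  refine Rel.bind_same _ fun m => ?_
  rw [PMF.map_bind]
  refine Rel.bind_same _ fun c => ?_
  rw [PMF.map_bind]
  refine Rel.bind_left fun found => ?_
  rw [PMF.map_bind]
  refine Rel.bind_same _ fun m' => ?_
  split_ifs with h1 h2
  · rw [PMF.map_comp]
    nth_rw 2 [← PMF.map_id (aAnswer s g3 (m.g 0) (m.z 0) m')]
    exact Rel.map (Rel.refl (R := fun a b => a = b) _ fun _ => rfl) fun a b hab => hab
  · simp at h2
  · rw [PMF.pure_map]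
    exact Rel.pure rfl

theorem aEncrypt_eq (s : Setup Γ N) (g3 : Γ.G) (S : Finset Γ.Z) (M : Γ.GT) :
    s.aEncrypt g3 S M = (unitZ Γ).map fun x => s.ctx g3 S 1 1 M x := by
  simp only [Setup.ctx, mul_one, one_mul]
  rfl

/-- Patched and unperturbed, the game is the original one. -/
theorem rewindGame_patch_fst (K : ℕ) (A : AAdversary Γ) :
    (rewindGame N true K A (PMF.pure 1)).map Prod.fst = aGame N A := by
  rw [rewindGame_one]
  refine Rel.eq ?_
  rw [PMF.map_bind, aGame]
  refine Rel.bind_same _ fun m => ?_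
  rw [PMF.map_bind]
  refine Rel.bind_same _ fun s => ?_
  rw [PMF.map_bind]
  refine Rel.bind_same _ fun g3 => ?_
  have hq : ∀ Qs a b, a.1 = b → Rel 0 (fun (a : Mem Γ × Bool) b => a.1 = b)
      (runList (rewindStep s g3 (targets N m) true K) Qs a)
      (runList (aStep s g3 (targets N m)) Qs b) := fun Qs a b hab => by
    simpa using Rel.runList (rel_rewindStep_fst s g3 (targets N m) K) Qs hab
  simp only [aQueries_eq]
  rw [gameBody, PMF.map_bind]
  refine Rel.bind_exact (hq _ _ _ rfl) fun a b hab => ?_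
  subst hab
  rw [PMF.map_bind]
  refine Rel.bind_same _ fun m' => ?_
  rw [PMF.pure_bind, PMF.map_bind]
  refine Rel.bind_same _ fun d => ?_
  rw [PMF.map_bind, aEncrypt_eq, PMF.bind_map]
  refine Rel.bind_same _ fun x => ?_
  rw [PMF.map_bind]
  refine Rel.bind_exact (hq _ _ _ rfl) fun a b hab => ?_
  subst hab
  rw [PMF.map_comp]
  exact Rel.refl _ fun _ => rfl

/-- Equality unless extraction has failed. -/
def UntilBad {α : Type} (a b : α × Bool) : Prop := a.2 = b.2 ∧ (a.2 = false → a.1 = b.1)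

theorem untilBad_rfl {α : Type} (a : α × Bool) : UntilBad a a := ⟨rfl, fun _ => rfl⟩

/-- The two versions differ only in the branch that raises the flag. Once raised, the flag persists,
and the relation then asks nothing about the memories. -/
theorem rel_rewindStep_untilBad (s : Setup Γ N) (g3 : Γ.G) (S : Finset Γ.Z) (K : ℕ) (Q : AQuery Γ)
    (a b : Mem Γ × Bool) (h : UntilBad a b) :
    Rel 0 UntilBad (rewindStep s g3 S false K Q a) (rewindStep s g3 S true K Q b) := by
  obtain ⟨a1, a2⟩ := a
  obtain ⟨b1, b2⟩ := b
  obtain ⟨h1, h2⟩ := h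
  dsimp only at h1 h2
  subst h1
  cases a2 with
  | true =>
    exact Rel.map (Rel.trivial (R := fun _ _ => True) _ _ fun _ _ => True.intro)
      fun _ _ _ => ⟨by simp, by simp⟩
  | false =>
    obtain rfl := h2 rfl
    refine Rel.map (R := UntilBad) ?_ fun a b hab => by simpa using hab
    rw [rewindCore, rewindCore]
    refine Rel.bind_same _ fun m => Rel.bind_same _ fun c => Rel.bind_same _ fun found =>
      Rel.bind_same _ fun m' => ?_
    split_ifs with h1 h2 h3 h4
    · exact Rel.refl _ untilBad_rfl
    · simp at h3
    · have hf : found = false := by simpa using h2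
      subst hf
      rw [← PMF.bind_pure_comp]
      -- An unused sample is added on the refusing side, in order to pair it with the key that the
      -- patched game delivers.
      have e : (PMF.pure (m'.setB 0 false, true) : PMF (Mem Γ × Bool)) =
          (aAnswer s g3 (m.g 0) (m.z 0) m').bind fun _ => PMF.pure (m'.setB 0 false, true) := by
        rw [PMF.bind_const]
      rw [e]
      exact Rel.bind_same _ fun _ => Rel.pure ⟨rfl, by simp⟩
    · simp at h4
    · exact Rel.pure (untilBad_rfl _)

theorem rel_rewindGame_untilBad (K : ℕ) (A : AAdversary Γ) :
    Rel 0 UntilBad (rewindGame N false K A (PMF.pure 1)) (rewindGame N true K A (PMF.pure 1)) := by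
  rw [rewindGame, rewindGame]
  refine Rel.bind_same _ fun m => Rel.bind_same _ fun s => Rel.bind_same _ fun γ =>
    Rel.bind_same _ fun δ => ?_
  have hq : ∀ Qs a b, UntilBad a b → Rel 0 UntilBad
      (runList (rewindStep s (pw s.g2 γ * pw s.g δ) (targets N m) false K) Qs a)
      (runList (rewindStep s (pw s.g2 γ * pw s.g δ) (targets N m) true K) Qs b) :=
    fun Qs a b hab => by
      simpa using Rel.runList (rel_rewindStep_untilBad s _ (targets N m) K) Qs hab
  rw [gameBody, gameBody]
  refine Rel.bind_exact (hq _ _ _ (untilBad_rfl _)) fun a b hab => ?_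
  obtain ⟨a1, a2⟩ := a
  obtain ⟨b1, b2⟩ := b
  obtain ⟨h1, h2⟩ := hab
  dsimp only at h1 h2
  subst h1
  have fin : ∀ {a b : Mem Γ × Bool} (d : Bool), UntilBad a b → Rel 0 UntilBad
      ((A.guess.run a.1).map fun m' => (m'.b 0 == d, a.2))
      ((A.guess.run b.1).map fun m' => (m'.b 0 == d, b.2)) := by
    rintro ⟨a1, a2⟩ ⟨b1, b2⟩ d ⟨h1, h2⟩
    dsimp only at h1 h2 ⊢
    subst h1
    cases a2 with
    | true =>
      exact Rel.map (Rel.trivial (R := fun _ _ => True) _ _ fun _ _ => True.intro)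
        fun _ _ _ => ⟨rfl, by simp⟩
    | false =>
      obtain rfl := h2 rfl
      exact Rel.refl _ untilBad_rfl
  cases a2 with
  | true =>
    refine Rel.bind_exact (Rel.trivial (R := fun _ _ => True) _ _ fun _ _ => True.intro)
      fun m₁ m₂ _ => Rel.bind_same _ fun TW => Rel.bind_same _ fun d => Rel.bind_same _ fun x => ?_
    exact Rel.bind_exact (hq _ _ _ ⟨rfl, by simp⟩) fun a b hab => fin d hab
  | false =>
    obtain rfl := h2 rfl
    refine Rel.bind_same _ fun m' => Rel.bind_same _ fun TW => Rel.bind_same _ fun d =>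
      Rel.bind_same _ fun x => ?_
    exact Rel.bind_exact (hq _ _ _ (untilBad_rfl _)) fun a b hab => fin d hab

theorem rewindGame_fail_le (patch : Bool) (K : ℕ) (A : AAdversary Γ) (μ : PMF Γ.GT) :
    ev (rewindGame N patch K A μ) (ind fun r => r.2 = true) ≤ A.queries * failBound Γ K := by
  have hc : ∀ {α : Type} (μ : PMF α) {f : α → ℝ≥0∞} {c : ℝ≥0∞}, (∀ a, f a ≤ c) → ev μ f ≤ c :=
    fun μ f c h => (ev_mono μ h).trans (ev_const μ c).le
  rw [rewindGame]
  simp only [ev_bind]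
  refine hc _ fun m => hc _ fun s => hc _ fun γ => hc _ fun δ => ?_
  rw [gameBody]
  simp only [ev_bind]
  have h1 := rewindStep_fail_le s (targets N m) (pw s.g2 γ * pw s.g δ) patch K A.pre
    (m.putG (s.apk (pw s.g2 γ * pw s.g δ)), false)
  calc _ ≤ ev (runList (rewindStep s (pw s.g2 γ * pw s.g δ) (targets N m) patch K) A.pre
        (m.putG (s.apk (pw s.g2 γ * pw s.g δ)), false))
        (fun a => ind (fun r => r.2 = true) a + A.post.length * failBound Γ K) := by
        refine ev_mono _ fun a => ?_
        refine hc _ fun m' => hc _ fun TW => hc _ fun d => hc _ fun x => ?_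
        refine le_trans (ev_mono _ fun b => ?_) (rewindStep_fail_le s (targets N m)
          (pw s.g2 γ * pw s.g δ) patch K A.post (_, a.2))
        rw [ev_map]
        exact hc _ fun m' => le_rfl
    _ ≤ _ := by
        rw [ev_add, ev_const]
        have e : ind (fun r : Mem Γ × Bool => r.2 = true)
          (m.putG (s.apk (pw s.g2 γ * pw s.g δ)), false) = 0 := by simp [ind]
        rw [e, zero_add] at h1
        calc _ ≤ A.pre.length * failBound Γ K + A.post.length * failBound Γ K := by gcongr
          _ = _ := by rw [AAdversary.queries]; push_cast; ring

/-- The output of the reduction: a coin if extraction has failed. -/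
def mix (r : Bool × Bool) : PMF Bool := if r.2 then unif Bool else PMF.pure r.1

theorem unifBool_map_beq (b : Bool) : ((unif Bool).map fun d => b == d) = unif Bool := by
  have e : Function.Bijective fun d : Bool => b == d := by cases b <;> decide
  have := unif_bind_equiv (Equiv.ofBijective _ e) PMF.pure
  rw [PMF.bind_pure] at this
  rw [← PMF.bind_pure_comp]
  exact this

theorem one_half_unifBool : unif Bool true = 2⁻¹ := by
  rw [PMF.uniformOfFintype_apply]; simp

/-- With a perturbation `T ≠ 1` the game is lost. -/
theorem rewindGame_bind_mix (K : ℕ) (A : AAdversary Γ) {T : Γ.GT} (hT : T ≠ 1) :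
    (rewindGame N false K A (PMF.pure T)).bind mix = unif Bool := by
  have key : ∀ (m : Mem Γ) (s : Setup Γ N) (g3 : Γ.G),
      ((unif Γ.Z).bind fun γ => (gameBody false K A m s g3 (PMF.pure (T, pw T γ))).bind mix) =
        unif Bool := by
    intro m s g3
    -- For fixed `g3` the secret γ is not used before the challenge, so its sampling is moved past
    -- the earlier queries and the choice of messages.
    simp only [gameBody, PMF.bind_bind, PMF.pure_bind]
    rw [PMF.bind_comm]
    refine (congrArg _ (funext fun a => ?_)).trans (PMF.bind_const _ _)
    rw [PMF.bind_comm]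
    refine (congrArg _ (funext fun m' => ?_)).trans (PMF.bind_const _ _)
    rw [PMF.bind_comm]
    -- As T ≠ 1 generates `GT`, the product of the chosen message and T^γ is uniform. It is replaced
    -- by an independent `W`, and the message disappears.
    have h1 : ∀ d : Bool, ((unif Γ.Z).bind fun γ => (unitZ Γ).bind fun x =>
        (runList (rewindStep s g3 (targets N m) false K) A.post
          (putC (s.ctx g3 (targets N m) T (pw T γ) (if d then m'.t 1 else m'.t 0) x) m',
            a.2)).bind fun b =>
          ((A.guess.run b.1).map fun m' => (m'.b 0 == d, b.2)).bind mix) =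
        (unif Γ.GT).bind fun W => (unitZ Γ).bind fun x =>
        (runList (rewindStep s g3 (targets N m) false K) A.post
          (putC (s.ctx g3 (targets N m) T W 1 x) m', a.2)).bind fun b =>
          ((A.guess.run b.1).map fun m' => (m'.b 0 == d, b.2)).bind mix := by
      intro d
      rw [← unif_bind_equiv ((pwEquivT hT).trans (Equiv.mulLeft (if d then m'.t 1 else m'.t 0)))]
      congr 1; funext γ
      simp only [Setup.ctx, one_mul]
      rfl
    simp only [h1]
    rw [PMF.bind_comm]
    refine (congrArg _ (funext fun W => ?_)).trans (PMF.bind_const _ _)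
    rw [PMF.bind_comm]
    refine (congrArg _ (funext fun x => ?_)).trans (PMF.bind_const _ _)
    rw [PMF.bind_comm]
    refine (congrArg _ (funext fun b => ?_)).trans (PMF.bind_const _ _)
    simp only [PMF.bind_map]
    rw [PMF.bind_comm]
    refine (congrArg _ (funext fun m'' => ?_)).trans (PMF.bind_const _ _)
    simp only [Function.comp, mix]
    cases b.2 with
    | true => simp
    | false =>
      simp only [Bool.false_eq_true, if_false]
      -- The bit `d` is now independent of the guess, so that comparing the two is a fair coin.
      have := unifBool_map_beq (m''.b 0)
      rw [← PMF.bind_pure_comp] at this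
      exact this
  rw [rewindGame]
  simp only [PMF.bind_bind, PMF.pure_map]
  refine (congrArg _ (funext fun m => ?_)).trans (PMF.bind_const _ _)
  refine (bind_congr_support _ fun s hs => ?_).trans (PMF.bind_const _ _)
  -- For every γ the exponent δ makes `g3` uniform; hence `g3` can be drawn first, with γ still
  -- uniform afterwards.
  have h2 : ∀ γ : Γ.Z, ((unif Γ.Z).bind fun δ =>
      (gameBody false K A m s (pw s.g2 γ * pw s.g δ) (PMF.pure (T, pw T γ))).bind mix) =
      (unif Γ.G).bind fun g3 => (gameBody false K A m s g3 (PMF.pure (T, pw T γ))).bind mix :=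
    fun γ => unif_bind_mul_pw (setup_g_ne_one hs) (pw s.g2 γ)
      fun g3 => (gameBody false K A m s g3 (PMF.pure (T, pw T γ))).bind mix
  simp only [h2]
  rw [PMF.bind_comm]
  simp only [key, PMF.bind_const]

/-- Unperturbed, the game is won as often as the original one, up to extraction failure. -/
theorem rewindGame_mix_close (K : ℕ) (A : AAdversary Γ) :
    |(((rewindGame N false K A (PMF.pure 1)).bind mix) true).toReal - (aGame N A true).toReal| ≤
      (A.queries * failBound Γ K).toReal / 2 := by
  set μ₀ := rewindGame N false K A (PMF.pure 1)
  set μ₁ := rewindGame N true K A (PMF.pure 1)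
  have hR : Rel 0 UntilBad μ₀ μ₁ := rel_rewindGame_untilBad K A
  have hev : ∀ f : Bool × Bool → ℝ≥0∞, (∀ a, f a ≤ 1) → (∀ a b, UntilBad a b → f a = f b) →
      ev μ₀ f = ev μ₁ f := fun f hf hab =>
    le_antisymm (by simpa using hR f f hf hf fun a b h => (hab a b h).le)
      (by simpa using hR.symm f f hf hf fun a b h => (hab b a h).ge)
  set u := ev μ₁ (ind fun r => r.1 = true ∧ r.2 = false) with hu
  set F := ev μ₁ (ind fun r => r.2 = true) with hF
  have hu0 : ev μ₀ (ind fun r => r.1 = true ∧ r.2 = false) = u := by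
    refine hev _ (ind_le_one _) ?_
    rintro ⟨a1, a2⟩ ⟨b1, b2⟩ ⟨h1, h2⟩
    dsimp only at h1 h2
    subst h1
    cases a2 with
    | true => simp [ind]
    | false => rw [h2 rfl]
  have hF0 : ev μ₀ (ind fun r => r.2 = true) = F := by
    refine hev _ (ind_le_one _) ?_
    rintro ⟨a1, a2⟩ ⟨b1, b2⟩ ⟨h1, h2⟩
    dsimp only at h1
    subst h1
    rfl
  have hFle : F ≤ A.queries * failBound Γ K := rewindGame_fail_le true K A _
  have hu1 : u ≤ 1 := ev_le_one _ (ind_le_one _)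
  have hF1 : F ≤ 1 := ev_le_one _ (ind_le_one _)
  -- With `u` the probability of winning without failure and `F` that of failure, the reduction wins
  -- with probability exactly u + F/2, while the original game is won with probability between u and
  -- u + F. This is the source of the factor 1/2.
  have e0 : (μ₀.bind mix) true = u + 2⁻¹ * F := by
    rw [← ev_indicator_true, ev_bind, ← hu0, ← hF0, ← ev_mul_left, ← ev_add]
    congr 1
    funext ⟨r1, r2⟩
    cases r2 <;> cases r1 <;> simp [mix, ind, ev_pure, ev_indicator_true]
  have e1 : aGame N A true = ev μ₁ (ind fun r => r.1 = true) := by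
    rw [← rewindGame_patch_fst K A, ← ev_indicator_true, ev_map]
    refine congrArg _ (funext fun r => ?_)
    cases h : r.1 <;> simp [ind, h]
  have h2 : u ≤ aGame N A true := by
    rw [e1]
    refine ev_mono _ fun r => ?_
    simp only [ind]
    by_cases h1 : r.1 = true <;> simp [h1]
    split_ifs <;> simp
  have h3 : aGame N A true ≤ u + F := by
    rw [e1, hu, hF, ← ev_add]
    refine ev_mono _ fun r => ?_
    simp only [ind]
    by_cases h1 : r.1 = true <;> by_cases h2 : r.2 = true <;> simp [h1, h2]
  have nt : ∀ {x : ℝ≥0∞}, x ≤ 1 → x ≠ ⊤ := fun h => ne_top_of_le_ne_top ENNReal.one_ne_top h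
  have hbt : (A.queries * failBound Γ K : ℝ≥0∞) ≠ ⊤ := by
    refine ENNReal.mul_ne_top (by simp) (ENNReal.add_ne_top.2 ⟨by simp, ?_⟩)
    simp [Γ.prime.out.ne_zero]
  have r2 := ENNReal.toReal_mono (PMF.apply_ne_top _ _) h2
  have r3 := ENNReal.toReal_mono (ENNReal.add_ne_top.2 ⟨nt hu1, nt hF1⟩) h3
  have r4 := ENNReal.toReal_mono hbt hFle
  rw [ENNReal.toReal_add (nt hu1) (nt hF1)] at r3
  rw [e0, ENNReal.toReal_add (nt hu1) (ENNReal.mul_ne_top (by simp) (nt hF1)), ENNReal.toReal_mul]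
  simp only [ENNReal.toReal_inv, ENNReal.toReal_ofNat]
  rw [_root_.abs_le]
  constructor <;> linarith

end AIBBE

end

noncomputable section

namespace AIBBE

open Classical
open scoped ENNReal

variable {Γ : BilinearGroup} {N : ℕ}

/-! ### The registers of the reductions -/

/-- Local variables. -/
inductive Loc
  | R | U | gam | del | ch | ch' | x' | y' | cc | t0 | th | t1 | rr | idr | d | fail | found | ver
  | coin | w

def Loc.code : Loc → ℕ
  | .R => 0 | .U => 1 | .gam => 2 | .del => 3 | .ch => 4 | .ch' => 5 | .x' => 6 | .y' => 7
  | .cc => 8 | .t0 => 9 | .th => 10 | .t1 => 11 | .rr => 12 | .idr => 13 | .d => 14 | .fail => 15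
  | .found => 16 | .ver => 17 | .coin => 18 | .w => 19

def Loc.decode : ℕ → Loc
  | 0 => .R | 1 => .U | 2 => .gam | 3 => .del | 4 => .ch | 5 => .ch' | 6 => .x' | 7 => .y'
  | 8 => .cc | 9 => .t0 | 10 => .th | 11 => .t1 | 12 => .rr | 13 => .idr | 14 => .d | 15 => .fail
  | 16 => .found | 17 => .ver | 18 => .coin | _ => .w

theorem Loc.code_injective : Function.Injective Loc.code :=
  Function.LeftInverse.injective (g := Loc.decode) fun l => by cases l <;> rfl

/-- The named registers: those that receive messages, the memory of a simulated adversary, a copy of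
it, the public key, an auxiliary array, and local variables. -/
inductive Reg (L : ℕ)
  | pad (i : Fin (L + 1))
  | adv (i : ℕ)
  | sav (i : ℕ)
  | pk (i : ℕ)
  | aux (i : ℕ)
  | loc (l : Loc)

/-- The `pad` registers have to be the actual registers 0, …, L, through which the challenger
communicates. All others lie above them at even offsets; the odd offsets are left to the auxiliary
registers of `layout`. -/
def Reg.code {L : ℕ} : Reg L → ℕ
  | .pad i => i
  | .adv i => L + 1 + 2 * Nat.pair 0 i
  | .sav i => L + 1 + 2 * Nat.pair 1 i
  | .pk i => L + 1 + 2 * Nat.pair 2 i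
  | .aux i => L + 1 + 2 * Nat.pair 3 i
  | .loc l => L + 1 + 2 * Nat.pair 4 l.code

theorem Reg.code_injective (L : ℕ) : Function.Injective (Reg.code (L := L)) := by
  have key : ∀ a b c d, L + 1 + 2 * Nat.pair a b = L + 1 + 2 * Nat.pair c d → a = c ∧ b = d :=
    fun a b c d h => Nat.pair_eq_pair.1 (by omega)
  intro x y h
  cases x <;> cases y <;> simp only [Reg.code] at h
  case pad.pad i j => rw [Fin.ext h]
  case loc.loc l l' => rw [Loc.code_injective (key _ _ _ _ h).2]
  all_goals first
    | (have := (key _ _ _ _ h).2; subst this; rfl)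
    | (have := (key _ _ _ _ h).1; omega)
    | (rename_i i _; have := i.isLt; omega)
    | (rename_i i; have := i.isLt; omega)

variable (L : ℕ)

def layout : Layout (Reg L) where
  reg := Reg.code
  tmp s := L + 1 + (2 * s + 1)
  reg_inj := Reg.code_injective L
  tmp_inj a b h := by
    have h : L + 1 + (2 * a + 1) = L + 1 + (2 * b + 1) := h
    omega
  reg_ne_tmp x s := by
    cases x <;> simp only [Reg.code]
    case pad i => have := i.isLt; omega
    all_goals omega

variable {L}

theorem adv_injective : Function.Injective (Reg.adv (L := L)) := fun a b h => by injection h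

/-- The delivery of a list of group elements. -/
def VM.putG (l : List Γ.G) (v : VM Γ (Reg L)) : VM Γ (Reg L) := fun k x => match k, x with
  | .g, .pad i => l.getD i (v .g (.pad i))
  | k, x => v k x

def VM.putT (l : List Γ.GT) (v : VM Γ (Reg L)) : VM Γ (Reg L) := fun k x => match k, x with
  | .t, .pad i => l.getD i (v .t (.pad i))
  | k, x => v k x

theorem getD_of_length_le {M : Type} {l : List M} {i : ℕ} (h : l.length ≤ i) (x : M) :
    l.getD i x = x := by
  rw [List.getD_eq_getElem?_getD, List.getElem?_eq_none h, Option.getD_none]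

theorem lt_code {x : Reg L} (h : ∀ i, x ≠ .pad i) : L + 1 ≤ x.code := by
  cases x
  case pad i => exact absurd rfl (h i)
  all_goals simp only [Reg.code]; omega

/-- A message of length at most L + 1 hits `pad` registers only, so that its delivery is visible on
the named registers as such. -/
theorem view_putG {l : List Γ.G} (hl : l.length ≤ L + 1) (m : Mem Γ) :
    (layout L).view (m.putG l) = ((layout L).view m).putG l := by
  funext k x
  cases k
  case g =>
    by_cases hx : ∃ i, x = .pad i
    · obtain ⟨i, rfl⟩ := hx
      rfl
    · have h := lt_code (fun i hi => hx ⟨i, hi⟩)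
      cases x
      case pad i => rfl
      all_goals exact getD_of_length_le (hl.trans h) _
  all_goals rfl

theorem view_putT {l : List Γ.GT} (hl : l.length ≤ L + 1) (m : Mem Γ) :
    (layout L).view (m.putT l) = ((layout L).view m).putT l := by
  funext k x
  cases k
  case t =>
    by_cases hx : ∃ i, x = .pad i
    · obtain ⟨i, rfl⟩ := hx
      rfl
    · have h := lt_code (fun i hi => hx ⟨i, hi⟩)
      cases x
      case pad i => rfl
      all_goals exact getD_of_length_le (hl.trans h) _
  all_goals rfl

theorem view_setB_zero (m : Mem Γ) (b : Bool) :
    (layout L).view (m.setB 0 b) = ((layout L).view m).set .b (.pad 0) b :=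
  (layout L).view_set_reg m .b (.pad 0) b

/-- The memory of the simulated adversary. -/
abbrev VM.advMem (v : VM Γ (Reg L)) : Mem Γ := v.pull Reg.adv

/-- Running a program of the simulated adversary. -/
def runAdv (P : Prog Γ) (v : VM Γ (Reg L)) : PMF (VM Γ (Reg L)) :=
  (P.run v.advMem).map (v.push Reg.adv)

@[simp] theorem push_pad (v : VM Γ (Reg L)) (a : Mem Γ) (k : Kind) (i : Fin (L + 1)) :
    v.push Reg.adv a k (.pad i) = v k (.pad i) := VM.push_of_ne _ _ _ (by simp)

@[simp] theorem push_sav (v : VM Γ (Reg L)) (a : Mem Γ) (k : Kind) (i : ℕ) :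
    v.push Reg.adv a k (.sav i) = v k (.sav i) := VM.push_of_ne _ _ _ (by simp)

@[simp] theorem push_pk (v : VM Γ (Reg L)) (a : Mem Γ) (k : Kind) (i : ℕ) :
    v.push Reg.adv a k (.pk i) = v k (.pk i) := VM.push_of_ne _ _ _ (by simp)

@[simp] theorem push_aux (v : VM Γ (Reg L)) (a : Mem Γ) (k : Kind) (i : ℕ) :
    v.push Reg.adv a k (.aux i) = v k (.aux i) := VM.push_of_ne _ _ _ (by simp)

@[simp] theorem push_loc (v : VM Γ (Reg L)) (a : Mem Γ) (k : Kind) (l : Loc) :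
    v.push Reg.adv a k (.loc l) = v k (.loc l) := VM.push_of_ne _ _ _ (by simp)

@[simp] theorem push_adv (v : VM Γ (Reg L)) (a : Mem Γ) (k : Kind) (i : ℕ) :
    v.push Reg.adv a k (.adv i) = a.get k i := VM.push_apply adv_injective _ _ _ _

theorem advMem_get (v : VM Γ (Reg L)) (k : Kind) (i : ℕ) : v.advMem.get k i = v k (.adv i) := by
  simp [VM.pull]

variable {X : ℕ} [hX : Fact (2 ≤ X)]

omit hX in
theorem Impl.runAdv {P : Prog Γ} (hP : P.cost ≤ X) : Impl (layout L) X 1 (runAdv P) :=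
  Impl.prog adv_injective hP

/-! ### The reduction from the accountable authority scheme to the Boneh-Hamburg scheme -/

section Reduction

local notation "BVM" => VM Γ (Reg (N + 5))

/-- Copying the announced identities. -/
def announce (v : BVM) : BVM := fun k x => match k, x with
  | .z, .pad i => if (i : ℕ) < N then v .z (.adv i) else v .z (.pad i)
  | .b, .pad i => if (i : ℕ) < N then v .b (.adv i) else v .b (.pad i)
  | k, x => v k x

def kStart (P : Prog Γ) (v : BVM) : PMF BVM := (runAdv P v).bind fun v => PMF.pure (announce v)

/-- The public key for the adversary. -/
def pkList (v : BVM) : List Γ.G :=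
  [v .g (.pad 0), v .g (.pad 1), v .g (.pad 2),
    pw (v .g (.pad 2)) (v .z (.loc .gam)) * pw (v .g (.pad 0)) (v .z (.loc .del)),
    v .g (.pad 3)] ++ List.ofFn fun i : Fin (N + 1) => v .g (.pad ⟨i + 4, by omega⟩)

/-- A private copy is kept in `pk`, because later answers overwrite the `pad` registers and the
adversary may overwrite its own. -/
def deliverPk (v : BVM) : BVM := fun k x => match k, x with
  | .g, .pk i => (pkList v).getD i (v .g (.pk i))
  | .g, .adv i => (pkList v).getD i (v .g (.adv i))
  | k, x => v k x

def kPk (v : BVM) : PMF BVM :=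
  ((unif Γ.Z).map fun a => v.set .z (.loc .gam) a).bind fun v =>
  ((unif Γ.Z).map fun a => v.set .z (.loc .del) a).bind fun v => PMF.pure (deliverPk v)

/-- Saving the registers in `W` and the adversary's message. -/
def save (W : List (Kind × ℕ)) (v : BVM) : BVM := fun k x => match k, x with
  | k, .sav i => if (k, i) ∈ W then v k (.adv i) else v k (.sav i)
  | .g, .loc .R => v .g (.adv 0)
  | .g, .loc .U => v .g (.adv 1)
  | .z, .loc .idr => v .z (.adv 0)
  | .b, .loc .found => false
  | k, x => v k x

/-- Passing a challenge to the adversary. -/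
def feed (l : Loc) (v : BVM) : BVM := fun k x => match k, x with
  | .z, .adv 0 => v .z (.loc l)
  | k, x => v k x

/-- The adversary's response to the challenge in register `l` is accepted. -/
def accepts (l : Loc) (v : BVM) : Prop :=
  pw (v .g (.pk 2)) (v .z (.adv 0)) * pw (v .g (.pk 0)) (v .z (.adv 1)) =
    v .g (.loc .U) * pw (v .g (.loc .R)) (v .z (.loc l))

def useful (v : BVM) : Prop := accepts .cc v ∧ ¬v .z (.loc .cc) = v .z (.loc .ch)

/-- Recording a useful response and restoring the adversary's memory. -/
def record (W : List (Kind × ℕ)) (v : BVM) : BVM := fun k x => match k, x with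
  | k, .adv i => if (k, i) ∈ W then v k (.sav i) else v k (.adv i)
  | .b, .loc .found => decide (v .b (.loc .found) = true ∨ useful v)
  | .z, .loc .ch' => if useful v then v .z (.loc .cc) else v .z (.loc .ch')
  | .z, .loc .x' => if useful v then v .z (.adv 0) else v .z (.loc .x')
  | .z, .loc .y' => if useful v then v .z (.adv 1) else v .z (.loc .y')
  | k, x => v k x

def kTrial (W : List (Kind × ℕ)) (P : Prog Γ) (v : BVM) : PMF BVM :=
  ((unif Γ.Z).map fun a => v.set .z (.loc .cc) a).bind fun v =>
  (PMF.pure (feed .cc v)).bind fun v =>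
  (runAdv P v).bind fun v => PMF.pure (record W v)

/-- The verdict on the adversary's proof, the extracted witness, and the key query. -/
def conclude (v : BVM) : BVM := fun k x => match k, x with
  | .b, .loc .ver => decide (accepts .ch v)
  | .z, .loc .t0 => (v .z (.adv 0) - v .z (.loc .x')) / (v .z (.loc .ch) - v .z (.loc .ch'))
  | .z, .loc .th => (v .z (.adv 1) - v .z (.loc .y')) / (v .z (.loc .ch) - v .z (.loc .ch'))
  | .z, .pad 0 => v .z (.loc .idr)
  | k, x => v k x

/-- The registers that change during the user's response. -/
def respondDst (Q : AQuery Γ) : List (Kind × ℕ) := (.z, 0) :: Q.respond.map Instr.dst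

/-- The rewindings precede the actual response, and each restores the adversary's memory. The
identity ends up in `pad 0`, so one BH key is requested per execution of the protocol, even if the
proof was invalid; this keeps the numbers of queries equal. -/
def kQuery (K : ℕ) (Q : AQuery Γ) (v : BVM) : PMF BVM :=
  (runAdv Q.commit v).bind fun v =>
  (PMF.pure (save (respondDst Q) v)).bind fun v =>
  ((unif Γ.Z).map fun a => v.set .z (.loc .ch) a).bind fun v =>
  (iter (fun _ => kTrial (respondDst Q) Q.respond) K v).bind fun v =>
  (PMF.pure (feed .ch v)).bind fun v =>
  (runAdv Q.respond v).bind fun v => PMF.pure (conclude v)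

/-- The exponent by which the received key is raised. -/
def tau (v : BVM) : Γ.Z := v .z (.loc .t1) + v .z (.loc .t0) + v .z (.loc .gam)

/-- For τ ≠ 0 the BH key is raised to the power τ, which turns its randomness r into rτ; the factor
g1^(θ+δ) supplies the part of R g3 that is a power of g. For τ = 0 the g2-part vanishes, and the key
is built from the public key with fresh randomness. -/
def keyList (v : BVM) : List Γ.G :=
  [if tau v = 0 then
      pw (v .g (.pk 1)) (v .z (.loc .th) + v .z (.loc .del)) * pw (v .g (.pk 4)) (v .z (.loc .rr))
    else pw (v .g (.pad 0)) (tau v) * pw (v .g (.pk 1)) (v .z (.loc .th) + v .z (.loc .del)),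
    if tau v = 0 then pw (v .g (.pk 0)) (v .z (.loc .rr)) else pw (v .g (.pad 1)) (tau v)] ++
  List.ofFn fun i : Fin N => if tau v = 0 then
      pw (v .g (.pk (i + 6))) (v .z (.loc .rr)) *
        pw (v .g (.pk (i + 5))) (-v .z (.loc .idr) * v .z (.loc .rr))
    else pw (v .g (.pad ⟨i + 2, by omega⟩)) (tau v)

/-- The bit in `pad 0` is the BH challenger's flag, which is true exactly if the identity is not a
target. -/
def due (v : BVM) : Prop := v .b (.pad 0) = true ∧ v .b (.loc .ver) = true

def good (v : BVM) : Prop := due v ∧ v .b (.loc .found) = true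

def deliverKey (v : BVM) : BVM := fun k x => match k, x with
  | .g, .adv i => if good v then (keyList v).getD i (v .g (.adv i)) else v .g (.adv i)
  | .z, .adv 0 => if good v then v .z (.loc .t1) else v .z (.adv 0)
  | .b, .adv 0 => decide (good v)
  | .b, .loc .fail => decide (v .b (.loc .fail) = true ∨ (due v ∧ ¬v .b (.loc .found) = true))
  | k, x => v k x

def kKey (v : BVM) : PMF BVM :=
  ((unitZ Γ).map fun a => v.set .z (.loc .t1) a).bind fun v =>
  ((unitZ Γ).map fun a => v.set .z (.loc .rr) a).bind fun v => PMF.pure (deliverKey v)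

/-- The message in the real-or-random game is the identity of `GT`. -/
def putMsg (v : BVM) : BVM := fun k x => match k, x with
  | .t, .pad 0 => (1 : Γ.GT)
  | k, x => v k x

def kChoose (P : Prog Γ) (v : BVM) : PMF BVM :=
  (runAdv P v).bind fun v =>
  (PMF.pure (putMsg v)).bind fun v =>
  (unif Bool).map fun a => v.set .b (.loc .d) a

/-- If `pad 0` of `GT` holds T e(g1,g2)^s, the first component below is m_d T^γ e(g1,g3)^s. -/
def deliverCt (v : BVM) : BVM := fun k x => match k, x with
  | .t, .adv 0 => (if v .b (.loc .d) = true then v .t (.adv 1) else v .t (.adv 0)) *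
      pw (v .t (.pad 0)) (v .z (.loc .gam)) * pw (Γ.e (v .g (.pk 1)) (v .g (.pad 0))) (v .z (.loc .del))
  | .t, .adv 1 => v .t (.pad 0)
  | .g, .adv 0 => v .g (.pad 0)
  | .g, .adv 1 => v .g (.pad 1)
  | k, x => v k x

/-- The output is the statement that `d` was guessed correctly, or a coin if some extraction has
failed. -/
def output (v : BVM) : BVM := fun k x => match k, x with
  | .b, .pad 0 => if v .b (.loc .fail) = true then v .b (.loc .coin) else
      decide ((v .b (.adv 0) = true ∧ v .b (.loc .d) = true) ∨
        (¬v .b (.adv 0) = true ∧ ¬v .b (.loc .d) = true))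
  | k, x => v k x

def kGuess (P : Prog Γ) (v : BVM) : PMF BVM :=
  (runAdv P v).bind fun v =>
  ((unif Bool).map fun a => v.set .b (.loc .coin) a).bind fun v => PMF.pure (output v)

/-! ### Costs of the reduction -/

theorem impl_kStart (hN : N + 6 ≤ X) {P : Prog Γ} (hP : P.cost ≤ X) :
    Impl (layout (N + 5)) X 20 (kStart P) := by
  have h : Impl (layout (N + 5)) X 15 fun v : BVM => PMF.pure (announce v) := by
    refine (Impl.assign (c := 1) (w := 2)
      ((List.finRange (N + 6)).map (fun i => (Kind.z, Reg.pad i)) ++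
        (List.finRange (N + 6)).map fun i => (Kind.b, Reg.pad i)) ?_ announce ?_ ?_).mono (by norm_num)
    · simp only [List.length_append, List.length_map, List.length_finRange]
      have := hX.out
      nlinarith
    · intro v k x hx
      rcases k <;> rcases x <;> first | rfl | simp at hx
    · intro k x hx
      rcases k <;> rcases x <;> simp at hx
      all_goals
        simp only [announce]
        split_ifs
        · exact Comp.reg _ _
        · exact Comp.reg _ _
  exact ((Impl.runAdv hP).seq h).mono (by norm_num)

theorem comp_pkList {c : ℕ} (hc : 10 ≤ c) {k : Reg (N + 5)} (i : ℕ) :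
    Comp (layout (N + 5)) X c .g fun v : BVM => (pkList v).getD i (v .g k) := by
  have R : ∀ k (x : Reg (N + 5)), Comp (layout (N + 5)) X 1 k (fun v : BVM => v k x) := Comp.reg
  unfold pkList
  rcases i with _ | _ | _ | _ | _ | i
  · exact (R .g (.pad 0)).mono (by omega)
  · exact (R .g (.pad 1)).mono (by omega)
  · exact (R .g (.pad 2)).mono (by omega)
  · exact (Comp.mulG (Comp.pwG (R .g (.pad 2)) (R .z (.loc .gam)))
      (Comp.pwG (R .g (.pad 0)) (R .z (.loc .del)))).mono (by norm_num; omega)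
  · exact (R .g (.pad 3)).mono (by omega)
  · simp only [List.cons_append, List.nil_append, List.getD_cons_succ]
    by_cases hi : i < N + 1
    · simp only [List.getD_eq_getElem?_getD, List.getElem?_ofFn, hi, dif_pos, Option.getD_some]
      exact (R .g (.pad _)).mono (by omega)
    · simp only [List.getD_eq_getElem?_getD, List.getElem?_ofFn, hi, dif_neg, not_false_iff,
        Option.getD_none]
      exact (R .g k).mono (by omega)

theorem length_pkList (v : BVM) : (pkList v).length = N + 6 := by
  simp [pkList]

theorem impl_kPk (hN : N + 6 ≤ X) : Impl (layout (N + 5)) X 20 (kPk (Γ := Γ) (N := N)) := by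
  have h : Impl (layout (N + 5)) X 14 fun v : BVM => PMF.pure (deliverPk v) := by
    refine (Impl.assign (c := 10) (w := 2)
      ((List.range (N + 6)).map (fun i => (Kind.g, Reg.pk i)) ++
        (List.range (N + 6)).map fun i => (Kind.g, Reg.adv i)) ?_ deliverPk ?_ ?_).mono (by norm_num)
    · simp only [List.length_append, List.length_map, List.length_range]
      have := hX.out
      nlinarith
    · intro v k x hx
      cases k
      case g =>
        cases x
        case pk i =>
          simp at hx
          exact getD_of_length_le (by rw [length_pkList]; omega) _
        case adv i =>
          simp at hx
          exact getD_of_length_le (by rw [length_pkList]; omega) _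
        all_goals rfl
      all_goals rfl
    · intro k x hx
      cases k
      case g =>
        cases x
        case pk i =>
          change Comp (layout (N + 5)) X 10 .g fun v : BVM => (pkList v).getD i (v .g (.pk i))
          exact comp_pkList le_rfl _
        case adv i =>
          change Comp (layout (N + 5)) X 10 .g fun v : BVM => (pkList v).getD i (v .g (.adv i))
          exact comp_pkList le_rfl _
        all_goals simp at hx
      all_goals simp at hx
  have R : ∀ x : Reg (N + 5), Impl (layout (N + 5)) X 0
    fun v : BVM => (unif Γ.Z).map fun a => v.set .z x a := Impl.rand
  have h2 := (R (.loc .gam)).seq ((R (.loc .del)).seq h)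
  exact h2.mono (by norm_num)

end Reduction

end AIBBE

end

/-! ### Costs of the protocol executions, the challenge and the guess -/

noncomputable section

namespace AIBBE

open Classical
open scoped ENNReal

variable {Γ : BilinearGroup} {N : ℕ} {X : ℕ} [hX : Fact (2 ≤ X)]

local notation "BVM" => VM Γ (Reg (N + 5))

section Costs

theorem le_cube {n : ℕ} (h : n ≤ 4 * X) : n ≤ X ^ 3 := by
  have := four_mul_pow_le X 1
  simp only [pow_one] at this
  exact h.trans this

theorem impl_save (hN : N + 6 ≤ X) (W : List (Kind × ℕ)) (hW : W.length ≤ X + 1) :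
    Impl (layout (N + 5)) X 6 fun v : BVM => PMF.pure (save W v) := by
  have R : ∀ k (x : Reg (N + 5)), Comp (layout (N + 5)) X 1 k (fun v : BVM => v k x) := Comp.reg
  refine (Impl.assign (c := 1) (w := 3)
    (W.map (fun y => (y.1, Reg.sav y.2)) ++ [(.g, .loc .R), (.g, .loc .U), (.z, .loc .idr),
      (.b, .loc .found)]) ?_ (save W) ?_ ?_).mono (by norm_num)
  · simp only [List.length_append, List.length_map, List.length_cons, List.length_nil]
    exact le_cube (by omega)
  · intro v k x hx
    have hs : ∀ i, x = .sav i → (k, i) ∉ W := by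
      rintro i rfl hi
      exact hx (List.mem_append_left _ (List.mem_map.2 ⟨(k, i), hi, rfl⟩))
    cases x
    case sav i => cases k <;> exact if_neg (hs i rfl)
    case loc l => cases k <;> cases l <;> first | rfl | simp at hx
    all_goals cases k <;> rfl
  · intro k x hx
    cases x
    case sav i =>
      have : ∀ k, (fun v : BVM => save W v k (.sav i)) = fun v =>
        if (k, i) ∈ W then v k (.adv i) else v k (.sav i) := fun k => by cases k <;> rfl
      rw [this]
      split_ifs
      · exact R _ _
      · exact R _ _
    case loc l =>
      cases k <;> cases l <;> simp at hx
      · exact R .g (.adv 0)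
      · exact R .g (.adv 1)
      · exact R .z (.adv 0)
      · exact (Comp.constB false).mono (by omega)
    all_goals simp at hx

theorem impl_feed (l : Loc) :
    Impl (layout (N + 5)) X 4 fun v : BVM => PMF.pure (feed l v) := by
  refine (Impl.assign (c := 1) (w := 0) [(.z, .adv 0)] (by simp) (feed l) ?_ ?_).mono (by norm_num)
  · intro v k x hx
    cases k
    case z =>
      cases x
      case adv i =>
        cases i
        · simp at hx
        · rfl
      all_goals rfl
    all_goals cases x <;> rfl
  · intro k x hx
    simp only [List.mem_singleton, Prod.mk.injEq] at hx
    obtain ⟨rfl, rfl⟩ := hx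
    exact Comp.reg (Λ := layout (N + 5)) .z (.loc l)

omit hX in
theorem compP_accepts [Fact (2 ≤ X)] (l : Loc) :
    CompP (layout (N + 5)) X 10 fun v : BVM => accepts l v := by
  have R : ∀ k (x : Reg (N + 5)), Comp (layout (N + 5)) X 1 k (fun v : BVM => v k x) := Comp.reg
  exact (CompP.eqG (Comp.mulG (Comp.pwG (R .g (.pk 2)) (R .z (.adv 0)))
    (Comp.pwG (R .g (.pk 0)) (R .z (.adv 1))))
    (Comp.mulG (R .g (.loc .U)) (Comp.pwG (R .g (.loc .R)) (R .z (.loc l))))).mono (by norm_num)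

theorem compP_useful : CompP (layout (N + 5)) X 14 fun v : BVM => useful v := by
  have R : ∀ k (x : Reg (N + 5)), Comp (layout (N + 5)) X 1 k (fun v : BVM => v k x) := Comp.reg
  exact (CompP.and (compP_accepts .cc)
    (CompP.not (CompP.eqZ (R .z (.loc .cc)) (R .z (.loc .ch))))).mono (by norm_num)

theorem impl_record (hN : N + 6 ≤ X) (W : List (Kind × ℕ)) (hW : W.length ≤ X + 1) :
    Impl (layout (N + 5)) X 25 fun v : BVM => PMF.pure (record W v) := by
  have R : ∀ k (x : Reg (N + 5)), Comp (layout (N + 5)) X 1 k (fun v : BVM => v k x) := Comp.reg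
  refine (Impl.assign (c := 20) (w := 3)
    (W.map (fun y => (y.1, Reg.adv y.2)) ++ [(.b, .loc .found), (.z, .loc .ch'), (.z, .loc .x'),
      (.z, .loc .y')]) ?_ (record W) ?_ ?_).mono (by norm_num)
  · simp only [List.length_append, List.length_map, List.length_cons, List.length_nil]
    exact le_cube (by omega)
  · intro v k x hx
    have hs : ∀ i, x = .adv i → (k, i) ∉ W := by
      rintro i rfl hi
      exact hx (List.mem_append_left _ (List.mem_map.2 ⟨(k, i), hi, rfl⟩))
    cases x
    case adv i => cases k <;> exact if_neg (hs i rfl)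
    case loc l => cases k <;> cases l <;> first | rfl | simp at hx
    all_goals cases k <;> rfl
  · intro k x hx
    cases x
    case adv i =>
      have : ∀ k, (fun v : BVM => record W v k (.adv i)) = fun v =>
        if (k, i) ∈ W then v k (.sav i) else v k (.adv i) := fun k => by cases k <;> rfl
      rw [this]
      split_ifs
      · exact (R _ _).mono (by norm_num)
      · exact (R _ _).mono (by norm_num)
    case loc l =>
      cases k <;> cases l <;> simp at hx
      · exact (Comp.ite .z compP_useful (R .z (.loc .cc)) (R .z (.loc .ch'))).mono (by norm_num)
      · exact (Comp.ite .z compP_useful (R .z (.adv 0)) (R .z (.loc .x'))).mono (by norm_num)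
      · exact (Comp.ite .z compP_useful (R .z (.adv 1)) (R .z (.loc .y'))).mono (by norm_num)
      · exact (Comp.ofP (CompP.or (CompP.reg (Λ := layout (N + 5)) (.loc .found))
          compP_useful)).mono (by norm_num)
    all_goals simp at hx

theorem impl_kTrial (hN : N + 6 ≤ X) (W : List (Kind × ℕ)) (hW : W.length ≤ X + 1) {P : Prog Γ}
    (hP : P.cost ≤ X) : Impl (layout (N + 5)) X 30 (kTrial (N := N) W P) := by
  have h0 : Impl (layout (N + 5)) X 0 fun v : BVM =>
    (unif Γ.Z).map fun a => v.set .z (.loc .cc) a := Impl.rand _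
  exact (h0.seq ((impl_feed .cc).seq ((Impl.runAdv hP).seq (impl_record hN W hW)))).mono
    (by norm_num)

theorem impl_conclude :
    Impl (layout (N + 5)) X 20 fun v : BVM => PMF.pure (conclude v) := by
  have R : ∀ k (x : Reg (N + 5)), Comp (layout (N + 5)) X 1 k (fun v : BVM => v k x) := Comp.reg
  refine (Impl.assign (c := 14) (w := 2)
    [(.b, .loc .ver), (.z, .loc .t0), (.z, .loc .th), (.z, .pad 0)] ?_ conclude ?_ ?_).mono
    (by norm_num)
  · have := four_mul_pow_le X 0
    simpa using this
  · intro v k x hx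
    cases x
    case loc l => cases k <;> cases l <;> first | rfl | simp at hx
    case pad i =>
      cases k
      case z =>
        obtain ⟨i, hi⟩ := i
        cases i
        · exact absurd hx (by simp)
        · rfl
      all_goals rfl
    all_goals cases k <;> rfl
  · intro k x hx
    simp only [List.mem_cons, Prod.mk.injEq, List.not_mem_nil, or_false] at hx
    rcases hx with ⟨rfl, rfl⟩ | ⟨rfl, rfl⟩ | ⟨rfl, rfl⟩ | ⟨rfl, rfl⟩
    · exact (Comp.ofP (compP_accepts .ch)).mono (by norm_num)
    · exact (Comp.divZ (Comp.subZ (R .z (.adv 0)) (R .z (.loc .x')))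
        (Comp.subZ (R .z (.loc .ch)) (R .z (.loc .ch')))).mono (by norm_num)
    · exact (Comp.divZ (Comp.subZ (R .z (.adv 1)) (R .z (.loc .y')))
        (Comp.subZ (R .z (.loc .ch)) (R .z (.loc .ch')))).mono (by norm_num)
    · exact (R .z (.loc .idr)).mono (by norm_num)

omit hX in
theorem length_respondDst {Q : AQuery Γ} (hQ : Q.cost ≤ X) : (respondDst Q).length ≤ X + 1 := by
  have := Q.respond.length_le_cost
  simp only [respondDst, List.length_cons, List.length_map]
  rw [AQuery.cost] at hQ
  omega

theorem impl_kQuery (hN : N + 6 ≤ X) {K : ℕ} (hK : K ≤ X) {Q : AQuery Γ} (hQ : Q.cost ≤ X) :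
    Impl (layout (N + 5)) X 50 (kQuery (N := N) K Q) := by
  have h0 : Impl (layout (N + 5)) X 0 fun v : BVM =>
    (unif Γ.Z).map fun a => v.set .z (.loc .ch) a := Impl.rand _
  have hW := length_respondDst hQ
  have h1 : Q.commit.cost ≤ X := le_trans (Nat.le_add_right _ _) hQ
  have h2 : Q.respond.cost ≤ X := le_trans (Nat.le_add_left _ _) hQ
  have h3 := Impl.iter (w := 1) (r := K) (by simpa using hK)
    fun i (_ : i < K) => impl_kTrial (N := N) hN _ hW h2
  exact ((Impl.runAdv h1).seq ((impl_save hN _ hW).seq (h0.seq (h3.seq ((impl_feed .ch).seq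
    ((Impl.runAdv h2).seq impl_conclude)))))).mono (by norm_num)

theorem comp_tau : Comp (layout (N + 5)) X 5 .z fun v : BVM => tau v := by
  have R : ∀ k (x : Reg (N + 5)), Comp (layout (N + 5)) X 1 k (fun v : BVM => v k x) := Comp.reg
  exact (Comp.addZ (Comp.addZ (R .z (.loc .t1)) (R .z (.loc .t0))) (R .z (.loc .gam))).mono
    (by norm_num)

omit hX in
theorem length_keyList (v : BVM) : (keyList v).length = N + 2 := by
  simp [keyList]

theorem comp_keyList {k : Reg (N + 5)} (i : ℕ) :
    Comp (layout (N + 5)) X 20 .g fun v : BVM => (keyList v).getD i (v .g k) := by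
  have R : ∀ k (x : Reg (N + 5)), Comp (layout (N + 5)) X 1 k (fun v : BVM => v k x) := Comp.reg
  have hτ : CompP (layout (N + 5)) X 7 fun v : BVM => tau v = 0 :=
    (CompP.eqZ comp_tau (Comp.constZ 0)).mono (by norm_num)
  have hθ : Comp (layout (N + 5)) X 3 .z fun v : BVM => v .z (.loc .th) + v .z (.loc .del) :=
    (Comp.addZ (R .z (.loc .th)) (R .z (.loc .del))).mono (by norm_num)
  unfold keyList
  rcases i with _ | _ | i
  · exact (Comp.ite .g hτ
      (Comp.mulG (Comp.pwG (R .g (.pk 1)) hθ) (Comp.pwG (R .g (.pk 4)) (R .z (.loc .rr))))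
      (Comp.mulG (Comp.pwG (R .g (.pad 0)) comp_tau) (Comp.pwG (R .g (.pk 1)) hθ))).mono
      (by norm_num)
  · exact (Comp.ite .g hτ (Comp.pwG (R .g (.pk 0)) (R .z (.loc .rr)))
      (Comp.pwG (R .g (.pad 1)) comp_tau)).mono (by norm_num)
  · simp only [List.cons_append, List.nil_append, List.getD_cons_succ]
    by_cases hi : i < N
    · simp only [List.getD_eq_getElem?_getD, List.getElem?_ofFn, hi, dif_pos, Option.getD_some]
      exact (Comp.ite .g hτ (Comp.mulG (Comp.pwG (R .g (.pk _)) (R .z (.loc .rr)))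
        (Comp.pwG (R .g (.pk _)) (Comp.mulZ (Comp.negZ (R .z (.loc .idr))) (R .z (.loc .rr)))))
        (Comp.pwG (R .g (.pad _)) comp_tau)).mono (by norm_num)
    · simp only [List.getD_eq_getElem?_getD, List.getElem?_ofFn, hi, dif_neg, not_false_iff,
        Option.getD_none]
      exact (R .g k).mono (by norm_num)

theorem compP_due : CompP (layout (N + 5)) X 5 fun v : BVM => due v :=
  (CompP.and (CompP.reg (Λ := layout (N + 5)) (.pad 0)) (CompP.reg (.loc .ver))).mono (by norm_num)

theorem compP_good : CompP (layout (N + 5)) X 9 fun v : BVM => good v :=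
  (CompP.and compP_due (CompP.reg (Λ := layout (N + 5)) (.loc .found))).mono (by norm_num)

theorem impl_deliverKey (hN : N + 6 ≤ X) :
    Impl (layout (N + 5)) X 35 fun v : BVM => PMF.pure (deliverKey v) := by
  have R : ∀ k (x : Reg (N + 5)), Comp (layout (N + 5)) X 1 k (fun v : BVM => v k x) := Comp.reg
  refine (Impl.assign (c := 30) (w := 3)
    ((List.range (N + 2)).map (fun i => (Kind.g, Reg.adv i)) ++
      [(.z, .adv 0), (.b, .adv 0), (.b, .loc .fail)]) ?_ deliverKey ?_ ?_).mono (by norm_num)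
  · simp only [List.length_append, List.length_map, List.length_range, List.length_cons,
      List.length_nil]
    exact le_cube (by omega)
  · intro v k x hx
    cases x
    case adv i =>
      cases k
      case g =>
        simp at hx
        have : (keyList v).getD i (v .g (.adv i)) = v .g (.adv i) :=
          getD_of_length_le (by rw [length_keyList]; omega) _
        simp only [deliverKey, this, ite_self]
      case t => rfl
      all_goals
        cases i
        · simp at hx
        · rfl
    case loc l => cases k <;> cases l <;> first | rfl | simp at hx
    all_goals cases k <;> rfl
  · intro k x hx
    cases x
    case adv i =>
      cases k
      case g =>
        exact (Comp.ite .g compP_good (comp_keyList i) (R .g (.adv i))).mono (by norm_num)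
      case t => simp at hx
      case z =>
        obtain rfl : i = 0 := by simpa using hx
        exact (Comp.ite .z compP_good (R .z (.loc .t1)) (R .z (.adv 0))).mono (by norm_num)
      case b =>
        obtain rfl : i = 0 := by simpa using hx
        exact (Comp.ofP compP_good).mono (by norm_num)
    case loc l =>
      cases k <;> cases l <;> simp at hx
      have B : ∀ x : Reg (N + 5), CompP (layout (N + 5)) X 1 (fun v : BVM => v .b x = true) :=
        CompP.reg
      exact (Comp.ofP (CompP.or (B (.loc .fail)) (CompP.and compP_due
        (CompP.not (B (.loc .found)))))).mono (by norm_num)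
    all_goals simp at hx

theorem impl_kKey (hN : N + 6 ≤ X) : Impl (layout (N + 5)) X 40 (kKey (Γ := Γ) (N := N)) := by
  have R : ∀ x : Reg (N + 5), Impl (layout (N + 5)) X 0
    fun v : BVM => (unitZ Γ).map fun a => v.set .z x a := Impl.randUnit
  have h2 := (R (.loc .t1)).seq ((R (.loc .rr)).seq (impl_deliverKey hN))
  exact h2.mono (by norm_num)

theorem impl_kChoose {P : Prog Γ} (hP : P.cost ≤ X) :
    Impl (layout (N + 5)) X 10 (kChoose (N := N) P) := by
  have h1 : Impl (layout (N + 5)) X 4 fun v : BVM => PMF.pure (putMsg v) := by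
    refine (Impl.assign (c := 1) (w := 0) [(.t, .pad 0)] (by simp) putMsg ?_ ?_).mono (by norm_num)
    · intro v k x hx
      cases x
      case pad i =>
        cases k
        case t =>
          obtain ⟨i, hi⟩ := i
          cases i
          · exact absurd hx (by simp)
          · rfl
        all_goals rfl
      all_goals cases k <;> rfl
    · intro k x hx
      simp only [List.mem_singleton, Prod.mk.injEq] at hx
      obtain ⟨rfl, rfl⟩ := hx
      exact (Comp.constT 1).mono (by norm_num)
  have h2 : Impl (layout (N + 5)) X 0 fun v : BVM =>
    (unif Bool).map fun a => v.set .b (.loc .d) a := Impl.coin _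
  exact ((Impl.runAdv hP).seq (h1.seq h2)).mono (by norm_num)

theorem impl_deliverCt : Impl (layout (N + 5)) X 20 fun v : BVM => PMF.pure (deliverCt v) := by
  have R : ∀ k (x : Reg (N + 5)), Comp (layout (N + 5)) X 1 k (fun v : BVM => v k x) := Comp.reg
  refine (Impl.assign (c := 14) (w := 2)
    [(.t, .adv 0), (.t, .adv 1), (.g, .adv 0), (.g, .adv 1)] ?_ deliverCt ?_ ?_).mono
    (by norm_num)
  · have := four_mul_pow_le X 0
    simpa using this
  · intro v k x hx
    cases x
    case adv i =>
      cases k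
      case b => rfl
      case z => rfl
      all_goals
        rcases i with _ | _ | i
        · simp at hx
        · simp at hx
        · rfl
    all_goals cases k <;> rfl
  · intro k x hx
    simp only [List.mem_cons, Prod.mk.injEq, List.not_mem_nil, or_false] at hx
    rcases hx with ⟨rfl, rfl⟩ | ⟨rfl, rfl⟩ | ⟨rfl, rfl⟩ | ⟨rfl, rfl⟩
    · exact (Comp.mulT (Comp.mulT (Comp.ite .t (CompP.reg (Λ := layout (N + 5)) (.loc .d))
        (R .t (.adv 1)) (R .t (.adv 0))) (Comp.pwT (R .t (.pad 0)) (R .z (.loc .gam))))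
        (Comp.pwT (Comp.pair (R .g (.pk 1)) (R .g (.pad 0))) (R .z (.loc .del)))).mono (by norm_num)
    · exact (R .t (.pad 0)).mono (by norm_num)
    · exact (R .g (.pad 0)).mono (by norm_num)
    · exact (R .g (.pad 1)).mono (by norm_num)

theorem impl_kGuess {P : Prog Γ} (hP : P.cost ≤ X) :
    Impl (layout (N + 5)) X 30 (kGuess (N := N) P) := by
  have R : ∀ k (x : Reg (N + 5)), Comp (layout (N + 5)) X 1 k (fun v : BVM => v k x) := Comp.reg
  have B : ∀ x : Reg (N + 5), CompP (layout (N + 5)) X 1 (fun v : BVM => v .b x = true) := CompP.reg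
  have h1 : Impl (layout (N + 5)) X 24 fun v : BVM => PMF.pure (output v) := by
    refine (Impl.assign (c := 20) (w := 0) [(.b, .pad 0)] (by simp) output ?_ ?_).mono (by norm_num)
    · intro v k x hx
      cases x
      case pad i =>
        cases k
        case b =>
          obtain ⟨i, hi⟩ := i
          cases i
          · exact absurd hx (by simp)
          · rfl
        all_goals rfl
      all_goals cases k <;> rfl
    · intro k x hx
      simp only [List.mem_singleton, Prod.mk.injEq] at hx
      obtain ⟨rfl, rfl⟩ := hx
      exact (Comp.ite .b (B (.loc .fail)) (R .b (.loc .coin)) (Comp.ofP (CompP.or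
        (CompP.and (B (.adv 0)) (B (.loc .d)))
        (CompP.and (CompP.not (B (.adv 0))) (CompP.not (B (.loc .d))))))).mono (by norm_num)
  have h2 : Impl (layout (N + 5)) X 0 fun v : BVM =>
    (unif Bool).map fun a => v.set .b (.loc .coin) a := Impl.coin _
  exact ((Impl.runAdv hP).seq (h2.seq h1)).mono (by norm_num)

end Costs

end AIBBE

end

noncomputable section

namespace AIBBE

open Classical
open scoped ENNReal

variable {Γ : BilinearGroup} {N : ℕ}

/-! ### Interleaving the reduction with the challenger -/

section Chunks

/-- The programs of the reduction between its key queries: first the delivery of the previous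
answer by `D`, later by `Dk`, and then the preparation of the next query. -/
def chunks {κ : Type} (D Dk : Prog Γ) (PC : κ → Prog Γ) : List κ → List (Prog Γ)
  | [] => []
  | Q :: Qs => (D ++ PC Q) :: chunks Dk Dk PC Qs

/-- The delivery of the last answer. -/
def lastD {κ : Type} (D Dk : Prog Γ) : List κ → Prog Γ
  | [] => D
  | _ :: _ => Dk

theorem length_chunks {κ : Type} (D Dk : Prog Γ) (PC : κ → Prog Γ) (Qs : List κ) :
    (chunks D Dk PC Qs).length = Qs.length := by
  induction Qs generalizing D with
  | nil => rfl
  | cons Q Qs ih => simp [chunks, ih]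

theorem cost_lastD_le {κ : Type} {D Dk : Prog Γ} {n : ℕ} (hD : D.cost ≤ n) (hk : Dk.cost ≤ n)
    (Qs : List κ) : (lastD D Dk Qs).cost ≤ n := by
  cases Qs <;> assumption

theorem cost_chunks_le {κ : Type} {D Dk : Prog Γ} {PC : κ → Prog Γ} {n : ℕ} (hD : D.cost ≤ n)
    (hk : Dk.cost ≤ n) (Qs : List κ) (hP : ∀ Q ∈ Qs, (PC Q).cost ≤ n) :
    ((chunks D Dk PC Qs).map Prog.cost).sum ≤ Qs.length * (2 * n) := by
  induction Qs generalizing D with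
  | nil => simp [chunks]
  | cons Q Qs ih =>
    have h1 := ih hk fun Q hQ => hP Q (by simp [hQ])
    have h2 := hP Q (by simp)
    simp only [chunks, List.map_cons, List.sum_cons, Prog.cost_append, List.length_cons]
    rw [add_mul]
    omega

/-- The invariant holds right after an answer has been delivered to the simulated adversary, whereas
a program of the reduction ends with the next query. The induction regroups the run so that each
step extends from one delivery to the next. -/
theorem rel_chunks {κ τ : Type} {R : Mem Γ → τ → Prop} (s : Setup Γ N) (S : Finset Γ.Z)
    {Dk : Prog Γ} {PC : κ → Prog Γ} {step : κ → τ → PMF τ} (Qs : List κ)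
    (h : ∀ Q ∈ Qs, ∀ m a, R m a →
      Rel 0 R ((((PC Q).run m).bind (bhAnswer s S)).bind Dk.run) (step Q a)) :
    ∀ {D : Prog Γ} {μ : PMF (Mem Γ)} {ν : PMF τ}, Rel 0 R (μ.bind D.run) ν →
      Rel 0 R ((μ.bind (bhQueries s S (chunks D Dk PC Qs))).bind (lastD D Dk Qs).run)
        (ν.bind (runList step Qs)) := by
  induction Qs with
  | nil =>
    intro D μ ν hD
    have e1 : bhQueries s S (chunks D Dk PC []) = PMF.pure := rfl
    have e2 : runList step [] = PMF.pure := rfl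
    rw [e1, e2, PMF.bind_pure, PMF.bind_pure]
    exact hD
  | cons Q Qs ih =>
    intro D μ ν hD
    have e : (μ.bind (bhQueries s S (chunks D Dk PC (Q :: Qs)))).bind (lastD D Dk (Q :: Qs)).run =
        (μ.bind D.run).bind fun m => ((((PC Q).run m).bind (bhAnswer s S)).bind
          (bhQueries s S (chunks Dk Dk PC Qs))).bind (lastD Dk Dk Qs).run := by
      have hl : (lastD D Dk (Q :: Qs)).run = (lastD Dk Dk Qs).run := by cases Qs <;> rfl
      rw [hl]
      have hq : bhQueries s S (chunks D Dk PC (Q :: Qs)) = fun m => (D.run m).bind fun m =>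
          (((PC Q).run m).bind (bhAnswer s S)).bind (bhQueries s S (chunks Dk Dk PC Qs)) := by
        funext m
        have hf : bhQueries s S (chunks Dk Dk PC Qs) =
          runList (bhStep s S) (chunks Dk Dk PC Qs) := funext (bhQueries_eq s S _)
        simp only [hf, bhQueries_eq, chunks, runList, bhStep, Prog.run_append, PMF.bind_bind]
      rw [hq]
      simp only [PMF.bind_bind]
    rw [e]
    exact hD.bind_exact fun m a hma =>
      ih (fun Q hQ => h Q (by simp [hQ])) (h Q (by simp) m a hma)

/-- A list of instructions that depend on a parameter in the state. -/
theorem runList_param {θ κ τ : Type} (step : θ → κ → τ → PMF τ) (Qs : List κ) (p : θ × τ) :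
    runList (fun Q (p : θ × τ) => (step p.1 Q p.2).map (Prod.mk p.1)) Qs p =
      (runList (step p.1) Qs p.2).map (Prod.mk p.1) := by
  induction Qs generalizing p with
  | nil => simp [runList, PMF.pure_map]
  | cons Q Qs ih =>
    rw [runList, runList, PMF.bind_map, PMF.map_bind]
    congr 1
    funext a
    exact ih _

end Chunks

local notation "BVM" => VM Γ (Reg (N + 5))

/-! ### The state of the reduction during an execution of the protocol -/

section Simulation

variable (s : Setup Γ N) (S : Finset Γ.Z)

/-- A key query, in terms of the named registers. -/
def bhAnswerV (v : BVM) : PMF BVM :=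
  if v .z (.pad 0) ∈ S then PMF.pure (v.set .b (.pad 0) false)
  else (unitZ Γ).map fun r => (v.putG (s.keyFor s.g2 (v .z (.pad 0)) r)).set .b (.pad 0) true

theorem length_keyFor (W : Γ.G) (ID r : Γ.Z) : (s.keyFor W ID r).length = N + 2 := by
  simp [Setup.keyFor]

theorem view_bhAnswer (m : Mem Γ) :
    (bhAnswer s S m).map (layout (N + 5)).view = bhAnswerV s S ((layout (N + 5)).view m) := by
  have e : (layout (N + 5)).view m .z (.pad 0) = m.z 0 := rfl
  rw [bhAnswer, bhAnswerV, e]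
  split_ifs
  · rw [PMF.pure_map, view_setB_zero]
  · have h2 : s.bhKeygen (m.z 0) = (unitZ Γ).map fun r => s.keyFor s.g2 (m.z 0) r := rfl
    rw [h2, PMF.map_comp, PMF.map_comp]
    congr 1
    funext r
    simp only [Function.comp]
    rw [view_setB_zero, view_putG (by rw [length_keyFor]; omega)]

/-- The parameters known to the reduction. -/
structure Par (γ δ : Γ.Z) (d : Bool) (v : BVM) : Prop where
  gam : v .z (.loc .gam) = γ
  del : v .z (.loc .del) = δ
  coin : v .b (.loc .d) = d
  pk0 : v .g (.pk 0) = s.g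
  pk1 : v .g (.pk 1) = s.g1
  pk2 : v .g (.pk 2) = s.g2
  pk4 : v .g (.pk 4) = s.z
  pkh : ∀ i : Fin (N + 1), v .g (.pk (i + 5)) = s.h i

variable {s} in
theorem Par.congr {γ δ : Γ.Z} {d : Bool} {v v' : BVM} (h : Par s γ δ d v)
    (h1 : v' .z (.loc .gam) = v .z (.loc .gam)) (h2 : v' .z (.loc .del) = v .z (.loc .del))
    (h3 : v' .b (.loc .d) = v .b (.loc .d)) (h4 : ∀ i, v' .g (.pk i) = v .g (.pk i)) :
    Par s γ δ d v' :=
  ⟨h1.trans h.gam, h2.trans h.del, h3.trans h.coin, (h4 _).trans h.pk0, (h4 _).trans h.pk1,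
    (h4 _).trans h.pk2, (h4 _).trans h.pk4, fun i => (h4 _).trans (h.pkh i)⟩

/-- The relation between the state of the reduction and the state of the game with rewinding. -/
structure Sim (γ δ : Γ.Z) (d : Bool) (v : BVM) (a : Mem Γ × Bool) : Prop where
  par : Par s γ δ d v
  adv : v.advMem = a.1
  fail : v .b (.loc .fail) = a.2

/-- The state of the reduction after the user's commitment and during the rewindings. -/
structure Rewound (γ δ : Γ.Z) (d : Bool) (fl : Bool) (W : List (Kind × ℕ)) (m : Mem Γ) (c : Γ.Z)
    (v : BVM) (found : Bool) : Prop where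
  par : Par s γ δ d v
  adv : v.advMem = m
  fail : v .b (.loc .fail) = fl
  sav : ∀ k i, (k, i) ∈ W → v k (.sav i) = m.get k i
  R : v .g (.loc .R) = m.g 0
  U : v .g (.loc .U) = m.g 1
  idr : v .z (.loc .idr) = m.z 0
  ch : v .z (.loc .ch) = c
  fnd : v .b (.loc .found) = found
  wit : found = true → v .z (.loc .ch') ≠ c ∧
    s.verify (m.g 0) (m.g 1) (v .z (.loc .ch')) (v .z (.loc .x')) (v .z (.loc .y'))

variable {s} {γ δ : Γ.Z} {d fl : Bool}

/-- The same challenge and the same response are used on both sides. Restoring only the registers in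
`respondDst` suffices, since the response program cannot have changed any other. -/
theorem rel_kTrial {Q : AQuery Γ} {m : Mem Γ} {c : Γ.Z} {v : BVM} {found : Bool}
    (h : Rewound s γ δ d fl (respondDst Q) m c v found) :
    Rel 0 (Rewound s γ δ d fl (respondDst Q) m c) (kTrial (respondDst Q) Q.respond v)
      ((trial s (m.g 0) (m.g 1) c Q.respond m).map fun b => found || b) := by
  rw [kTrial, trial, PMF.bind_map, PMF.map_bind]
  refine Rel.bind_same _ fun c' => ?_
  rw [Function.comp, PMF.pure_bind, runAdv, PMF.bind_map, PMF.map_comp, ← PMF.bind_pure_comp]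
  set v1 : BVM := feed .cc (v.set .z (.loc .cc) c') with hv1
  have ha : v1.advMem = m.setZ 0 c' := by
    refine Mem.ext_get fun k i => ?_
    rw [advMem_get, hv1]
    have hm : ∀ k i, v k (.adv i) = m.get k i := fun k i => by rw [← h.adv, advMem_get]
    cases k
    case z =>
      cases i
      · simp [feed, Mem.setZ, Mem.get]
      · simpa [feed, Mem.setZ, Mem.get] using hm .z _
    all_goals simpa [feed, Mem.setZ, Mem.get] using hm _ _
  rw [ha]
  -- Membership in the support is recorded because it is needed to know which registers are
  -- unchanged.
  refine Rel.bind_exact (R := fun a b => a = b ∧ a ∈ (Q.respond.run (m.setZ 0 c')).support)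
    (Rel.support_left (Rel.refl (R := fun a b => a = b) _ fun _ => rfl)) fun m' m'' hm => ?_
  obtain ⟨rfl, hm⟩ := hm
  have hu : useful (v1.push Reg.adv m') ↔
      (s.verify (m.g 0) (m.g 1) c' (m'.z 0) (m'.z 1) ∧ c' ≠ c) := by
    simp only [useful, accepts, push_pk, push_adv, push_loc, Setup.verify, hv1, feed]
    simp [h.par.pk0, h.par.pk2, h.R, h.U, h.ch, Mem.get]
  refine Rel.pure ⟨h.par.congr ?_ ?_ ?_ ?_, ?_, ?_, ?_, ?_, ?_, ?_, ?_, ?_, ?_⟩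
  · simp [record, hv1, feed]
  · simp [record, hv1, feed]
  · simp [record, hv1, feed]
  · intro i; simp [record, hv1, feed]
  · refine Mem.ext_get fun k i => ?_
    rw [advMem_get]
    by_cases hW : (k, i) ∈ respondDst Q
    · have : record (respondDst Q) (v1.push Reg.adv m') k (.adv i) = v k (.sav i) := by
        cases k <;> simp [record, hW, hv1, feed]
      rw [this, h.sav k i hW]
    · have : record (respondDst Q) (v1.push Reg.adv m') k (.adv i) = m'.get k i := by
        cases k <;> simp [record, hW]
      rw [this]
      simp only [respondDst, List.mem_cons, not_or] at hW
      rw [Prog.get_of_mem_support _ hm hW.2]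
      exact Mem.get_set_of_ne (k := .z) m c' hW.1
  · simpa [record, hv1, feed] using h.fail
  · intro k i hW
    have : record (respondDst Q) (v1.push Reg.adv m') k (.sav i) = v k (.sav i) := by
      cases k <;> simp [record, hv1, feed]
    rw [this, h.sav k i hW]
  · simpa [record, hv1, feed] using h.R
  · simpa [record, hv1, feed] using h.U
  · simpa [record, hv1, feed] using h.idr
  · simpa [record, hv1, feed] using h.ch
  · have hf : (v1.push Reg.adv m') .b (.loc .found) = found := by simpa [hv1, feed] using h.fnd
    simp only [record, hf, hu, Function.comp]
    cases found <;> simp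
  · intro hf
    simp only [record, Function.comp] at hf ⊢
    by_cases hu' : useful (v1.push Reg.adv m')
    · simp only [if_pos hu']
      have := hu.1 hu'
      simpa [hv1, feed, Mem.get] using And.symm this
    · simp only [if_neg hu']
      have h1 : found = true := by
        rw [Bool.or_eq_true, decide_eq_true_iff, ← hu] at hf
        exact hf.resolve_right hu'
      simpa [hv1, feed] using h.wit h1

theorem rel_iter_kTrial {Q : AQuery Γ} {m : Mem Γ} {c : Γ.Z} {v : BVM} (K : ℕ)
    (h : Rewound s γ δ d fl (respondDst Q) m c v false) :
    Rel 0 (Rewound s γ δ d fl (respondDst Q) m c)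
      (iter (fun _ => kTrial (respondDst Q) Q.respond) K v)
      (trials s (m.g 0) (m.g 1) c Q.respond m K) := by
  induction K with
  | zero => exact Rel.pure h
  | succ K ih =>
    rw [iter, trials]
    exact ih.bind_exact fun v b hv => rel_kTrial hv

end Simulation

end AIBBE

end

/-! ### Perfect simulation of the answers to key queries -/

noncomputable section

namespace AIBBE

open Classical
open scoped ENNReal

variable {Γ : BilinearGroup} {N : ℕ}

local notation "BVM" => VM Γ (Reg (N + 5))

section Answers

variable {s : Setup Γ N} {γ δ : Γ.Z} {d fl : Bool}

theorem Par.deliverKey {v : BVM} (h : Par s γ δ d v) : Par s γ δ d (deliverKey v) :=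
  h.congr rfl rfl rfl fun _ => rfl

theorem sim_deliverKey_of_good {v : BVM} {m : Mem Γ} (h : Par s γ δ d v) (ha : v.advMem = m)
    (hf : v .b (.loc .fail) = fl) (hg : good v) :
    Sim s γ δ d (deliverKey v)
      (((m.putG (keyList v)).setZ 0 (v .z (.loc .t1))).setB 0 true, fl) := by
  have hm : ∀ k i, v k (.adv i) = m.get k i := fun k i => by rw [← ha, advMem_get]
  refine ⟨h.deliverKey, Mem.ext_get fun k i => ?_, ?_⟩
  · rw [advMem_get]
    cases k
    case g => simpa [deliverKey, hg, Mem.get, Mem.setB, Mem.setZ, Mem.putG] using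
      congrArg ((keyList v).getD i) (hm .g i)
    case t => exact hm .t i
    case z =>
      cases i
      · simp [deliverKey, hg, Mem.get, Mem.setB, Mem.setZ]
      · simpa [deliverKey, Mem.get, Mem.setB, Mem.setZ, Mem.putG] using hm .z _
    case b =>
      cases i
      · simp [deliverKey, hg, Mem.get, Mem.setB]
      · simpa [deliverKey, Mem.get, Mem.setB, Mem.setZ, Mem.putG] using hm .b _
  · have : ¬(due v ∧ ¬v .b (.loc .found) = true) := fun h => h.2 hg.2
    simp only [deliverKey, this, hf, or_false, Bool.decide_eq_true]

theorem sim_deliverKey_of_not_good {v : BVM} {m : Mem Γ} (h : Par s γ δ d v) (ha : v.advMem = m)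
    (hf : v .b (.loc .fail) = fl) (hg : ¬good v) :
    Sim s γ δ d (deliverKey v) (m.setB 0 false, fl || decide (due v)) := by
  have hm : ∀ k i, v k (.adv i) = m.get k i := fun k i => by rw [← ha, advMem_get]
  refine ⟨h.deliverKey, Mem.ext_get fun k i => ?_, ?_⟩
  · rw [advMem_get]
    cases k
    case g => simpa [deliverKey, hg, Mem.get, Mem.setB, Mem.setZ, Mem.putG] using hm .g i
    case t => exact hm .t i
    case z =>
      cases i
      · simpa [deliverKey, hg, Mem.get, Mem.setB, Mem.setZ] using hm .z _
      · simpa [deliverKey, Mem.get, Mem.setB, Mem.setZ, Mem.putG] using hm .z _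
    case b =>
      cases i
      · simp [deliverKey, hg, Mem.get, Mem.setB]
      · simpa [deliverKey, Mem.get, Mem.setB, Mem.setZ, Mem.putG] using hm .b _
  · have : (due v ∧ ¬v .b (.loc .found) = true) ↔ due v :=
      ⟨fun h => h.1, fun h => ⟨h, fun h' => hg ⟨h, h'⟩⟩⟩
    simp only [deliverKey, this, hf, Bool.decide_or, Bool.decide_eq_true]

/-- The user's key is assembled correctly from the key of the Boneh-Hamburg scheme. -/
theorem keyList_eq {v : BVM} (h : Par s γ δ d v) {R : Γ.G} {ID r : Γ.Z}
    (hidr : v .z (.loc .idr) = ID)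
    (hR : R = pw s.g2 (v .z (.loc .t0)) * pw s.g (v .z (.loc .th)))
    (hpad : ∀ i : Fin (N + 5 + 1), (i : ℕ) < N + 2 → v .g (.pad i) = (s.keyFor s.g2 ID r).getD i 1) :
    keyList v = s.keyFor (pw s.g2 (v .z (.loc .t1)) * R * (pw s.g2 γ * pw s.g δ)) ID
      (if tau v = 0 then v .z (.loc .rr) else r * tau v) := by
  -- Inserting R = g2^t0 g^θ and g3 = g2^γ g^δ collects the exponent τ on g2 and θ + δ on g.
  have hW : pw (pw s.g2 (v .z (.loc .t1)) * R * (pw s.g2 γ * pw s.g δ)) s.α =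
      pw (pw s.g2 s.α) (tau v) * pw s.g1 (v .z (.loc .th) + δ) := by
    rw [hR, tau, h.gam, Setup.g1, ← pw_mul, ← pw_mul, mul_comm s.α, mul_comm s.α, pw_mul, pw_mul,
      ← mul_pw]
    congr 1
    simp only [pw_add]
    ac_rfl
  have h0 := hpad 0 (by simp)
  have e0 : (s.keyFor s.g2 ID r).getD 0 1 = pw s.g2 s.α * pw s.z r := rfl
  have e2 : ∀ i : Fin N, v .g (.pad ⟨i + 2, by omega⟩) =
      pw (s.h i.succ) r * pw (s.h i.castSucc) (-ID * r) := by
    intro i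
    rw [hpad _ (by simp)]
    simp [Setup.keyFor, List.getD_eq_getElem?_getD]
  have p5 : ∀ i : Fin N, v .g (.pk (i + 5)) = s.h i.castSucc := fun i => by
    simpa using h.pkh i.castSucc
  have p6 : ∀ i : Fin N, v .g (.pk (i + 6)) = s.h i.succ := fun i => by
    simpa [Nat.add_right_comm _ 1 5] using h.pkh i.succ
  rw [keyList, Setup.keyFor]
  refine congrArg₂ (· ++ ·) (congrArg₂ List.cons ?_ (congrArg₂ List.cons ?_ rfl))
    (congrArg List.ofFn (funext fun i => ?_))
  · rw [hW, h.pk1, h.pk4, h.del]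
    split_ifs with hτ
    · rw [hτ, pw_zero, one_mul]
    · have h0' : v .g (.pad 0) = pw s.g2 s.α * pw s.z r := h0.trans e0
      rw [h0', mul_pw, ← pw_mul s.z, mul_right_comm]
  · rw [h.pk0]
    split_ifs
    · rfl
    · have h1' : v .g (.pad 1) = pw s.g r := by
        simpa [Setup.keyFor] using hpad 1 (by simp)
      rw [h1', ← pw_mul]
  · simp only [p5, p6, hidr, e2]
    split_ifs
    · rfl
    · rw [mul_pw, ← pw_mul, ← pw_mul, mul_assoc]

/-- Multiplication by τ ≠ 0 permutes the units. It couples the BH randomness r with the authority's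
randomness rτ. -/
theorem Rel.unitZ_mul {α β : Type} {R : α → β → Prop} {τ : Γ.Z} (hτ : τ ≠ 0)
    {κ : Γ.Z → PMF α} {κ' : Γ.Z → PMF β} {ε : ℝ≥0∞} (h : ∀ r, Rel ε R (κ r) (κ' (r * τ))) :
    Rel ε R ((unitZ Γ).bind κ) ((unitZ Γ).bind κ') := by
  rw [unitZ, PMF.bind_map, PMF.bind_map]
  refine Rel.bind_equiv (Equiv.mulRight (Units.mk0 τ hτ)) fun r => ?_
  simpa using h r

/-- A target identity, an invalid proof or a missing witness leads to the same refusal on both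
sides. If a key is due and a witness is known, the assembled key has exactly the authority's
distribution. -/
theorem rel_answer {S : Finset Γ.Z} {v : BVM} {m : Mem Γ} {R : Γ.G} {ID : Γ.Z} {found ver : Bool}
    (h : Par s γ δ d v) (ha : v.advMem = m) (hf : v .b (.loc .fail) = fl)
    (hfound : v .b (.loc .found) = found) (hver : v .b (.loc .ver) = ver)
    (hidr : v .z (.loc .idr) = ID) (hid : v .z (.pad 0) = ID)
    (hR : found = true → ver = true →
      R = pw s.g2 (v .z (.loc .t0)) * pw s.g (v .z (.loc .th))) :
    Rel 0 (Sim s γ δ d) ((bhAnswerV s S v).bind kKey)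
      ((if ID ∉ S ∧ ver = true then
        if found then (aAnswer s (pw s.g2 γ * pw s.g δ) R ID m).map fun m => (m, !found)
        else PMF.pure (m.setB 0 false, true)
      else PMF.pure (m.setB 0 false, false)).map fun r => (r.1, fl || r.2)) := by
  rw [bhAnswerV, hid]
  set F : BVM → Γ.Z → Γ.Z → BVM := fun v t r => (v.set .z (.loc .t1) t).set .z (.loc .rr) r with hF
  have hk : ∀ v : BVM, kKey v = (unitZ Γ).bind fun t => (unitZ Γ).bind fun r =>
      PMF.pure (deliverKey (F v t r)) := by
    intro v
    rw [kKey, PMF.bind_map]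
    congr 1; funext t
    rw [Function.comp, PMF.bind_map]
    rfl
  have hadv : ∀ (v : BVM) t r, (F v t r).advMem = v.advMem := fun v t r =>
    Mem.ext_get fun k i => by rw [advMem_get, advMem_get]; simp [hF]
  by_cases hS : ID ∈ S
  · rw [if_pos hS, PMF.pure_bind, if_neg (by simp [hS]), PMF.pure_map, hk]
    refine Rel.bind_left fun t => Rel.bind_left fun r => Rel.pure ?_
    have hd : ¬due (F (v.set .b (.pad 0) false) t r) := by simp [due, hF]
    have := sim_deliverKey_of_not_good (s := s) (γ := γ) (δ := δ) (d := d) (m := m) (fl := fl)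
      (v := F (v.set .b (.pad 0) false) t r)
      (h.congr (by simp [hF]) (by simp [hF]) (by simp [hF]) (by simp [hF]))
      (by rw [hadv, ← ha]; exact Mem.ext_get fun k i => by rw [advMem_get, advMem_get]; simp)
      (by simpa [hF] using hf) (fun hg => hd hg.1)
    simpa [hd] using this
  rw [if_neg hS, PMF.bind_map]
  set G : Γ.Z → BVM := fun r => (v.putG (s.keyFor s.g2 ID r)).set .b (.pad 0) true with hG
  have e1 : ∀ r t r', Par s γ δ d (F (G r) t r') := fun r t r' =>
    h.congr (by simp [hF, hG, VM.putG]) (by simp [hF, hG, VM.putG]) (by simp [hF, hG, VM.putG])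
      (by simp [hF, hG, VM.putG])
  have e2 : ∀ r t r', (F (G r) t r').advMem = m := fun r t r' => by
    rw [hadv, ← ha]
    exact Mem.ext_get fun k i => by
      rw [advMem_get, advMem_get]
      cases k <;> simp [hG, VM.putG]
  have e3 : ∀ r t r', (F (G r) t r') .b (.loc .fail) = fl := fun r t r' => by
    simpa [hF, hG, VM.putG] using hf
  have e4 : ∀ r t r', due (F (G r) t r') ↔ ver = true := fun r t r' => by
    simp [hF, hG, due, VM.putG, hver]
  have e5 : ∀ r t r', (F (G r) t r') .b (.loc .found) = found := fun r t r' => by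
    simpa [hF, hG, VM.putG] using hfound
  have e6 : ∀ r t r', good (F (G r) t r') ↔ ver = true ∧ found = true := fun r t r' => by
    rw [good, e4, e5]
  simp only [Function.comp_def, hk]
  by_cases hg : ver = true ∧ found = true
  · obtain ⟨hv, hfd⟩ := hg
    rw [if_pos ⟨hS, hv⟩, if_pos hfd, PMF.map_comp, aAnswer, PMF.map_comp]
    have ek : s.aKeygen (pw s.g2 γ * pw s.g δ) R ID = (unitZ Γ).bind fun t1 => (unitZ Γ).bind fun r =>
        PMF.pure (s.keyFor (pw s.g2 t1 * R * (pw s.g2 γ * pw s.g δ)) ID r, t1) := by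
      have h1 : s.aKeygen (pw s.g2 γ * pw s.g δ) R ID = (unitZ Γ).bind fun r => (unitZ Γ).map fun t1 =>
          (s.keyFor (pw s.g2 t1 * R * (pw s.g2 γ * pw s.g δ)) ID r, t1) := by
        rw [unitZ, PMF.bind_map]
        rfl
      rw [h1, PMF.bind_comm]
      congr 1
    rw [ek]
    simp only [PMF.map_bind, PMF.pure_map]
    -- Drawing t1 first fixes τ, so that the coupling of the remaining randomness may depend on
    -- whether τ = 0.
    rw [PMF.bind_comm (unitZ Γ) (unitZ Γ)]
    refine Rel.bind_same _ fun t => ?_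
    have key : ∀ r r', Sim s γ δ d (deliverKey (F (G r) t r'))
        (((m.putG (s.keyFor (pw s.g2 t * R * (pw s.g2 γ * pw s.g δ)) ID
          (if t + v .z (.loc .t0) + γ = 0 then r' else r * (t + v .z (.loc .t0) + γ)))).setZ 0
            t).setB 0 true, fl) := by
      intro r r'
      have hs := sim_deliverKey_of_good (e1 r t r') (e2 r t r') (e3 r t r')
        ((e6 r t r').2 ⟨hv, hfd⟩)
      have ht1 : F (G r) t r' .z (.loc .t1) = t := by simp [hF]
      have ht0 : F (G r) t r' .z (.loc .t0) = v .z (.loc .t0) := by simp [hF, hG, VM.putG]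
      have hth : F (G r) t r' .z (.loc .th) = v .z (.loc .th) := by simp [hF, hG, VM.putG]
      have hrr : F (G r) t r' .z (.loc .rr) = r' := by simp [hF]
      have hτ : tau (F (G r) t r') = t + v .z (.loc .t0) + γ := by
        rw [tau, ht1, ht0, (e1 r t r').gam]
      have hkl := keyList_eq (e1 r t r') (R := R) (ID := ID) (r := r)
        (by simpa [hF, hG, VM.putG] using hidr) (by rw [ht0, hth]; exact hR hfd hv) (by
          intro i hi
          have : F (G r) t r' .g (.pad i) = (s.keyFor s.g2 ID r).getD i (v .g (.pad i)) := by
            simp [hF, hG, VM.putG]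
          rw [this]
          have hl := length_keyFor s s.g2 ID r
          simp [List.getD_eq_getElem?_getD, List.getElem?_eq_getElem (by omega :
            (i : ℕ) < (s.keyFor s.g2 ID r).length)])
      rw [hkl, ht1, hrr, hτ] at hs
      exact hs
    simp only [Function.comp_def, hfd, Bool.not_true, Bool.or_false]
    -- For τ = 0 the randomness of the BH key is discarded and the fresh `rr` is matched with the
    -- authority's; otherwise `rr` is discarded and r is matched with rτ.
    by_cases hτ : t + v .z (.loc .t0) + γ = 0
    · simp only [hτ, if_true] at key
      refine Rel.bind_left fun r => Rel.bind_same _ fun r' => Rel.pure (key r r')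
    · simp only [hτ, if_false] at key
      exact Rel.unitZ_mul hτ fun r => Rel.bind_left fun r' => Rel.pure (key r r')
  · have hr : (if ID ∉ S ∧ ver = true then
        if found then (aAnswer s (pw s.g2 γ * pw s.g δ) R ID m).map fun m => (m, !found)
        else PMF.pure (m.setB 0 false, true)
      else PMF.pure (m.setB 0 false, false)) = PMF.pure (m.setB 0 false, ver) := by
      cases ver <;> cases found <;> simp_all
    rw [hr, PMF.pure_map]
    refine Rel.bind_left fun r => Rel.bind_left fun t => Rel.bind_left fun r' => Rel.pure ?_
    have := sim_deliverKey_of_not_good (e1 r t r') (e2 r t r') (e3 r t r')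
      (fun hgood => hg ((e6 r t r').1 hgood))
    rw [show decide (due (F (G r) t r')) = ver by
      rw [Bool.eq_iff_iff, decide_eq_true_iff, e4]] at this
    exact this

end Answers

end AIBBE

end

/-! ### The phases of the reduction against those of the game with rewinding -/

noncomputable section

namespace AIBBE

open Classical
open scoped ENNReal

variable {Γ : BilinearGroup} {N : ℕ}

local notation "BVM" => VM Γ (Reg (N + 5))

section Game

variable {s : Setup Γ N} {γ δ : Γ.Z} {d : Bool}

/-- An execution of the key generation protocol is simulated perfectly. -/
theorem rel_kQuery (S : Finset Γ.Z) (K : ℕ) (Q : AQuery Γ) {v : BVM} {a : Mem Γ × Bool}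
    (h : Sim s γ δ d v a) :
    Rel 0 (Sim s γ δ d) (((kQuery K Q v).bind (bhAnswerV s S)).bind kKey)
      (rewindStep s (pw s.g2 γ * pw s.g δ) S false K Q a) := by
  rw [rewindStep, rewindCore, kQuery, PMF.map_bind, runAdv, h.adv]
  simp only [PMF.bind_bind, PMF.bind_map, PMF.pure_bind]
  refine Rel.bind_same _ fun m => ?_
  rw [PMF.map_bind]
  simp only [Function.comp_def, PMF.bind_bind, PMF.pure_bind]
  refine Rel.bind_same _ fun c => ?_
  rw [PMF.map_bind]
  set v1 : BVM := (save (respondDst Q) (v.push Reg.adv m)).set .z (.loc .ch) c with hv1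
  have h1 : Rewound s γ δ d a.2 (respondDst Q) m c v1 false := by
    refine ⟨h.par.congr ?_ ?_ ?_ ?_, ?_, ?_, ?_, ?_, ?_, ?_, ?_, ?_, ?_⟩
    · simp [hv1, save]
    · simp [hv1, save]
    · simp [hv1, save]
    · intro i; simp [hv1, save]
    · refine Mem.ext_get fun k i => ?_
      rw [advMem_get]
      cases k <;> simp [hv1, save]
    · simpa [hv1, save] using h.fail
    · intro k i hW
      cases k <;> simp [hv1, save, hW]
    · simp [hv1, save, Mem.get]
    · simp [hv1, save, Mem.get]
    · simp [hv1, save, Mem.get]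
    · simp [hv1]
    · simp [hv1, save]
    · simp
  refine (rel_iter_kTrial K h1).bind_exact fun v2 found h2 => ?_
  have ha : (feed .ch v2).advMem = m.setZ 0 c := by
    refine Mem.ext_get fun k i => ?_
    rw [advMem_get]
    have hm : ∀ k i, v2 k (.adv i) = m.get k i := fun k i => by rw [← h2.adv, advMem_get]
    cases k
    case z =>
      cases i
      · simpa [feed, Mem.setZ, Mem.get] using h2.ch
      · simpa [feed, Mem.setZ, Mem.get] using hm .z _
    all_goals simpa [feed, Mem.setZ, Mem.get] using hm _ _
  rw [runAdv, ha, PMF.bind_map, PMF.map_bind]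
  refine Rel.bind_same _ fun m' => ?_
  simp only [Function.comp_def, Bool.or_false]
  set v3 : BVM := (feed .ch v2).push Reg.adv m' with hv3
  have hver : accepts .ch v3 ↔ s.verify (m.g 0) (m.g 1) c (m'.z 0) (m'.z 1) := by
    simp only [accepts, hv3, push_pk, push_adv, push_loc, Setup.verify, feed]
    rw [h2.par.pk0, h2.par.pk2, h2.R, h2.U, h2.ch]
    rfl
  have := rel_answer (S := S) (v := conclude v3) (m := m') (R := m.g 0) (ID := m.z 0) (γ := γ)
    (δ := δ) (s := s) (d := d) (fl := a.2) (found := found)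
    (ver := decide (s.verify (m.g 0) (m.g 1) c (m'.z 0) (m'.z 1)))
    (h2.par.congr (by simp [conclude, hv3, feed]) (by simp [conclude, hv3, feed])
      (by simp [conclude, hv3, feed]) (by simp [conclude, hv3, feed]))
    (by
      refine Mem.ext_get fun k i => ?_
      rw [advMem_get]
      cases k <;> simp [conclude, hv3])
    (by simpa [conclude, hv3, feed] using h2.fail)
    (by simpa [conclude, hv3, feed] using h2.fnd)
    (by simp [conclude, hver])
    (by simpa [conclude, hv3, feed] using h2.idr)
    (by
      have e : conclude v3 .z (.pad 0) = v3 .z (.loc .idr) := rfl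
      rw [e]
      simpa [hv3, feed] using h2.idr)
    (by
      intro hf hv
      have hw := h2.wit hf
      have e := extract hw.1 (of_decide_eq_true hv) hw.2
      simpa [conclude, hv3, feed, h2.ch, Mem.get] using e)
  simpa only [decide_eq_true_eq] using this

theorem getD_ofFn {M : Type} {n : ℕ} (f : Fin n → M) (i : Fin n) (x : M) :
    (List.ofFn f).getD i x = f i := by
  rw [List.getD_eq_getElem?_getD, List.getElem?_ofFn]
  simp

/-- The reduction draws γ and δ inside a program of its own, so on the other side they are carried
along as part of the state. -/
theorem rel_kPk {v : BVM} {m : Mem Γ} (ha : v.advMem = m) (hf : v .b (.loc .fail) = false)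
    (hd : v .b (.loc .d) = d)
    (hpad : ∀ i : Fin (N + 5 + 1), v .g (.pad i) =
      ([s.g, s.g1, s.g2, s.z] ++ List.ofFn s.h).getD i (v .g (.pad i))) :
    Rel 0 (fun v (p : (Γ.Z × Γ.Z) × Mem Γ × Bool) => Sim s p.1.1 p.1.2 d v p.2) (kPk v)
      ((unif Γ.Z).bind fun γ => (unif Γ.Z).bind fun δ =>
        PMF.pure ((γ, δ), m.putG (s.apk (pw s.g2 γ * pw s.g δ)), false)) := by
  rw [kPk, PMF.bind_map]
  refine Rel.bind_same _ fun γ => ?_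
  rw [Function.comp, PMF.bind_map]
  refine Rel.bind_same _ fun δ => Rel.pure ?_
  set w : BVM := (v.set .z (.loc .gam) γ).set .z (.loc .del) δ with hw
  have p0 : w .g (.pad 0) = s.g := by simpa [hw] using hpad 0
  have p1 : w .g (.pad 1) = s.g1 := by simpa [hw] using hpad 1
  have hwv : ∀ i, w .g (.pad i) = v .g (.pad i) := fun i => by simp [hw]
  have p2 : w .g (.pad 2) = s.g2 := by
    rw [show (2 : Fin (N + 5 + 1)) = ⟨2, by omega⟩ from
      Fin.ext (show 2 % (N + 5 + 1) = 2 from Nat.mod_eq_of_lt (by omega)), hwv,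
      hpad]
    rfl
  have p3 : w .g (.pad 3) = s.z := by
    rw [show (3 : Fin (N + 5 + 1)) = ⟨3, by omega⟩ from
      Fin.ext (show 3 % (N + 5 + 1) = 3 from Nat.mod_eq_of_lt (by omega)), hwv,
      hpad]
    rfl
  have ph : ∀ i : Fin (N + 1), w .g (.pad ⟨i + 4, by omega⟩) = s.h i := fun i => by
    rw [hwv, hpad]
    exact getD_ofFn s.h i _
  have hl : pkList w = s.apk (pw s.g2 γ * pw s.g δ) := by
    have e1 : w .z (.loc .gam) = γ := by simp [hw]
    have e2 : w .z (.loc .del) = δ := by simp [hw]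
    rw [pkList, p0, p1, p2, p3, e1, e2]
    simp only [ph]
    rfl
  have hpk : ∀ i, deliverPk w .g (.pk i) = (s.apk (pw s.g2 γ * pw s.g δ)).getD i (w .g (.pk i)) :=
    fun i => by rw [← hl]; rfl
  refine ⟨⟨by simp [deliverPk], by simp [deliverPk], by simpa [deliverPk, hw] using hd,
    hpk 0, hpk 1, hpk 2, hpk 4, fun i => ?_⟩, Mem.ext_get fun k i => ?_,
    by simpa [deliverPk, hw] using hf⟩
  · rw [hpk]
    exact getD_ofFn s.h i _
  · have hm : ∀ k i, v k (.adv i) = m.get k i := fun k i => by rw [← ha, advMem_get]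
    rw [advMem_get]
    cases k
    case g =>
      have : deliverPk w .g (.adv i) = (pkList w).getD i (w .g (.adv i)) := rfl
      rw [this, hl]
      have : w .g (.adv i) = m.g i := by
        have e : w .g (.adv i) = v .g (.adv i) := by simp [hw]
        exact e.trans (hm .g i)
      rw [this]
      rfl
    all_goals simpa [deliverPk, hw, Mem.get, Mem.putG] using hm _ i

theorem rel_kChoose (P : Prog Γ) {v : BVM} {a : Mem Γ × Bool} (h : Sim s γ δ d v a) :
    Rel 0 (fun v (q : Mem Γ × Bool) => Sim s γ δ q.2 v (q.1, a.2) ∧ v .t (.pad 0) = 1)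
      (kChoose P v) ((P.run a.1).bind fun m => (unif Bool).bind fun d => PMF.pure (m, d)) := by
  rw [kChoose, runAdv, h.adv, PMF.bind_map]
  refine Rel.bind_same _ fun m => ?_
  rw [Function.comp, PMF.pure_bind, ← PMF.bind_pure_comp]
  refine Rel.bind_same _ fun d' => Rel.pure ⟨⟨⟨?_, ?_, ?_, ?_, ?_, ?_, ?_, ?_⟩, ?_, ?_⟩, ?_⟩
  · simpa [putMsg] using h.par.gam
  · simpa [putMsg] using h.par.del
  · simp
  · simpa [putMsg] using h.par.pk0
  · simpa [putMsg] using h.par.pk1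
  · simpa [putMsg] using h.par.pk2
  · simpa [putMsg] using h.par.pk4
  · simpa [putMsg] using h.par.pkh
  · refine Mem.ext_get fun k i => ?_
    rw [advMem_get]
    cases k <;> simp [putMsg]
  · simpa [putMsg] using h.fail
  · exact (VM.set_ne_kind (putMsg (v.push Reg.adv m)) d' (by simp)).trans rfl

theorem sim_deliverCt (hg : s.g ≠ 1) (S : Finset Γ.Z) {v : BVM} {m : Mem Γ} {fl : Bool}
    (h : Sim s γ δ d v (m, fl)) (M : Γ.GT) (x : Γ.Z) :
    Sim s γ δ d (deliverCt ((v.putT [M * pw (Γ.e s.g1 s.g2) x]).putG [pw s.g x, pw (s.hash S) x]))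
      (putC (s.ctx (pw s.g2 γ * pw s.g δ) S M (pw M γ) (if d then m.t 1 else m.t 0) x) m, fl) := by
  set w : BVM := (v.putT [M * pw (Γ.e s.g1 s.g2) x]).putG [pw s.g x, pw (s.hash S) x] with hw
  have hm : ∀ k i, v k (.adv i) = m.get k i := fun k i => by
    rw [← advMem_get v, h.adv]
  have wadv : ∀ k i, w k (.adv i) = v k (.adv i) := fun k i => by
    cases k <;> simp [hw, VM.putG, VM.putT]
  have wt : w .t (.pad 0) = M * pw (Γ.e s.g1 s.g2) x := by simp [hw, VM.putG, VM.putT]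
  have wg0 : w .g (.pad 0) = pw s.g x := by simp [hw, VM.putG, VM.putT]
  have wg1 : w .g (.pad 1) = pw (s.hash S) x := by simp [hw, VM.putG, VM.putT]
  have hp : Par s γ δ d w := h.par.congr rfl rfl rfl fun _ => rfl
  have hc : (if d then m.t 1 else m.t 0) * pw (M * pw (Γ.e s.g1 s.g2) x) γ *
      pw (Γ.e s.g1 (pw s.g x)) δ = (if d then m.t 1 else m.t 0) * pw M γ *
        pw (Γ.e s.g1 (pw s.g2 γ * pw s.g δ)) x := by
    -- Bilinearity is available for powers of fixed elements, so everything is written with the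
    -- common base e(g,g).
    obtain ⟨b, hb⟩ := exists_pw hg s.g2
    have e1 : ∀ y : Γ.Z, Γ.e s.g1 (pw s.g y) = pw (Γ.e s.g s.g) (s.α * y) := fun y => e_pw _ _ _ _
    rw [hb, ← pw_mul, ← pw_add, e1, e1, e1, mul_pw]
    simp only [← pw_mul, mul_assoc, ← pw_add]
    congr 3
    ring
  refine ⟨hp.congr rfl rfl rfl fun _ => rfl, Mem.ext_get fun k i => ?_, h.fail⟩
  rw [advMem_get]
  cases k
  case g =>
    rcases i with _ | _ | i
    · exact wg0
    · exact wg1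
    · exact (wadv .g _).trans (hm .g _)
  case t =>
    rcases i with _ | _ | i
    · have : deliverCt w .t (.adv 0) = (if w .b (.loc .d) = true then w .t (.adv 1) else
        w .t (.adv 0)) * pw (w .t (.pad 0)) (w .z (.loc .gam)) *
          pw (Γ.e (w .g (.pk 1)) (w .g (.pad 0))) (w .z (.loc .del)) := rfl
      rw [this, wt, wg0, hp.gam, hp.del, hp.pk1, hp.coin, wadv, wadv, hm, hm]
      exact hc
    · exact wt
    · exact (wadv .t _).trans (hm .t _)
  case z => exact (wadv .z _).trans (hm .z _)
  case b => exact (wadv .b _).trans (hm .b _)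

theorem rel_kGuess (P : Prog Γ) {v : BVM} {b : Mem Γ × Bool} (h : Sim s γ δ d v b) :
    Rel 0 (fun v r => v .b (.pad 0) = r) (kGuess P v)
      ((P.run b.1).bind fun m => mix (m.b 0 == d, b.2)) := by
  rw [kGuess, runAdv, h.adv, PMF.bind_map]
  refine Rel.bind_same _ fun m => ?_
  rw [Function.comp, PMF.bind_map, mix]
  have e : ∀ a : Bool, output ((v.push Reg.adv m).set .b (.loc .coin) a) .b (.pad 0) =
      if b.2 then a else m.b 0 == d := by
    intro a
    have : ∀ w : BVM, output w .b (.pad 0) = if w .b (.loc .fail) = true then w .b (.loc .coin) else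
      decide ((w .b (.adv 0) = true ∧ w .b (.loc .d) = true) ∨
        (¬w .b (.adv 0) = true ∧ ¬w .b (.loc .d) = true)) := fun _ => rfl
    rw [this]
    have hb : ((v.push Reg.adv m).set .b (.loc .coin) a) .b (.loc .d) = d := by
      simpa using h.par.coin
    have hf : ((v.push Reg.adv m).set .b (.loc .coin) a) .b (.loc .fail) = b.2 := by
      simpa using h.fail
    have ha : ((v.push Reg.adv m).set .b (.loc .coin) a) .b (.adv 0) = m.b 0 := by
      simp [Mem.get]
    rw [hb, hf, ha, VM.set_same]
    congr 1
    cases m.b 0 <;> cases d <;> simp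
  by_cases hb : b.2 = true
  · simp only [hb, if_true]
    nth_rw 2 [← PMF.bind_pure (unif Bool)]
    refine Rel.bind_same _ fun a => Rel.pure ?_
    simpa [hb] using e a
  · simp only [hb]
    refine Rel.bind_left fun a => Rel.pure ?_
    simpa [hb] using e a

end Game

end AIBBE

end

/-! ### Assembly of the reduction from its programs -/

noncomputable section

namespace AIBBE

open Classical
open scoped ENNReal

variable {Γ : BilinearGroup} {N : ℕ}

local notation "BVM" => VM Γ (Reg (N + 5))

section Assembly

/-- The program `P` acts as `κ` on the named registers. -/
def Acts (N : ℕ) (P : Prog Γ) (κ : VM Γ (Reg (N + 5)) → PMF (VM Γ (Reg (N + 5)))) : Prop :=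
  ∀ m, (P.run m).map (layout (N + 5)).view = κ ((layout (N + 5)).view m)

theorem Acts.rel {P : Prog Γ} {κ : BVM → PMF BVM} (h : Acts N P κ) {τ : Type} {R : BVM → τ → Prop}
    {m : Mem Γ} {ν : PMF τ} {δ : ℝ≥0∞} (hR : Rel δ R (κ ((layout (N + 5)).view m)) ν) :
    Rel δ (fun m b => R ((layout (N + 5)).view m) b) (P.run m) ν := by
  rw [← h] at hR
  exact Rel.of_map_left hR

/-- The adversary against the Boneh-Hamburg scheme. -/
def reduction (A : AAdversary Γ) (Pstart Ppk Pkey Pch Pct Pg : Prog Γ) (PC : AQuery Γ → Prog Γ) :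
    BHAdversary Γ where
  start := Pstart
  pre := chunks Ppk Pkey PC A.pre
  choose := lastD Ppk Pkey A.pre ++ Pch
  post := chunks Pct Pkey PC A.post
  guess := lastD Pct Pkey A.post ++ Pg

theorem targets_congr {m m' : Mem Γ} (hz : ∀ i < N, m.z i = m'.z i) (hb : ∀ i < N, m.b i = m'.b i) :
    targets N m = targets N m' := by
  ext x
  simp only [targets, Finset.mem_image, Finset.mem_filter, Finset.mem_range]
  constructor
  · rintro ⟨i, ⟨hi, h⟩, rfl⟩
    exact ⟨i, ⟨hi, by rw [← hb i hi, h]⟩, (hz i hi).symm⟩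
  · rintro ⟨i, ⟨hi, h⟩, rfl⟩
    exact ⟨i, ⟨hi, by rw [hb i hi, h]⟩, hz i hi⟩

theorem rel_kStart (P : Prog Γ) :
    Rel 0 (fun (v : BVM) a => v.advMem = a ∧ v .b (.loc .fail) = false ∧
      v .b (.loc .d) = false ∧ (∀ i : Fin (N + 5 + 1), (i : ℕ) < N → v .z (.pad i) = a.z i) ∧
      ∀ i : Fin (N + 5 + 1), (i : ℕ) < N → v .b (.pad i) = a.b i)
      (kStart P ((layout (N + 5)).view (Mem.init Γ))) (P.run (Mem.init Γ)) := by
  have h0 : ((layout (N + 5)).view (Mem.init Γ)).advMem = Mem.init Γ := by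
    refine Mem.ext_get fun k i => ?_
    rw [advMem_get]
    cases k <;> rfl
  rw [kStart, runAdv, h0, PMF.bind_map]
  nth_rw 2 [← PMF.bind_pure (P.run _)]
  refine Rel.bind_same _ fun a => Rel.pure ⟨?_, ?_, ?_, ?_, ?_⟩
  · refine Mem.ext_get fun k i => ?_
    rw [advMem_get]
    cases k <;> simp [announce]
  · simp [announce, Layout.view, Mem.get, Mem.init]
  · simp [announce, Layout.view, Mem.get, Mem.init]
  · intro i hi
    simp [announce, hi, Mem.get]
  · intro i hi
    simp [announce, hi, Mem.get]

variable {A : AAdversary Γ} {Pstart Ppk Pkey Pch Pct Pg : Prog Γ} {PC : AQuery Γ → Prog Γ} {K : ℕ}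

/-- A key query, from delivery to delivery. -/
theorem rel_query {s : Setup Γ N} {γ δ : Γ.Z} {d : Bool} (S : Finset Γ.Z) {Q : AQuery Γ}
    (hkey : Acts N Pkey kKey) (hPC : Acts N (PC Q) (kQuery K Q)) {m : Mem Γ}
    {a : Mem Γ × Bool} (h : Sim s γ δ d ((layout (N + 5)).view m) a) :
    Rel 0 (fun m a => Sim s γ δ d ((layout (N + 5)).view m) a)
      ((((PC Q).run m).bind (bhAnswer s S)).bind Pkey.run)
      (rewindStep s (pw s.g2 γ * pw s.g δ) S false K Q a) := by
  refine Rel.of_map_left (R := Sim s γ δ d) ?_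
  rw [PMF.map_bind]
  have e1 : (fun m => (Pkey.run m).map (layout (N + 5)).view) =
      fun m => kKey ((layout (N + 5)).view m) := funext hkey
  have e2 : ((((PC Q).run m).bind (bhAnswer s S)).map (layout (N + 5)).view) =
      (kQuery K Q ((layout (N + 5)).view m)).bind (bhAnswerV s S) := by
    rw [PMF.map_bind, ← hPC m, PMF.bind_map]
    congr 1
    funext m
    exact view_bhAnswer s S m
  have e3 : ((((PC Q).run m).bind (bhAnswer s S)).bind fun m => kKey ((layout (N + 5)).view m)) =
      ((((PC Q).run m).bind (bhAnswer s S)).map (layout (N + 5)).view).bind kKey := by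
    rw [PMF.bind_map]
    rfl
  rw [e1, e3, e2]
  exact rel_kQuery S K Q h

/-- The game with rewinding after the choice of the messages. -/
def lateGame (real : Bool) (K : ℕ) (A : AAdversary Γ) (s : Setup Γ N) (S : Finset Γ.Z)
    (θ : Γ.Z × Γ.Z) (fl : Bool) (q : Mem Γ × Bool) : PMF Bool :=
  (if real then PMF.pure 1 else unif Γ.GT).bind fun T => (unitZ Γ).bind fun x =>
  (runList (rewindStep s (pw s.g2 θ.1 * pw s.g θ.2) S false K) A.post
    (putC (s.ctx (pw s.g2 θ.1 * pw s.g θ.2) S T (pw T θ.1) (if q.2 then q.1.t 1 else q.1.t 0) x) q.1,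
      fl)).bind fun b =>
  (A.guess.run b.1).bind fun m => mix (m.b 0 == q.2, b.2)

/-- The game with rewinding after the first key queries. -/
def midGame (real : Bool) (K : ℕ) (A : AAdversary Γ) (s : Setup Γ N) (S : Finset Γ.Z)
    (p : (Γ.Z × Γ.Z) × Mem Γ × Bool) : PMF Bool :=
  ((A.choose.run p.2.1).bind fun m => (unif Bool).bind fun d => PMF.pure (m, d)).bind
    (lateGame real K A s S p.1 p.2.2)

/-- The beginning of the game with rewinding. -/
def openGame (s : Setup Γ N) (a : Mem Γ) : PMF ((Γ.Z × Γ.Z) × Mem Γ × Bool) :=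
  (unif Γ.Z).bind fun γ => (unif Γ.Z).bind fun δ =>
    PMF.pure ((γ, δ), a.putG (s.apk (pw s.g2 γ * pw s.g δ)), false)

/-- A key query in the game with rewinding, with the parameters as part of the state. -/
def paramStep (K : ℕ) (s : Setup Γ N) (S : Finset Γ.Z) (Q : AQuery Γ)
    (p : (Γ.Z × Γ.Z) × Mem Γ × Bool) : PMF ((Γ.Z × Γ.Z) × Mem Γ × Bool) :=
  (rewindStep s (pw s.g2 p.1.1 * pw s.g p.1.2) S false K Q p.2).map (Prod.mk p.1)

/-- The game is regrouped into the phases of the reduction, with (γ,δ) in the state and `d` drawn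
before the challenge factor `T`. -/
theorem gameBody_bind_mix (real : Bool) (s : Setup Γ N) (a : Mem Γ) :
    ((unif Γ.Z).bind fun γ => (unif Γ.Z).bind fun δ =>
      (gameBody false K A a s (pw s.g2 γ * pw s.g δ)
        ((if real then PMF.pure 1 else unif Γ.GT).map fun T => (T, pw T γ))).bind mix) =
      ((openGame s a).bind (runList (paramStep K s (targets N a)) A.pre)).bind
        (midGame real K A s (targets N a)) := by
  have h1 : ∀ p, runList (paramStep K s (targets N a)) A.pre p =
      (runList (rewindStep s (pw s.g2 p.1.1 * pw s.g p.1.2) (targets N a) false K) A.pre p.2).map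
        (Prod.mk p.1) := fun p =>
    runList_param (fun p : Γ.Z × Γ.Z => rewindStep s (pw s.g2 p.1 * pw s.g p.2) (targets N a) false K)
      A.pre p
  rw [openGame]
  simp only [PMF.bind_bind, PMF.pure_bind, h1, PMF.bind_map]
  congr 1; funext γ; congr 1; funext δ
  rw [gameBody, PMF.bind_bind]
  congr 1; funext p
  simp only [Function.comp, midGame, lateGame, PMF.bind_bind, PMF.pure_bind, PMF.bind_map]
  congr 1; funext m'
  rw [PMF.bind_comm]
  rfl

theorem rel_late (hkey : Acts N Pkey kKey) (hct : Acts N Pct fun v => PMF.pure (deliverCt v))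
    (hg : Acts N Pg (kGuess A.guess)) (hPC : ∀ Q ∈ A.post, Acts N (PC Q) (kQuery K Q)) (real : Bool)
    {s : Setup Γ N} (hg1 : s.g ≠ 1) (S : Finset Γ.Z) {θ : Γ.Z × Γ.Z} {fl : Bool} {m : Mem Γ}
    {q : Mem Γ × Bool} (h : Sim s θ.1 θ.2 q.2 ((layout (N + 5)).view m) (q.1, fl)) (h1 : m.t 0 = 1) :
    Rel 0 (· = ·)
      ((if real then PMF.pure (m.t 0) else unif Γ.GT).bind fun M => (s.bhEncrypt S M).bind fun C =>
        (bhQueries s S (chunks Pct Pkey PC A.post) ((m.putT [C.1]).putG [C.2.1, C.2.2])).bind fun m =>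
        (Prog.run (lastD Pct Pkey A.post ++ Pg) m).map fun m => m.b 0)
      (lateGame real K A s S θ fl q) := by
  obtain ⟨m', d⟩ := q
  obtain ⟨γ, δ⟩ := θ
  rw [lateGame, h1]
  refine Rel.bind_same _ fun T => ?_
  have he : s.bhEncrypt S T = (unitZ Γ).map fun x =>
    (T * pw (Γ.e s.g1 s.g2) x, pw s.g x, pw (s.hash S) x) := rfl
  rw [he, PMF.bind_map]
  refine Rel.bind_same _ fun x => ?_
  simp only [Function.comp]
  set m₃ := (m.putT [T * pw (Γ.e s.g1 s.g2) x]).putG [pw s.g x, pw (s.hash S) x] with hm₃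
  have eL : ((bhQueries s S (chunks Pct Pkey PC A.post) m₃).bind fun m =>
        (Prog.run (lastD Pct Pkey A.post ++ Pg) m).map fun m => m.b 0) =
      (((PMF.pure m₃).bind (bhQueries s S (chunks Pct Pkey PC A.post))).bind
        (lastD Pct Pkey A.post).run).bind fun m => (Pg.run m).map fun m => m.b 0 := by
    simp only [PMF.pure_bind, Prog.run_append, PMF.bind_bind, PMF.map_bind]
  rw [eL, ← PMF.pure_bind (putC _ m', fl) (runList _ A.post)]
  refine Rel.bind_exact (R := fun m p => Sim s γ δ d ((layout (N + 5)).view m) p)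
    (rel_chunks s S A.post ?_ ?_) fun m₄ b hb => ?_
  · intro Q hQ m a h
    exact rel_query S hkey (hPC Q hQ) h
  · rw [PMF.pure_bind]
    refine hct.rel (Rel.pure ?_)
    rw [hm₃, view_putG (by simp), view_putT (by simp)]
    exact sim_deliverCt hg1 S h T x
  · have h1 := hg.rel (rel_kGuess A.guess hb)
    have h2 := h1.map (φ := fun m => m.b 0) (ψ := id) (R' := fun a b => a = b) fun a b hab => hab
    rwa [PMF.map_id] at h2

theorem rel_open (hpk : Acts N Ppk kPk) {s : Setup Γ N} {m a : Mem Γ}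
    (ha : ((layout (N + 5)).view m).advMem = a)
    (hfail : (layout (N + 5)).view m .b (.loc .fail) = false)
    (hd : (layout (N + 5)).view m .b (.loc .d) = false) :
    Rel 0 (fun m (p : (Γ.Z × Γ.Z) × Mem Γ × Bool) => Sim s p.1.1 p.1.2 false ((layout (N + 5)).view m) p.2)
      (Ppk.run (m.putG ([s.g, s.g1, s.g2, s.z] ++ List.ofFn s.h))) (openGame s a) := by
  refine hpk.rel (R := fun v (p : (Γ.Z × Γ.Z) × Mem Γ × Bool) => Sim s p.1.1 p.1.2 false v p.2) ?_
  have hl : ([s.g, s.g1, s.g2, s.z] ++ List.ofFn s.h).length ≤ N + 5 + 1 := by simp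
  rw [view_putG hl]
  refine rel_kPk ?_ hfail hd fun i => ?_
  · rw [← ha]; rfl
  · simp only [VM.putG]
    rcases lt_or_ge (i : ℕ) ([s.g, s.g1, s.g2, s.z] ++ List.ofFn s.h).length with h | h
    · rw [List.getD_eq_getElem _ _ h, List.getD_eq_getElem _ _ h]
    · rw [getD_of_length_le h, getD_of_length_le h]

/-- Every phase is coupled without error, whence an equality of distributions. All losses occur
later, where the game with rewinding is compared with the original one. -/
theorem bhGame_reduction (hstart : Acts N Pstart (kStart A.start)) (hpk : Acts N Ppk kPk)
    (hkey : Acts N Pkey kKey) (hch : Acts N Pch (kChoose A.choose))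
    (hct : Acts N Pct fun v => PMF.pure (deliverCt v)) (hg : Acts N Pg (kGuess A.guess))
    (hPC : ∀ Q, Q ∈ A.pre ∨ Q ∈ A.post → Acts N (PC Q) (kQuery K Q)) (real : Bool) :
    bhGame N real (reduction A Pstart Ppk Pkey Pch Pct Pg PC) =
      (rewindGame N false K A (if real then PMF.pure 1 else unif Γ.GT)).bind mix := by
  refine Rel.eq ?_
  rw [bhGame, rewindGame, PMF.bind_bind]
  refine (hstart.rel (rel_kStart A.start)).bind_exact fun m a₀ hma => ?_
  obtain ⟨ha, hfail, hd, hz, hb⟩ := hma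
  have hS : targets N m = targets N a₀ :=
    targets_congr (fun i hi => hz ⟨i, by omega⟩ hi) fun i hi => hb ⟨i, by omega⟩ hi
  rw [PMF.bind_bind]
  refine (Rel.support_left (Rel.refl (R := fun a b => a = b) (setup Γ N) fun _ => rfl)).bind_exact
    fun s s' hs => ?_
  obtain ⟨rfl, hs⟩ := hs
  have hg1 := setup_g_ne_one hs
  simp only [PMF.bind_bind]
  rw [gameBody_bind_mix, hS]
  have eL : ∀ κ : Mem Γ → PMF Bool,
      ((bhQueries s (targets N a₀) (chunks Ppk Pkey PC A.pre)
        (m.putG ([s.g, s.g1, s.g2, s.z] ++ List.ofFn s.h))).bind fun m =>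
        (Prog.run (lastD Ppk Pkey A.pre ++ Pch) m).bind κ) =
      (((PMF.pure (m.putG ([s.g, s.g1, s.g2, s.z] ++ List.ofFn s.h))).bind
        (bhQueries s (targets N a₀) (chunks Ppk Pkey PC A.pre))).bind
          (lastD Ppk Pkey A.pre).run).bind fun m => (Pch.run m).bind κ := fun κ => by
    simp only [PMF.pure_bind, Prog.run_append, PMF.bind_bind]
  refine Eq.mpr (congrArg (fun μ => Rel 0 _ μ _) (eL _)) ?_
  refine Rel.bind_exact (R := fun m (p : (Γ.Z × Γ.Z) × Mem Γ × Bool) =>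
      Sim s p.1.1 p.1.2 false ((layout (N + 5)).view m) p.2)
    (rel_chunks s (targets N a₀) A.pre ?_ ?_) fun m₁ p hp => ?_
  · rintro Q hQ m ⟨⟨γ, δ⟩, a⟩ h
    have := rel_query (targets N a₀) hkey (hPC Q (Or.inl hQ)) h
    rw [paramStep, ← PMF.map_id (PMF.bind _ _)]
    exact this.map fun a b hab => hab
  · rw [PMF.pure_bind]
    exact rel_open hpk ha hfail hd
  · rw [midGame]
    refine (hch.rel (rel_kChoose A.choose hp)).bind_exact fun m₂ q hq => ?_
    exact rel_late hkey hct hg (fun Q hQ => hPC Q (Or.inr hQ)) real hg1 _ hq.1 hq.2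

end Assembly

end AIBBE

end

/-! ### Size and advantage of the reduction -/

noncomputable section

namespace AIBBE

open Classical
open scoped ENNReal

variable {Γ : BilinearGroup} {N : ℕ}

section Quantitative

theorem le_sum_map {κ : Type} (f : κ → ℕ) {l : List κ} {x : κ} (h : x ∈ l) :
    f x ≤ (l.map f).sum :=
  List.single_le_sum (fun _ _ => Nat.zero_le _) _ (List.mem_map_of_mem h)

theorem exists_reduction (N : ℕ) (A : AAdversary Γ) (K : ℕ) :
    ∃ B : BHAdversary Γ, B.queries = A.queries ∧ B.size ≤ (A.size + N + K + 2) ^ 156 ∧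
      ∀ real : Bool, bhGame N real B =
        (rewindGame N false K A (if real then PMF.pure 1 else unif Γ.GT)).bind mix := by
  obtain ⟨Y, hY⟩ : ∃ Y, Y = A.size + N + K + 2 := ⟨_, rfl⟩
  -- The shift by 4 ensures N + 6 ≤ X. Every program costs at most X^50, the whole adversary at most
  -- X^50 (3X + 5) ≤ X^52, and X ≤ Y^3, which gives the exponent 156 = 3 · 52.
  obtain ⟨X, hXdef⟩ : ∃ X, X = Y + 4 := ⟨_, rfl⟩
  rw [← hY]
  have hX : Fact (2 ≤ X) := ⟨by omega⟩
  have hN : N + 6 ≤ X := by omega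
  have hK : K ≤ X := by omega
  have hsz : A.size = A.start.cost + (A.pre.map AQuery.cost).sum + A.choose.cost +
    (A.post.map AQuery.cost).sum + A.guess.cost + A.queries := rfl
  obtain ⟨Pstart, c1, a1⟩ := impl_kStart (X := X) hN (P := A.start) (by omega)
  obtain ⟨Ppk, c2, a2⟩ := impl_kPk (Γ := Γ) (X := X) hN
  obtain ⟨Pkey, c3, a3⟩ := impl_kKey (Γ := Γ) (X := X) hN
  obtain ⟨Pch, c4, a4⟩ := impl_kChoose (N := N) (X := X) (P := A.choose) (by omega)
  obtain ⟨Pct, c5, a5⟩ := impl_deliverCt (Γ := Γ) (N := N) (X := X)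
  obtain ⟨Pg, c6, a6⟩ := impl_kGuess (N := N) (X := X) (P := A.guess) (by omega)
  have hQ : ∀ Q : AQuery Γ, ∃ P : Prog Γ, (Q ∈ A.pre ∨ Q ∈ A.post) →
      (P.cost ≤ X ^ 50 ∧ Acts N P (kQuery K Q)) := by
    intro Q
    by_cases h : Q ∈ A.pre ∨ Q ∈ A.post
    · have hc : Q.cost ≤ X := by
        rcases h with h | h
        · have := le_sum_map AQuery.cost h
          omega
        · have := le_sum_map AQuery.cost h
          omega
      obtain ⟨P, c, a⟩ := impl_kQuery (N := N) (X := X) hN hK hc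
      exact ⟨P, fun _ => ⟨c, a⟩⟩
    · exact ⟨[], fun h' => absurd h' h⟩
  choose PC hPC using hQ
  refine ⟨reduction A Pstart Ppk Pkey Pch Pct Pg PC, ?_, ?_,
    bhGame_reduction a1 a2 a3 a4 a5 a6 fun Q hQ => (hPC Q hQ).2⟩
  · simp [BHAdversary.queries, AAdversary.queries, reduction, length_chunks]
  · have up : ∀ {n c : ℕ}, n ≤ X ^ c → c ≤ 50 → n ≤ X ^ 50 := fun h hc =>
      h.trans (Nat.pow_le_pow_right (by omega) hc)
    have d1 := up c1 (by norm_num)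
    have d2 := up c2 (by norm_num)
    have d3 := up c3 (by norm_num)
    have d4 := up c4 (by norm_num)
    have d5 := up c5 (by norm_num)
    have d6 := up c6 (by norm_num)
    have s1 := cost_chunks_le d2 d3 A.pre fun Q hQ => (hPC Q (Or.inl hQ)).1
    have s2 := cost_chunks_le d5 d3 A.post fun Q hQ => (hPC Q (Or.inr hQ)).1
    have l1 := cost_lastD_le d2 d3 A.pre
    have l2 := cost_lastD_le d5 d3 A.post
    have hq : A.queries ≤ X := by omega
    have hq' : A.queries = A.pre.length + A.post.length := rfl
    have e : (reduction A Pstart Ppk Pkey Pch Pct Pg PC).size ≤ X ^ 50 * (3 * X + 5) := by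
      simp only [BHAdversary.size, BHAdversary.queries, reduction, length_chunks, Prog.cost_append]
      have h1 : 1 ≤ X ^ 50 := Nat.one_le_pow _ _ (by omega)
      have h2 : (A.pre.length + A.post.length) * (2 * X ^ 50) + (A.pre.length + A.post.length) ≤
          X ^ 50 * (3 * X) := by
        rw [← hq']
        nth_rw 2 [← mul_one A.queries]
        calc A.queries * (2 * X ^ 50) + A.queries * 1
            ≤ X * (2 * X ^ 50) + X * X ^ 50 := by gcongr
          _ = X ^ 50 * (3 * X) := by ring
      rw [add_mul] at h2
      rw [mul_add]
      omega
    have h3 : X ≤ Y ^ 3 := by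
      have : 2 ≤ Y := by omega
      calc X ≤ Y * 4 := by omega
        _ ≤ Y * Y ^ 2 := by gcongr; nlinarith
        _ = Y ^ 3 := by ring
    have h4 : 3 * X + 5 ≤ X ^ 2 := by
      have : 6 ≤ X := by omega
      nlinarith
    calc _ ≤ X ^ 50 * (3 * X + 5) := e
      _ ≤ X ^ 50 * X ^ 2 := by gcongr
      _ = X ^ 52 := by ring
      _ ≤ (Y ^ 3) ^ 52 := by gcongr
      _ = Y ^ 156 := by ring

theorem ev_unif_eq_or (x : Γ.GT) (a b : ℝ) (f : Γ.GT → ℝ≥0∞) (hf : ∀ T, f T ≤ 1)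
    (h1 : (f x).toReal = a) (h2 : ∀ T, T ≠ x → (f T).toReal = b) :
    (ev (unif Γ.GT) f).toReal = (a + (Γ.p - 1) * b) / Γ.p := by
  rw [ev_unif, Γ.cardT, ENNReal.toReal_div, ENNReal.toReal_natCast, ENNReal.toReal_sum
    fun T _ => ne_top_of_le_ne_top ENNReal.one_ne_top (hf T),
    ← Finset.add_sum_erase _ _ (Finset.mem_univ x), h1,
    Finset.sum_congr rfl fun T hT => h2 T (Finset.ne_of_mem_erase hT), Finset.sum_const,
    Finset.card_erase_of_mem (Finset.mem_univ x), Finset.card_univ, Γ.cardT, nsmul_eq_mul,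
    Nat.cast_sub Γ.prime.out.one_le, Nat.cast_one]

theorem toReal_failBound (K : ℕ) : (failBound Γ K).toReal = 1 / (K + 1) + 1 / Γ.p := by
  rw [failBound, ENNReal.toReal_add (by simp) (by simp [Γ.prime.out.ne_zero])]
  simp [ENNReal.toReal_add]

/-- Let P be the probability to answer "real" in the real game. In the random game T = 1 occurs with
probability 1/p and again yields P, while every other T yields 1/2. The difference is (1 - 1/p)(P -
1/2), and P is close to the success probability of the original adversary. -/
theorem bhAdv_close {B : BHAdversary Γ} {A : AAdversary Γ} {K : ℕ}
    (h : ∀ real : Bool, bhGame N real B =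
      (rewindGame N false K A (if real then PMF.pure 1 else unif Γ.GT)).bind mix) :
    |bhAdv N B - (1 - 1 / (Γ.p : ℝ)) * aAdv N A| ≤
      (A.queries / 2 : ℝ) * (1 / (K + 1) + 1 / (Γ.p : ℝ)) := by
  have hp1 : (1 : ℝ) ≤ Γ.p := by exact_mod_cast Γ.prime.out.one_le
  have hp0 : (Γ.p : ℝ) ≠ 0 := by positivity
  set P := (((rewindGame N false K A (PMF.pure 1)).bind mix) true).toReal with hP
  have hr : (bhGame N true B true).toReal = P := by rw [h true]; rfl
  have hn : (bhGame N false B true).toReal = (P + (Γ.p - 1) * (1 / 2)) / Γ.p := by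
    rw [h false]
    simp only [Bool.false_eq_true, if_false]
    rw [rewindGame_eq_bind, PMF.bind_bind, ← ev_indicator_true, ev_bind]
    refine ev_unif_eq_or 1 _ _ _ (fun T => ev_le_one _ fun b => by split_ifs <;> simp) ?_ ?_
    · rw [ev_indicator_true]
    · intro T hT
      rw [ev_indicator_true, rewindGame_bind_mix K A hT, one_half_unifBool]
      simp
  have hb : bhAdv N B = (1 - 1 / (Γ.p : ℝ)) * |P - 1 / 2| := by
    have h0 : 0 ≤ 1 - 1 / (Γ.p : ℝ) := by
      rw [sub_nonneg, div_le_one (by linarith)]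
      exact hp1
    rw [bhAdv, hr, hn, ← abs_of_nonneg h0, ← abs_mul]
    congr 1
    field_simp
    ring
  have hc := rewindGame_mix_close (N := N) K A
  rw [ENNReal.toReal_mul, toReal_failBound, ENNReal.toReal_natCast] at hc
  rw [hb, aAdv, ← mul_sub, abs_mul]
  have h1 : |1 - 1 / (Γ.p : ℝ)| ≤ 1 := by
    rw [abs_le]
    have : 1 / (Γ.p : ℝ) ≤ 1 := by rw [div_le_one (by linarith)]; exact hp1
    have : 0 ≤ 1 / (Γ.p : ℝ) := by positivity
    constructor <;> linarith
  have h2 : |(|P - 1 / 2| - |(aGame N A true).toReal - 1 / 2|)| ≤ |P - (aGame N A true).toReal| := by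
    have := abs_abs_sub_abs_le_abs_sub (P - 1 / 2) ((aGame N A true).toReal - 1 / 2)
    simpa using this
  calc _ ≤ 1 * |P - (aGame N A true).toReal| :=
        mul_le_mul h1 h2 (abs_nonneg _) zero_le_one
    _ ≤ _ := by rw [one_mul]; linarith

end Quantitative

end AIBBE

end

noncomputable section

namespace AIBBE

open Classical
open scoped ENNReal

variable {Γ : BilinearGroup} {N : ℕ}

/-! ### The distinguisher for the decision bilinear Diffie-Hellman exponent problem -/

theorem ImplN.runList {ι κ : Type} {Λ : Layout ι} {n : ℕ} {step : κ → VM Γ ι → PMF (VM Γ ι)}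
    (qs : List κ) (h : ∀ q ∈ qs, ImplN Λ n (step q)) :
    ImplN Λ (qs.length * n) (runList step qs) := by
  induction qs with
  | nil => exact ImplN.skip.mono (by simp)
  | cons q qs ih =>
    have := (h q (by simp)).seq (ih fun q hq => h q (by simp [hq]))
    exact this.mono (by rw [List.length_cons, add_mul, one_mul]; omega)

theorem Impl.runList {ι κ : Type} {Λ : Layout ι} {X w a : ℕ} {step : κ → VM Γ ι → PMF (VM Γ ι)}
    {qs : List κ} (hq : qs.length ≤ X ^ w) (h : ∀ q ∈ qs, Impl Λ X a (step q)) :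
    Impl Λ X (w + a) (runList step qs) :=
  ImplN.mono (ImplN.runList qs h) <| by
    rw [pow_add]
    exact Nat.mul_le_mul_right _ hq

local notation "DVM" => VM Γ (Reg (2 * N + 2))

section Distinguisher

/-- The elements of the problem instance. -/
def inst (j : ℕ) (v : DVM) : Γ.G :=
  if h : j < 2 * N + 2 + 1 then v .g (.pad ⟨j, h⟩) else 1

/-- The other registers of the array are 0 initially, so this is the polynomial 1, the product over
no targets. -/
def rhoInit (v : DVM) : DVM := fun k x => match k, x with
  | .z, .aux 0 => (1 : Γ.Z)
  | k, x => v k x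

/-- The `i`-th announced identity is a target that has not been listed before. -/
def fresh (i : ℕ) (v : DVM) : Prop :=
  v .b (.adv i) = true ∧ ¬∃ j < i, v .b (.adv j) = true ∧ v .z (.adv j) = v .z (.adv i)

/-- Multiplication of a polynomial by a linear factor. -/
def rhoStep (i : ℕ) (v : DVM) : DVM := fun k x => match k, x with
  | .z, .aux 0 => if fresh i v then -(v .z (.adv i) * v .z (.aux 0)) else v .z (.aux 0)
  | .z, .aux (k + 1) => if k < N then
      if fresh i v then v .z (.aux k) - v .z (.adv i) * v .z (.aux (k + 1)) else v .z (.aux (k + 1))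
    else v .z (.aux (k + 1))
  | k, x => v k x

/-- The elements `h_k`. -/
def instH (k : ℕ) (v : DVM) : Γ.G := inst (k + 1) v * pw (inst 0 v) (v .z (.pk k))

/-- The product removes all h_k^(ρ_k) from the hash of the target set and leaves g^w. -/
def instZ (v : DVM) : Γ.G :=
  pw (inst 0 v) (v .z (.loc .w)) *
    ∏ k ∈ Finset.range (N + 1), pw (instH k v) (-v .z (.aux k))

/-- The masks u_k, v and w of h_k, g2 and z are in `pk k`, `t0` and `w`. -/
def instPk (v : DVM) : List Γ.G :=
  [inst 0 v, inst 1 v, inst (N + 1) v * pw (inst 0 v) (v .z (.loc .t0)), instZ v] ++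
    List.ofFn fun k : Fin (N + 1) => instH k v

def instDeliver (v : DVM) : DVM := fun k x => match k, x with
  | .g, .adv i => (instPk v).getD i (v .g (.adv i))
  | k, x => v k x

def dStart (P : Prog Γ) (v : DVM) : PMF DVM :=
  (runAdv P v).bind fun v =>
  (PMF.pure (rhoInit v)).bind fun v =>
  (iter (fun i v => PMF.pure (rhoStep i v)) N v).bind fun v =>
  (iter (fun i (v : DVM) => (unif Γ.Z).map fun a => v.set .z (.pk i) a) (N + 1) v).bind fun v =>
  ((unif Γ.Z).map fun a => v.set .z (.loc .t0) a).bind fun v =>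
  ((unif Γ.Z).map fun a => v.set .z (.loc .w) a).bind fun v => PMF.pure (instDeliver v)

/-- The value at the requested identity of the polynomial that vanishes on the targets. -/
def evalP (v : DVM) : Γ.Z :=
  ∑ k ∈ Finset.range (N + 1), v .z (.aux k) * v .z (.adv 0) ^ k

/-- This is g^E for the shift E of the key randomness. It needs only the powers up to α^(N+1), all
of which are given. -/
def instE (v : DVM) : Γ.G :=
  ∏ j ∈ Finset.range (N + 2), pw (inst j v) ((evalP v)⁻¹ * v .z (.adv 0) ^ (N + 1 - j))

/-- The double product is the part of z^E with exponents α^(k+1+j). The terms with k + 1 + j = N + 2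
are left out: together they are -α^(N+2) and cancel against g2^α. Register N + 2 holds h, not a
power of g known to the program. -/
def instKey₀ (v : DVM) : Γ.G :=
  pw (inst 1 v) (v .z (.loc .t0)) * pw (instZ v) (v .z (.loc .rr)) *
    pw (instE v)
      (v .z (.loc .w) - ∑ k ∈ Finset.range (N + 1), v .z (.aux k) * v .z (.pk k)) *
    ∏ k ∈ Finset.range (N + 1), ∏ j ∈ Finset.range (N + 2),
      if j = N + 1 - k then 1 else
        pw (inst (k + 1 + j) v) (-((evalP v)⁻¹ * v .z (.aux k) * v .z (.adv 0) ^ (N + 1 - j)))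

/-- The exponent α^(i+1)(α - ID)E telescopes to P(ID)^(-1)(α^(i+N+3) - ID^(N+2) α^(i+1)), which
jumps over α^(N+2). -/
def instKey (i : ℕ) (v : DVM) : Γ.G :=
  pw (instH (i + 1) v * pw (instH i v) (-v .z (.adv 0))) (v .z (.loc .rr)) *
    pw (inst (i + N + 3) v) (evalP v)⁻¹ *
    pw (inst (i + 1) v) (-((evalP v)⁻¹ * v .z (.adv 0) ^ (N + 2))) *
    pw (instE v) (v .z (.pk (i + 1)) - v .z (.adv 0) * v .z (.pk i))

def instKeyList (v : DVM) : List Γ.G :=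
  [instKey₀ v, pw (inst 0 v) (v .z (.loc .rr)) * instE v] ++ List.ofFn fun i : Fin N => instKey i v

def instAnswer (v : DVM) : DVM := fun k x => match k, x with
  | .g, .adv i => if evalP v = 0 then v .g (.adv i) else (instKeyList v).getD i (v .g (.adv i))
  | .b, .adv 0 => decide (¬evalP v = 0)
  | k, x => v k x

def dQuery (P : Prog Γ) (v : DVM) : PMF DVM :=
  (runAdv P v).bind fun v =>
  ((unif Γ.Z).map fun a => v.set .z (.loc .rr) a).bind fun v => PMF.pure (instAnswer v)

/-- With h = g^s, the factor T stands for the part of e(g1,g2)^s that belongs to α^(N+1), the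
pairing supplies the part of the mask v, and H(S)^s = h^w. -/
def instCt (v : DVM) : DVM := fun k x => match k, x with
  | .t, .adv 0 => v .t (.adv 0) * v .t (.pad 0) *
      pw (Γ.e (inst 1 v) (inst (N + 2) v)) (v .z (.loc .t0))
  | .g, .adv 0 => inst (N + 2) v
  | .g, .adv 1 => pw (inst (N + 2) v) (v .z (.loc .w))
  | k, x => v k x

def dChoose (P : Prog Γ) (v : DVM) : PMF DVM :=
  (runAdv P v).bind fun v => PMF.pure (instCt v)

def instOut (v : DVM) : DVM := fun k x => match k, x with
  | .b, .pad 0 => v .b (.adv 0)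
  | k, x => v k x

def dGuess (P : Prog Γ) (v : DVM) : PMF DVM :=
  (runAdv P v).bind fun v => PMF.pure (instOut v)

def dAll (B : BHAdversary Γ) (v : DVM) : PMF DVM :=
  (dStart B.start v).bind fun v =>
  (runList dQuery B.pre v).bind fun v =>
  (dChoose B.choose v).bind fun v =>
  (runList dQuery B.post v).bind fun v => dGuess B.guess v

/-! ### Costs of the distinguisher -/

variable {X : ℕ} [hX : Fact (2 ≤ X)]

local notation "DLay" => layout (2 * N + 2)

theorem comp_inst (j : ℕ) : Comp DLay X 1 .g fun v : DVM => inst j v := by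
  unfold inst
  split_ifs with h
  · exact Comp.reg (Λ := DLay) .g (.pad ⟨j, h⟩)
  · exact (Comp.constG 1).mono (by norm_num)

theorem impl_rhoInit : Impl DLay X 4 fun v : DVM => PMF.pure (rhoInit v) := by
  refine (Impl.assign (c := 1) (w := 0) [(.z, .aux 0)] (by simp) rhoInit ?_ ?_).mono (by norm_num)
  · intro v k x hx
    cases k
    case z =>
      cases x
      case aux i =>
        cases i
        · simp at hx
        · rfl
      all_goals rfl
    all_goals cases x <;> rfl
  · intro k x hx
    simp only [List.mem_singleton, Prod.mk.injEq] at hx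
    obtain ⟨rfl, rfl⟩ := hx
    exact (Comp.constZ 1).mono (by norm_num)

theorem compP_fresh {i : ℕ} (hi : i ≤ X) : CompP DLay X 20 fun v : DVM => fresh i v := by
  have R : ∀ k (x : Reg (2 * N + 2)), Comp DLay X 1 k (fun v : DVM => v k x) := Comp.reg
  have B : ∀ x : Reg (2 * N + 2), CompP DLay X 1 (fun v : DVM => v .b x = true) := CompP.reg
  have h1 : CompP DLay X 14 fun v : DVM => ∃ j < i, v .b (.adv j) = true ∧
      v .z (.adv j) = v .z (.adv i) :=
    CompP.exists_lt (a := 7) hi fun j _ =>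
      (CompP.and (B (.adv j)) (CompP.eqZ (R .z (.adv j)) (R .z (.adv i)))).mono (by norm_num)
  exact (CompP.and (B (.adv i)) h1.not).mono (by norm_num)

theorem impl_rhoStep (hN : 2 * N + 6 ≤ X) {i : ℕ} (hi : i < N) :
    Impl DLay X 32 fun v : DVM => PMF.pure (rhoStep i v) := by
  have R : ∀ k (x : Reg (2 * N + 2)), Comp DLay X 1 k (fun v : DVM => v k x) := Comp.reg
  have hF : CompP DLay X 20 fun v : DVM => fresh i v := compP_fresh (by omega)
  refine (Impl.assign (c := 29) (w := 1) ((List.range (N + 1)).map fun k => (Kind.z, Reg.aux k))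
    (by simp; omega) (rhoStep i) ?_ ?_).mono (by norm_num)
  · intro v k x hx
    cases k
    case z =>
      cases x
      case aux k =>
        cases k
        · simp at hx
        · simp at hx
          exact if_neg (by omega)
      all_goals rfl
    all_goals cases x <;> rfl
  · intro k x hx
    cases k
    case z =>
      cases x
      case aux k =>
        cases k
        · exact (Comp.ite .z hF (Comp.negZ (Comp.mulZ (R .z (.adv i)) (R .z (.aux 0))))
            (R .z (.aux 0))).mono (by norm_num)
        · rename_i k
          have hk : k < N := by simpa using hx
          have e : (fun v : DVM => rhoStep i v .z (.aux (k + 1))) = fun v => if fresh i v then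
              v .z (.aux k) - v .z (.adv i) * v .z (.aux (k + 1)) else v .z (.aux (k + 1)) :=
            funext fun v => if_pos hk
          rw [e]
          exact (Comp.ite .z hF (Comp.subZ (R .z (.aux k)) (Comp.mulZ (R .z (.adv i))
            (R .z (.aux (k + 1))))) (R .z (.aux (k + 1)))).mono (by norm_num)
      all_goals simp at hx
    all_goals simp at hx

theorem comp_instH (k : ℕ) : Comp DLay X 5 .g fun v : DVM => instH k v := by
  have R : ∀ k (x : Reg (2 * N + 2)), Comp DLay X 1 k (fun v : DVM => v k x) := Comp.reg
  exact (Comp.mulG (comp_inst (k + 1)) (Comp.pwG (comp_inst 0) (R .z (.pk k)))).mono (by norm_num)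

theorem comp_instZ (hN : 2 * N + 6 ≤ X) : Comp DLay X 12 .g fun v : DVM => instZ v := by
  have R : ∀ k (x : Reg (2 * N + 2)), Comp DLay X 1 k (fun v : DVM => v k x) := Comp.reg
  exact (Comp.mulG (Comp.pwG (comp_inst 0) (R .z (.loc .w)))
    (Comp.prodG (r := N + 1) (by omega) fun k _ =>
      Comp.pwG (comp_instH k) (Comp.negZ (R .z (.aux k))))).mono (by norm_num)

theorem length_instPk (v : DVM) : (instPk v).length = N + 5 := by
  simp [instPk]

theorem comp_instPk (hN : 2 * N + 6 ≤ X) {k : Reg (2 * N + 2)} (i : ℕ) :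
    Comp DLay X 12 .g fun v : DVM => (instPk v).getD i (v .g k) := by
  have R : ∀ k (x : Reg (2 * N + 2)), Comp DLay X 1 k (fun v : DVM => v k x) := Comp.reg
  unfold instPk
  rcases i with _ | _ | _ | _ | i
  · exact (comp_inst 0).mono (by norm_num)
  · exact (comp_inst 1).mono (by norm_num)
  · exact (Comp.mulG (comp_inst (N + 1)) (Comp.pwG (comp_inst 0) (R .z (.loc .t0)))).mono
      (by norm_num)
  · exact comp_instZ hN
  · simp only [List.cons_append, List.nil_append, List.getD_cons_succ]
    by_cases hi : i < N + 1
    · simp only [List.getD_eq_getElem?_getD, List.getElem?_ofFn, hi, dif_pos, Option.getD_some]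
      exact (comp_instH i).mono (by norm_num)
    · simp only [List.getD_eq_getElem?_getD, List.getElem?_ofFn, hi, dif_neg, not_false_iff,
        Option.getD_none]
      exact (R .g k).mono (by norm_num)

theorem impl_instDeliver (hN : 2 * N + 6 ≤ X) :
    Impl DLay X 15 fun v : DVM => PMF.pure (instDeliver v) := by
  refine (Impl.assign (c := 12) (w := 1) ((List.range (N + 5)).map fun k => (Kind.g, Reg.adv k))
    (by simp; omega) instDeliver ?_ ?_).mono (by norm_num)
  · intro v k x hx
    cases k
    case g =>
      cases x
      case adv i =>
        simp at hx
        exact getD_of_length_le (by rw [length_instPk]; omega) _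
      all_goals rfl
    all_goals rfl
  · intro k x hx
    cases k
    case g =>
      cases x
      case adv i => exact comp_instPk hN i
      all_goals simp at hx
    all_goals simp at hx

theorem impl_dStart (hN : 2 * N + 6 ≤ X) {P : Prog Γ} (hP : P.cost ≤ X) :
    Impl DLay X 40 (dStart (N := N) P) := by
  have R : ∀ x, Impl DLay X 0 fun v : DVM => (unif Γ.Z).map fun a => v.set .z x a := Impl.rand
  have h1 := Impl.iter (w := 1) (r := N) (by rw [pow_one]; omega)
    fun i hi => impl_rhoStep (Γ := Γ) (N := N) hN hi
  have h2 := Impl.iter (w := 1) (r := N + 1) (by rw [pow_one]; omega) fun i _ => R (.pk i)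
  exact ((Impl.runAdv hP).seq (impl_rhoInit.seq (h1.seq (h2.seq ((R _).seq ((R _).seq
    (impl_instDeliver hN))))))).mono (by norm_num)

theorem comp_evalP (hN : 2 * N + 6 ≤ X) : Comp DLay X 9 .z fun v : DVM => evalP v := by
  have R : ∀ k (x : Reg (2 * N + 2)), Comp DLay X 1 k (fun v : DVM => v k x) := Comp.reg
  exact (Comp.sumZ (a := 6) (r := N + 1) (by omega) fun k hk =>
    (Comp.mulZ (R .z (.aux k)) (Comp.powZ (r := k) (by omega) (R .z (.adv 0)))).mono
      (by norm_num)).mono (by norm_num)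

theorem comp_instE (hN : 2 * N + 6 ≤ X) : Comp DLay X 18 .g fun v : DVM => instE v := by
  have R : ∀ k (x : Reg (2 * N + 2)), Comp DLay X 1 k (fun v : DVM => v k x) := Comp.reg
  exact Comp.prodG (a := 15) (r := N + 2) (by omega) fun j _ =>
    (Comp.pwG (comp_inst j) (Comp.mulZ (Comp.invZ (comp_evalP hN))
      (Comp.powZ (r := N + 1 - j) (by omega) (R .z (.adv 0))))).mono (by norm_num)

theorem comp_instKey₀ (hN : 2 * N + 6 ≤ X) : Comp DLay X 30 .g fun v : DVM => instKey₀ v := by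
  have R : ∀ k (x : Reg (2 * N + 2)), Comp DLay X 1 k (fun v : DVM => v k x) := Comp.reg
  have h1 : Comp DLay X 25 .g fun v : DVM => ∏ k ∈ Finset.range (N + 1), ∏ j ∈ Finset.range (N + 2),
      if j = N + 1 - k then 1 else
        pw (inst (k + 1 + j) v) (-((evalP v)⁻¹ * v .z (.aux k) * v .z (.adv 0) ^ (N + 1 - j))) := by
    refine (Comp.prodG (a := 22) (r := N + 1) (by omega) fun k _ =>
      (Comp.prodG (a := 19) (r := N + 2) (by omega) fun j _ => ?_).mono (by norm_num)).mono
      (by norm_num)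
    split_ifs
    · exact (Comp.constG 1).mono (by norm_num)
    · exact (Comp.pwG (comp_inst (k + 1 + j)) (Comp.negZ (Comp.mulZ (Comp.mulZ
        (Comp.invZ (comp_evalP hN)) (R .z (.aux k)))
        (Comp.powZ (r := N + 1 - j) (by omega) (R .z (.adv 0)))))).mono (by norm_num)
  have h2 : Comp DLay X 6 .z fun v : DVM =>
      ∑ k ∈ Finset.range (N + 1), v .z (.aux k) * v .z (.pk k) :=
    Comp.sumZ (a := 3) (r := N + 1) (by omega) fun k _ =>
      (Comp.mulZ (R .z (.aux k)) (R .z (.pk k))).mono (by norm_num)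
  exact (Comp.mulG (Comp.mulG (Comp.mulG (Comp.pwG (comp_inst 1) (R .z (.loc .t0)))
    (Comp.pwG (comp_instZ hN) (R .z (.loc .rr))))
    (Comp.pwG (comp_instE hN) (Comp.subZ (R .z (.loc .w)) h2))) h1).mono (by norm_num)

theorem comp_instKey (hN : 2 * N + 6 ≤ X) (i : ℕ) :
    Comp DLay X 30 .g fun v : DVM => instKey i v := by
  have R : ∀ k (x : Reg (2 * N + 2)), Comp DLay X 1 k (fun v : DVM => v k x) := Comp.reg
  have hκ := Comp.invZ (comp_evalP (Γ := Γ) hN)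
  exact (Comp.mulG (Comp.mulG (Comp.mulG
    (Comp.pwG (Comp.mulG (comp_instH (i + 1)) (Comp.pwG (comp_instH i) (Comp.negZ (R .z (.adv 0)))))
      (R .z (.loc .rr)))
    (Comp.pwG (comp_inst (i + N + 3)) hκ))
    (Comp.pwG (comp_inst (i + 1)) (Comp.negZ (Comp.mulZ hκ
      (Comp.powZ (r := N + 2) (by omega) (R .z (.adv 0)))))))
    (Comp.pwG (comp_instE hN) (Comp.subZ (R .z (.pk (i + 1)))
      (Comp.mulZ (R .z (.adv 0)) (R .z (.pk i)))))).mono (by norm_num)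

theorem length_instKeyList (v : DVM) : (instKeyList v).length = N + 2 := by
  simp [instKeyList]

theorem comp_instKeyList (hN : 2 * N + 6 ≤ X) {k : Reg (2 * N + 2)} (i : ℕ) :
    Comp DLay X 30 .g fun v : DVM => (instKeyList v).getD i (v .g k) := by
  have R : ∀ k (x : Reg (2 * N + 2)), Comp DLay X 1 k (fun v : DVM => v k x) := Comp.reg
  unfold instKeyList
  rcases i with _ | _ | i
  · exact comp_instKey₀ hN
  · exact (Comp.mulG (Comp.pwG (comp_inst 0) (R .z (.loc .rr))) (comp_instE hN)).mono (by norm_num)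
  · simp only [List.cons_append, List.nil_append, List.getD_cons_succ]
    by_cases hi : i < N
    · simp only [List.getD_eq_getElem?_getD, List.getElem?_ofFn, hi, dif_pos, Option.getD_some]
      exact comp_instKey hN i
    · simp only [List.getD_eq_getElem?_getD, List.getElem?_ofFn, hi, dif_neg, not_false_iff,
        Option.getD_none]
      exact (R .g k).mono (by norm_num)

theorem impl_instAnswer (hN : 2 * N + 6 ≤ X) :
    Impl DLay X 40 fun v : DVM => PMF.pure (instAnswer v) := by
  have R : ∀ k (x : Reg (2 * N + 2)), Comp DLay X 1 k (fun v : DVM => v k x) := Comp.reg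
  have hP : CompP DLay X 11 fun v : DVM => evalP v = 0 :=
    (CompP.eqZ (comp_evalP hN) (Comp.constZ 0)).mono (by norm_num)
  refine (Impl.assign (c := 36) (w := 1) ((List.range (N + 2)).map (fun k => (Kind.g, Reg.adv k)) ++
    [(.b, .adv 0)]) (by simp; omega) instAnswer ?_ ?_).mono (by norm_num)
  · intro v k x hx
    cases k
    case g =>
      cases x
      case adv i =>
        simp at hx
        have : (instKeyList v).getD i (v .g (.adv i)) = v .g (.adv i) :=
          getD_of_length_le (by rw [length_instKeyList]; omega) _
        simp only [instAnswer, this, ite_self]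
      all_goals rfl
    case b =>
      cases x
      case adv i =>
        cases i
        · simp at hx
        · rfl
      all_goals rfl
    all_goals rfl
  · intro k x hx
    cases k
    case g =>
      cases x
      case adv i => exact (Comp.ite .g hP (R .g (.adv i)) (comp_instKeyList hN i)).mono (by norm_num)
      all_goals simp at hx
    case b =>
      cases x
      case adv i =>
        obtain rfl : i = 0 := by simpa using hx
        exact (Comp.ofP hP.not).mono (by norm_num)
      all_goals simp at hx
    all_goals simp at hx

theorem impl_dQuery (hN : 2 * N + 6 ≤ X) {P : Prog Γ} (hP : P.cost ≤ X) :
    Impl DLay X 45 (dQuery (N := N) P) := by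
  have R : ∀ x, Impl DLay X 0 fun v : DVM => (unif Γ.Z).map fun a => v.set .z x a := Impl.rand
  exact ((Impl.runAdv hP).seq ((R _).seq (impl_instAnswer hN))).mono (by norm_num)

theorem impl_dChoose {P : Prog Γ} (hP : P.cost ≤ X) : Impl DLay X 20 (dChoose (N := N) P) := by
  have R : ∀ k (x : Reg (2 * N + 2)), Comp DLay X 1 k (fun v : DVM => v k x) := Comp.reg
  have h1 : Impl DLay X 12 fun v : DVM => PMF.pure (instCt v) := by
    refine (Impl.assign (c := 7) (w := 2) [(.t, .adv 0), (.g, .adv 0), (.g, .adv 1)] ?_ instCt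
      ?_ ?_).mono (by norm_num)
    · have := four_mul_pow_le X 0
      simp only [pow_zero, zero_add] at this
      simp only [List.length_cons, List.length_nil]
      omega
    · intro v k x hx
      cases x
      case adv i =>
        cases k
        case b => rfl
        case z => rfl
        case t =>
          cases i
          · simp at hx
          · rfl
        case g =>
          rcases i with _ | _ | i
          · simp at hx
          · simp at hx
          · rfl
      all_goals cases k <;> rfl
    · intro k x hx
      simp only [List.mem_cons, Prod.mk.injEq, List.not_mem_nil, or_false] at hx
      rcases hx with ⟨rfl, rfl⟩ | ⟨rfl, rfl⟩ | ⟨rfl, rfl⟩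
      · exact (Comp.mulT (Comp.mulT (R .t (.adv 0)) (R .t (.pad 0)))
          (Comp.pwT (Comp.pair (comp_inst 1) (comp_inst (N + 2))) (R .z (.loc .t0)))).mono
          (by norm_num)
      · exact (comp_inst (N + 2)).mono (by norm_num)
      · exact (Comp.pwG (comp_inst (N + 2)) (R .z (.loc .w))).mono (by norm_num)
  exact ((Impl.runAdv hP).seq h1).mono (by norm_num)

theorem impl_dGuess {P : Prog Γ} (hP : P.cost ≤ X) : Impl DLay X 10 (dGuess (N := N) P) := by
  have h1 : Impl DLay X 4 fun v : DVM => PMF.pure (instOut v) := by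
    refine (Impl.assign (c := 1) (w := 0) [(.b, .pad 0)] (by simp) instOut ?_ ?_).mono (by norm_num)
    · intro v k x hx
      cases x
      case pad i =>
        cases k
        case b =>
          obtain ⟨i, hi⟩ := i
          cases i
          · exact absurd hx (by simp)
          · rfl
        all_goals rfl
      all_goals cases k <;> rfl
    · intro k x hx
      simp only [List.mem_singleton, Prod.mk.injEq] at hx
      obtain ⟨rfl, rfl⟩ := hx
      exact Comp.reg (Λ := DLay) .b (.adv 0)
  exact ((Impl.runAdv hP).seq h1).mono (by norm_num)

theorem exists_distinguisher (N : ℕ) (B : BHAdversary Γ) :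
    ∃ D : Prog Γ, D.cost ≤ (B.size + 2 * N + 6) ^ 60 ∧
      ∀ m, (D.run m).map (layout (2 * N + 2)).view = dAll B ((layout (2 * N + 2)).view m) := by
  obtain ⟨X, hXdef⟩ : ∃ X, X = B.size + 2 * N + 6 := ⟨_, rfl⟩
  rw [← hXdef]
  have hX : Fact (2 ≤ X) := ⟨by omega⟩
  have hN : 2 * N + 6 ≤ X := by omega
  have hsz : B.size = B.start.cost + (B.pre.map Prog.cost).sum + B.choose.cost +
    (B.post.map Prog.cost).sum + B.guess.cost + (B.pre.length + B.post.length) := rfl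
  have h1 := Impl.runList (w := 1) (qs := B.pre) (by rw [pow_one]; omega) fun Q hQ =>
    impl_dQuery (X := X) hN (P := Q) (by have := le_sum_map Prog.cost hQ; omega)
  have h2 := Impl.runList (w := 1) (qs := B.post) (by rw [pow_one]; omega) fun Q hQ =>
    impl_dQuery (X := X) hN (P := Q) (by have := le_sum_map Prog.cost hQ; omega)
  exact ((impl_dStart (X := X) hN (P := B.start) (by omega)).seq (h1.seq
    ((impl_dChoose (X := X) (P := B.choose) (by omega)).seq (h2.seq
      (impl_dGuess (X := X) (P := B.guess) (by omega)))))).mono (by norm_num)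

end Distinguisher

end AIBBE

end

noncomputable section

namespace AIBBE

open Classical
open scoped ENNReal

variable {Γ : BilinearGroup} {N : ℕ}

local notation "DVM" => VM Γ (Reg (2 * N + 2))

/-! ### Coefficients of the polynomial that vanishes on the targets -/

section Rho

theorem rho_empty (k : ℕ) : rho (∅ : Finset Γ.Z) k = if k = 0 then 1 else 0 := by
  simp [rho, Polynomial.coeff_one]

theorem rho_insert_zero {S : Finset Γ.Z} {x : Γ.Z} (hx : x ∉ S) :
    rho (insert x S) 0 = -(x * rho S 0) := by
  rw [rho, rho, Finset.prod_insert hx, sub_mul, Polynomial.coeff_sub, Polynomial.coeff_C_mul]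
  simp [Polynomial.mul_coeff_zero]

theorem rho_insert_succ {S : Finset Γ.Z} {x : Γ.Z} (hx : x ∉ S) (k : ℕ) :
    rho (insert x S) (k + 1) = rho S k - x * rho S (k + 1) := by
  rw [rho, rho, rho, Finset.prod_insert hx, sub_mul, Polynomial.coeff_sub, Polynomial.coeff_C_mul,
    Polynomial.coeff_X_mul]

theorem sum_rho {S : Finset Γ.Z} (hS : S.card ≤ N) (x : Γ.Z) :
    ∑ k ∈ Finset.range (N + 1), rho S k * x ^ k = ∏ y ∈ S, (x - y) := by
  have h : (∏ y ∈ S, (Polynomial.X - Polynomial.C y)).natDegree < N + 1 := by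
    rw [Polynomial.natDegree_prod_of_monic _ _ fun y _ => Polynomial.monic_X_sub_C y]
    simp
    omega
  have := Polynomial.eval_eq_sum_range' h x
  rw [Polynomial.eval_prod] at this
  simp only [Polynomial.eval_sub, Polynomial.eval_X, Polynomial.eval_C] at this
  exact this.symm

theorem targets_succ (i : ℕ) (m : Mem Γ) :
    targets (i + 1) m = if m.b i = true then insert (m.z i) (targets i m) else targets i m := by
  rw [targets, Finset.range_add_one, Finset.filter_insert]
  split_ifs
  · rw [Finset.image_insert]; rfl
  · rfl

theorem mem_targets {i : ℕ} {m : Mem Γ} {x : Γ.Z} :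
    x ∈ targets i m ↔ ∃ j < i, m.b j = true ∧ m.z j = x := by
  simp [targets, and_assoc]

theorem card_targets_le (m : Mem Γ) : (targets N m).card ≤ N := by
  refine Finset.card_image_le.trans ((Finset.card_filter_le _ _).trans ?_)
  simp

/-- After i steps the array describes the first i announcements. An identity that is repeated is not
`fresh` and contributes no second factor, in accordance with the set of targets. -/
theorem iter_rhoStep {v : DVM} {m : Mem Γ} (ha : v.advMem = m)
    (h0 : ∀ k, v .z (.aux k) = rho ∅ k) {i : ℕ} (hi : i ≤ N) :
    ∃ v' : DVM, iter (fun i v => PMF.pure (rhoStep i v)) i v = PMF.pure v' ∧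
      (∀ k x, (∀ j, (k, x) ≠ (Kind.z, Reg.aux j)) → v' k x = v k x) ∧
      ∀ k ≤ N, v' .z (.aux k) = rho (targets i m) k := by
  have hm : ∀ k i, v k (.adv i) = m.get k i := fun k i => by rw [← ha, advMem_get]
  induction i with
  | zero => exact ⟨v, rfl, fun _ _ _ => rfl, fun k _ => h0 k⟩
  | succ i ih =>
    obtain ⟨v', h1, h2, h3⟩ := ih (by omega)
    have hz : ∀ j, v' .z (.adv j) = m.z j := fun j => (h2 _ _ (by simp)).trans (hm .z j)
    have hb : ∀ j, v' .b (.adv j) = m.b j := fun j => (h2 _ _ (by simp)).trans (hm .b j)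
    have hf : fresh i v' ↔ m.b i = true ∧ m.z i ∉ targets i m := by
      simp only [fresh, hz, hb, mem_targets]
    refine ⟨rhoStep i v', by rw [iter, h1, PMF.pure_bind], fun k x hx => ?_, fun k hk => ?_⟩
    · rw [← h2 k x hx]
      cases k
      case z =>
        cases x
        case aux j => exact absurd rfl (hx j)
        all_goals rfl
      all_goals cases x <;> rfl
    · rw [targets_succ]
      by_cases hfr : fresh i v'
      · obtain ⟨hbi, hnot⟩ := hf.1 hfr
        rw [if_pos hbi]
        cases k with
        | zero =>
          have : rhoStep i v' .z (.aux 0) = -(v' .z (.adv i) * v' .z (.aux 0)) := if_pos hfr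
          rw [this, rho_insert_zero hnot, hz, h3 0 hk]
        | succ k =>
          have : rhoStep i v' .z (.aux (k + 1)) =
              v' .z (.aux k) - v' .z (.adv i) * v' .z (.aux (k + 1)) :=
            (if_pos (by omega : k < N)).trans (if_pos hfr)
          rw [this, rho_insert_succ hnot, hz, h3 k (by omega), h3 (k + 1) hk]
      · have e : (if m.b i = true then insert (m.z i) (targets i m) else targets i m) =
            targets i m := by
          split_ifs with hbi
          · exact Finset.insert_eq_of_mem (by_contra fun hnot => hfr (hf.2 ⟨hbi, hnot⟩))
          · rfl
        rw [e, ← h3 k hk]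
        cases k with
        | zero => exact if_neg hfr
        | succ k => exact (if_pos (by omega : k < N)).trans (if_neg hfr)

end Rho

/-! ### Random exponents -/

section Sampling

/-- A translate of a uniform exponent is uniform. It exceeds the uniform distribution on nonzero
exponents only at 0, where its mass is 1/p. -/
theorem Rel.unif_add_unitZ (E : Γ.Z) :
    Rel (Γ.p : ℝ≥0∞)⁻¹ (fun a r => r = a + E) (unif Γ.Z) (unitZ Γ) := by
  intro f g hf hg hfg
  have h1 : ev (unif Γ.Z) f ≤ ev (unif Γ.Z) g := by
    rw [ev_unif, ev_unif]
    gcongr 1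
    rw [← Equiv.sum_comp (Equiv.addRight E) g]
    exact Finset.sum_le_sum fun a _ => hfg _ _ rfl
  refine h1.trans ?_
  have h2 : ∀ r, unif Γ.Z r * g r ≤ unitZ Γ r * g r + if r = 0 then (Γ.p : ℝ≥0∞)⁻¹ else 0 := by
    intro r
    rw [PMF.uniformOfFintype_apply, card_Z]
    by_cases hr : r = 0
    · rw [if_pos hr]
      exact le_add_left (mul_le_of_le_one_right' (hg r))
    · rw [if_neg hr, add_zero]
      gcongr
      rw [unitZ, PMF.map_apply]
      refine le_trans ?_ (ENNReal.le_tsum (Units.mk0 r hr))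
      rw [if_pos (Units.val_mk0 hr).symm, PMF.uniformOfFintype_apply, ENNReal.inv_le_inv, Nat.cast_le]
      exact (Fintype.card_le_of_injective _ Units.val_injective).trans card_Z.le
  calc ev (unif Γ.Z) g ≤ ∑' r, (unitZ Γ r * g r + if r = 0 then (Γ.p : ℝ≥0∞)⁻¹ else 0) :=
        ENNReal.tsum_le_tsum h2
    _ = _ := by rw [ENNReal.tsum_add, tsum_ite_eq]; rfl

theorem unif_fin_succ (r : ℕ) : unif (Fin (r + 1) → Γ.Z) =
    (unif (Fin r → Γ.Z)).bind fun u => (unif Γ.Z).map fun a => Fin.snoc (α := fun _ => Γ.Z) u a := by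
  refine pmf_ext_ev (fun f _ => le_of_eq ?_) (fun f _ => le_of_eq ?_)
  all_goals
    rw [ev_bind]
    simp only [ev_map, ev_unif]
    have e : ∑ u : Fin (r + 1) → Γ.Z, f u = ∑ u : Fin r → Γ.Z, ∑ a : Γ.Z,
        f (Fin.snoc (α := fun _ => Γ.Z) u a) := by
      rw [← Equiv.sum_comp (Fin.snocEquiv fun _ => Γ.Z), Fintype.sum_prod_type, Finset.sum_comm]
      rfl
    have c : (Fintype.card (Fin (r + 1) → Γ.Z) : ℝ≥0∞) =
        Fintype.card Γ.Z * Fintype.card (Fin r → Γ.Z) := by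
      simp [pow_succ, mul_comm]
    rw [e, c]
    simp only [div_eq_mul_inv, ← Finset.sum_mul]
    rw [ENNReal.mul_inv (by simp) (by simp), mul_assoc]

theorem rel_iter_sample (v : DVM) (r : ℕ) :
    Rel 0 (fun (v' : DVM) (u : Fin r → Γ.Z) => (∀ k : Fin r, v' .z (.pk k) = u k) ∧
        ∀ k x, (∀ j, (k, x) ≠ (Kind.z, Reg.pk j)) → v' k x = v k x)
      (iter (fun i (v : DVM) => (unif Γ.Z).map fun a => v.set .z (.pk i) a) r v)
      (unif (Fin r → Γ.Z)) := by
  induction r with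
  | zero =>
    have : unif (Fin 0 → Γ.Z) = (unif (Fin 0 → Γ.Z)).bind PMF.pure := (PMF.bind_pure _).symm
    rw [iter, this, ← PMF.bind_const (unif (Fin 0 → Γ.Z)) (PMF.pure v)]
    exact Rel.bind_same _ fun u => Rel.pure ⟨fun k => k.elim0, fun _ _ _ => rfl⟩
  | succ r ih =>
    rw [iter, unif_fin_succ]
    refine ih.bind_exact fun v' u h => ?_
    refine Rel.map (R := fun a b => a = b) (Rel.refl _ fun _ => rfl) ?_
    rintro a _ rfl
    refine ⟨fun k => ?_, fun k x hx => ?_⟩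
    · refine Fin.lastCases ?_ (fun k => ?_) k
      · simp
      · rw [VM.set_ne_reg]
        · simpa using h.1 k
        · intro h
          injection h with h
          have := k.isLt
          simp at h
          omega
    · rw [VM.set_of_ne _ _ (hx r), h.2 k x hx]

end Sampling

end AIBBE

end

noncomputable section

namespace AIBBE

open Classical
open scoped ENNReal

variable {Γ : BilinearGroup} {N : ℕ}

local notation "DVM" => VM Γ (Reg (2 * N + 2))

/-! ### Keys without the master secret -/

section Exponents

variable {F : Type*} [CommRing F]

theorem geom_exponent (α ID κ : F) (n : ℕ) :
    (α - ID) * ∑ j ∈ Finset.range (n + 2), α ^ j * (κ * ID ^ (n + 1 - j)) =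
      κ * (α ^ (n + 2) - ID ^ (n + 2)) := by
  have h := (Commute.all α ID).mul_geom_sum₂ (n + 2)
  rw [← h, mul_left_comm, Finset.mul_sum (a := κ)]
  congr 1
  exact Finset.sum_congr rfl fun j _ => by
    rw [show n + 2 - 1 - j = n + 1 - j by omega]
    ring

/-- The heart of the simulation: the coefficient of α^(n+2) in the part of z^E that comes from the
α-powers is -κ ∑ ρ_k ID^k = -1, which offsets the α^(n+2) in g2^α. Both therefore drop out of the
left-hand side, the exponent that can be computed. -/
theorem key_exponent (α ID κ vv ww r : F) (ρ U : ℕ → F) (n : ℕ)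
    (h : κ * ∑ k ∈ Finset.range (n + 1), ρ k * ID ^ k = 1) :
    α * vv + (ww - ∑ k ∈ Finset.range (n + 1), ρ k * (α ^ (k + 1) + U k)) * r +
      (∑ j ∈ Finset.range (n + 2), α ^ j * (κ * ID ^ (n + 1 - j))) *
        (ww - ∑ k ∈ Finset.range (n + 1), ρ k * U k) +
      ∑ k ∈ Finset.range (n + 1), ∑ j ∈ Finset.range (n + 2),
        (if j = n + 1 - k then 0 else α ^ (k + 1 + j) * -(κ * ρ k * ID ^ (n + 1 - j))) =
    (α ^ (n + 1) + vv) * α + (ww - ∑ k ∈ Finset.range (n + 1), ρ k * (α ^ (k + 1) + U k)) *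
      (r + ∑ j ∈ Finset.range (n + 2), α ^ j * (κ * ID ^ (n + 1 - j))) := by
  have h1 : ∀ k ∈ Finset.range (n + 1), ∑ j ∈ Finset.range (n + 2),
      (if j = n + 1 - k then 0 else α ^ (k + 1 + j) * -(κ * ρ k * ID ^ (n + 1 - j))) =
      α ^ (n + 2) * (κ * (ρ k * ID ^ k)) -
        ρ k * α ^ (k + 1) * ∑ j ∈ Finset.range (n + 2), α ^ j * (κ * ID ^ (n + 1 - j)) := by
    intro k hk
    have hk : k < n + 1 := Finset.mem_range.1 hk
    -- The omitted term, for which k + 1 + j = n + 2, is added and subtracted; this completes the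
    -- sum to a multiple of E.
    have h2 : ∀ j ∈ Finset.range (n + 2),
        (if j = n + 1 - k then 0 else α ^ (k + 1 + j) * -(κ * ρ k * ID ^ (n + 1 - j))) =
        (if j = n + 1 - k then α ^ (n + 2) * (κ * (ρ k * ID ^ k)) else 0) -
          ρ k * α ^ (k + 1) * (α ^ j * (κ * ID ^ (n + 1 - j))) := by
      intro j hj
      split_ifs with hjk
      · subst hjk
        rw [show n + 1 - (n + 1 - k) = k by omega,
          show n + 2 = k + 1 + (n + 1 - k) by omega]
        ring
      · ring
    rw [Finset.sum_congr rfl h2, Finset.sum_sub_distrib, Finset.sum_ite_eq',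
      if_pos (Finset.mem_range.2 (by omega)), Finset.mul_sum]
  rw [Finset.sum_congr rfl h1, Finset.sum_sub_distrib, ← Finset.mul_sum, ← Finset.mul_sum, h,
    ← Finset.sum_mul]
  simp only [mul_add, Finset.sum_add_distrib]
  ring

end Exponents

/-- The setup that the distinguisher simulates. -/
def simSetup (g : Γ.G) (α : Γ.Z) (S : Finset Γ.Z) (u : Fin (N + 1) → Γ.Z) (vv ww : Γ.Z) :
    Setup Γ N where
  g := g
  g2 := pw g (α ^ (N + 1) + vv)
  z := pw g (ww - ∑ k : Fin (N + 1), rho S k * (α ^ (k + 1 : ℕ) + u k))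
  a k := α ^ (k + 1 : ℕ) + u k
  α := α

section Keys

variable {g : Γ.G} {α x : Γ.Z} {T : Γ.GT} {S : Finset Γ.Z} {u : Fin (N + 1) → Γ.Z} {vv ww : Γ.Z}

/-- The registers that hold a problem instance. -/
structure IsInst (g : Γ.G) (α x : Γ.Z) (T : Γ.GT) (v : DVM) : Prop where
  y : ∀ j ≤ 2 * N + 2, j ≠ N + 2 → inst j v = pw g (α ^ j)
  h : inst (N + 2) v = pw g x
  T : v .t (.pad 0) = T

/-- The registers that determine the simulated setup. -/
structure ParD (g : Γ.G) (α x : Γ.Z) (T : Γ.GT) (S : Finset Γ.Z) (u : Fin (N + 1) → Γ.Z)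
    (vv ww : Γ.Z) (v : DVM) : Prop extends IsInst g α x T v where
  rho : ∀ k ≤ N, v .z (.aux k) = rho S k
  u : ∀ k : Fin (N + 1), v .z (.pk k) = u k
  vv : v .z (.loc .t0) = vv
  ww : v .z (.loc .w) = ww

theorem inst_congr {v v' : DVM} (h : ∀ i, v' .g (.pad i) = v .g (.pad i)) (j : ℕ) :
    inst j v' = inst j v := by
  unfold inst
  split_ifs
  · exact h _
  · rfl

theorem IsInst.congr {v v' : DVM} (h : IsInst g α x T v)
    (hg : ∀ i, v' .g (.pad i) = v .g (.pad i)) (ht : v' .t (.pad 0) = v .t (.pad 0)) :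
    IsInst g α x T v' :=
  ⟨fun j h1 h2 => (inst_congr hg j).trans (h.y j h1 h2), (inst_congr hg _).trans h.h, ht.trans h.T⟩

theorem ParD.congr {v v' : DVM} (h : ParD g α x T S u vv ww v)
    (hg : ∀ i, v' .g (.pad i) = v .g (.pad i)) (ht : v' .t (.pad 0) = v .t (.pad 0))
    (ha : ∀ i, v' .z (.aux i) = v .z (.aux i)) (hp : ∀ i, v' .z (.pk i) = v .z (.pk i))
    (h0 : v' .z (.loc .t0) = v .z (.loc .t0)) (hw : v' .z (.loc .w) = v .z (.loc .w)) :
    ParD g α x T S u vv ww v' :=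
  ⟨h.toIsInst.congr hg ht, fun k hk => (ha k).trans (h.rho k hk), fun k => (hp k).trans (h.u k),
    h0.trans h.vv, hw.trans h.ww⟩

variable {v : VM Γ (Reg (2 * N + 2))} (h : ParD g α x T S u vv ww v)
include h

theorem ParD.instH {k : ℕ} (hk : k ≤ N) :
    instH k v = pw g (α ^ (k + 1) + v .z (.pk k)) := by
  rw [AIBBE.instH, h.y (k + 1) (by omega) (by omega), h.y 0 (by omega) (by omega), pow_zero, pw_one,
    pw_add]

theorem ParD.instH_eq (k : Fin (N + 1)) :
    AIBBE.instH k v = (simSetup g α S u vv ww).h k := by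
  rw [h.instH (by omega), h.u]
  rfl

theorem ParD.instZ_exp : instZ v = pw g (v .z (.loc .w) -
    ∑ k ∈ Finset.range (N + 1), v .z (.aux k) * (α ^ (k + 1) + v .z (.pk k))) := by
  rw [instZ, h.y 0 (by omega) (by omega), pow_zero, pw_one, sub_eq_add_neg, pw_add, ← Finset.sum_neg_distrib,
    pw_sum]
  congr 1
  refine Finset.prod_congr rfl fun k hk => ?_
  rw [h.instH (by simpa [Nat.lt_succ_iff] using hk), ← pw_mul]
  congr 1
  ring

theorem ParD.instZ : AIBBE.instZ v = (simSetup g α S u vv ww).z := by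
  rw [h.instZ_exp, h.ww, Finset.sum_range]
  simp only [simSetup, h.u]
  congr 2
  exact Finset.sum_congr rfl fun k _ => by rw [h.rho k (by omega)]

theorem ParD.instPk : instPk v = [(simSetup g α S u vv ww).g, (simSetup g α S u vv ww).g1,
    (simSetup g α S u vv ww).g2, (simSetup g α S u vv ww).z] ++
      List.ofFn (simSetup g α S u vv ww).h := by
  have e : (fun k : Fin (N + 1) => AIBBE.instH k v) = (simSetup g α S u vv ww).h :=
    funext h.instH_eq
  rw [AIBBE.instPk, e, h.instZ, h.y 0 (by omega) (by omega), h.y 1 (by omega) (by omega),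
    h.y (N + 1) (by omega) (by omega), pow_zero, pw_one, pow_one, h.vv, ← pw_add]
  rfl

theorem ParD.evalP_eq (hS : S.card ≤ N) : evalP v = ∏ y ∈ S, (v .z (.adv 0) - y) := by
  rw [evalP, ← sum_rho hS]
  exact Finset.sum_congr rfl fun k hk => by
    rw [h.rho k (by simpa [Nat.lt_succ_iff] using hk)]

theorem ParD.evalP_eq_zero (hS : S.card ≤ N) : evalP v = 0 ↔ v .z (.adv 0) ∈ S := by
  rw [h.evalP_eq hS, Finset.prod_eq_zero_iff]
  simp [sub_eq_zero]

theorem ParD.instE : instE v = pw g (∑ j ∈ Finset.range (N + 2),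
    α ^ j * ((evalP v)⁻¹ * v .z (.adv 0) ^ (N + 1 - j))) := by
  rw [AIBBE.instE, pw_sum]
  refine Finset.prod_congr rfl fun j hj => ?_
  have := Finset.mem_range.1 hj
  rw [h.y j (by omega) (by omega), ← pw_mul]

theorem ParD.instKey₀ (hP : evalP v ≠ 0) : instKey₀ v = pw g
    ((α ^ (N + 1) + v .z (.loc .t0)) * α + (v .z (.loc .w) - ∑ k ∈ Finset.range (N + 1),
      v .z (.aux k) * (α ^ (k + 1) + v .z (.pk k))) * (v .z (.loc .rr) +
        ∑ j ∈ Finset.range (N + 2), α ^ j * ((evalP v)⁻¹ * v .z (.adv 0) ^ (N + 1 - j)))) := by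
  rw [← key_exponent α (v .z (.adv 0)) (evalP v)⁻¹ (v .z (.loc .t0)) (v .z (.loc .w))
    (v .z (.loc .rr)) (fun k => v .z (.aux k)) (fun k => v .z (.pk k)) N (inv_mul_cancel₀ hP),
    AIBBE.instKey₀, h.instZ_exp, h.instE, h.y 1 (by omega) (by omega), pow_one, ← pw_mul, ← pw_mul,
    ← pw_mul, ← pw_add, ← pw_add]
  conv_rhs => rw [pw_add, pw_sum]
  congr 1
  refine Finset.prod_congr rfl fun k hk => ?_
  rw [pw_sum]
  refine Finset.prod_congr rfl fun j hj => ?_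
  have := Finset.mem_range.1 hj
  have := Finset.mem_range.1 hk
  split_ifs with hjk
  · rw [pw_zero]
  · rw [h.y (k + 1 + j) (by omega) (by omega), ← pw_mul]

theorem ParD.instKey {i : ℕ} (hi : i < N) : instKey i v = pw g
    ((α ^ (i + 1 + 1) + v .z (.pk (i + 1))) * (v .z (.loc .rr) +
        ∑ j ∈ Finset.range (N + 2), α ^ j * ((evalP v)⁻¹ * v .z (.adv 0) ^ (N + 1 - j))) +
      (α ^ (i + 1) + v .z (.pk i)) * (-v .z (.adv 0) * (v .z (.loc .rr) +
        ∑ j ∈ Finset.range (N + 2), α ^ j * ((evalP v)⁻¹ * v .z (.adv 0) ^ (N + 1 - j))))) := by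
  rw [AIBBE.instKey, h.instH (by omega), h.instH (by omega), h.instE,
    h.y (i + N + 3) (by omega) (by omega), h.y (i + 1) (by omega) (by omega)]
  simp only [← pw_mul, ← pw_add]
  congr 1
  -- The exponents of the two neighbours h_(i+1) and h_i contribute α^(i+1)(α - ID)E apart from the
  -- masks.
  linear_combination -(α ^ (i + 1)) * geom_exponent α (v .z (.adv 0)) (evalP v)⁻¹ N

/-- The shift E depends on the identity and the parameters but not on `rr`. Having it before `rr` is
drawn allows it to serve as the translation in `Rel.unif_add_unitZ`. -/
theorem ParD.instKeyList (hP : evalP v ≠ 0) : ∃ E : Γ.Z, (∀ v' : DVM,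
    ParD g α x T S u vv ww v' → v' .z (.adv 0) = v .z (.adv 0) → instKeyList v' =
      (simSetup g α S u vv ww).keyFor (simSetup g α S u vv ww).g2 (v .z (.adv 0))
        (v' .z (.loc .rr) + E)) := by
  refine ⟨∑ j ∈ Finset.range (N + 2), α ^ j * ((evalP v)⁻¹ * v .z (.adv 0) ^ (N + 1 - j)),
    fun v' h' hID => ?_⟩
  have hev : evalP v' = evalP v := by
    rw [evalP, evalP, hID]
    exact Finset.sum_congr rfl fun k hk => by
      have hk : k ≤ N := by simpa [Nat.lt_succ_iff] using hk
      rw [h.rho k hk, h'.rho k hk]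
  have hz : (v' .z (.loc .w) - ∑ k ∈ Finset.range (N + 1),
      v' .z (.aux k) * (α ^ (k + 1) + v' .z (.pk k))) =
      ww - ∑ k : Fin (N + 1), AIBBE.rho S k * (α ^ (k + 1 : ℕ) + u k) := by
    rw [h'.ww, Finset.sum_range]
    congr 1
    exact Finset.sum_congr rfl fun k _ => by rw [h'.rho k (by omega), h'.u]
  rw [AIBBE.instKeyList, h'.instKey₀ (hev ▸ hP), h'.instE, hz, hev, hID,
    h'.y 0 (by omega) (by omega), pow_zero, pw_one, h'.vv, Setup.keyFor]
  have e : (fun i : Fin N => AIBBE.instKey i v') = fun i : Fin N =>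
      pw ((simSetup g α S u vv ww).h i.succ) (v' .z (.loc .rr) +
        ∑ j ∈ Finset.range (N + 2), α ^ j * ((evalP v)⁻¹ * v .z (.adv 0) ^ (N + 1 - j))) *
      pw ((simSetup g α S u vv ww).h i.castSucc) (-v .z (.adv 0) * (v' .z (.loc .rr) +
        ∑ j ∈ Finset.range (N + 2), α ^ j * ((evalP v)⁻¹ * v .z (.adv 0) ^ (N + 1 - j)))) := by
    funext i
    have h1 := h'.u i.succ
    have h2 := h'.u i.castSucc
    simp only [Fin.val_succ, Fin.val_castSucc] at h1 h2
    rw [h'.instKey i.isLt, h1, h2, hev, hID, pw_add, pw_mul, pw_mul]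
    rfl
  rw [e]
  simp only [simSetup, pw_add, pw_mul]

end Keys

end AIBBE

end

noncomputable section

namespace AIBBE

open Classical
open scoped ENNReal

variable {Γ : BilinearGroup} {N : ℕ}

local notation "DVM" => VM Γ (Reg (2 * N + 2))

/-! ### The simulation of the real-or-random game by the distinguisher -/

section Simulation

variable {g : Γ.G} {α x : Γ.Z} {T : Γ.GT}

/-- The public key of the Boneh-Hamburg scheme. -/
def Setup.bhpk (s : Setup Γ N) : List Γ.G := [s.g, s.g1, s.g2, s.z] ++ List.ofFn s.h

/-- The distinguisher simulates the setup `s` and the memory of the adversary. -/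
def SimD (g : Γ.G) (α x : Γ.Z) (T : Γ.GT) (s : Setup Γ N) (S : Finset Γ.Z) (v : DVM)
    (m : Mem Γ) : Prop :=
  ∃ u vv ww, s = simSetup g α S u vv ww ∧ S.card ≤ N ∧ ParD g α x T S u vv ww v ∧ v.advMem = m

/-- Since h occupies the place of the missing power, the index of every other register is the
exponent of α in it. -/
theorem isInst_view_dbdheInput (g : Γ.G) (α x : Γ.Z) (T : Γ.GT) :
    IsInst (N := N) g α x T ((layout (2 * N + 2)).view (dbdheInput (N + 1) g α (pw g x) T)) := by
  have e : ∀ j, j < 2 * N + 3 →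
      inst (N := N) j ((layout (2 * N + 2)).view (dbdheInput (N + 1) g α (pw g x) T)) =
      ((List.range (N + 1 + 1)).map (fun i => pw g (α ^ i)) ++ [pw g x] ++
        (List.range (N + 1 - 1)).map (fun i => pw g (α ^ (N + 1 + 2 + i)))).getD j 1 := by
    intro j hj
    rw [inst, dif_pos (by omega)]
    rfl
  refine ⟨fun j h1 h2 => ?_, ?_, rfl⟩
  · rw [e j (by omega), List.getD_eq_getElem?_getD]
    by_cases hj : j < N + 2
    · rw [List.getElem?_append_left (by simp; omega), List.getElem?_append_left (by simp; omega)]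
      simp [hj]
    · rw [List.getElem?_append_right (by simp; omega)]
      simp only [List.length_append, List.length_map, List.length_range, List.length_cons,
        List.length_nil, List.getElem?_map]
      rw [List.getElem?_range (by omega)]
      simp only [Option.map_some, Option.getD_some]
      congr 2
      omega
  · rw [e _ (by omega), List.getD_eq_getElem?_getD, List.getElem?_append_left (by simp),
      List.getElem?_append_right (by simp)]
    simp

theorem view_dbdheInput_of_ne {h : Γ.G} {k : Kind} {y : Reg (2 * N + 2)} (hy : ∀ i, y ≠ .pad i) :
    (layout (2 * N + 2)).view (dbdheInput (N + 1) g α h T) k y =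
      (layout (2 * N + 2)).view (Mem.init Γ) k y := by
  rw [dbdheInput, view_putT (by simp), view_putG (by simp; omega)]
  cases y
  case pad i => exact absurd rfl (hy i)
  all_goals cases k <;> rfl

theorem bhKeygen_eq (s : Setup Γ N) (ID : Γ.Z) :
    s.bhKeygen ID = (unitZ Γ).map fun r => s.keyFor s.g2 ID r := rfl

/-- Refusals are exact, because the polynomial vanishes precisely at the targets. A delivered key
has randomness `rr + E`, uniform on all exponents instead of the nonzero ones, at an error of 1/p.
-/
theorem rel_dQuery {s : Setup Γ N} {S : Finset Γ.Z} (P : Prog Γ) {v : DVM} {m : Mem Γ}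
    (h : SimD g α x T s S v m) :
    Rel (Γ.p : ℝ≥0∞)⁻¹ (SimD g α x T s S) (dQuery P v) (bhStep s S P m) := by
  obtain ⟨u, vv, ww, rfl, hS, hp, ha⟩ := h
  rw [dQuery, runAdv, ha, bhStep, PMF.bind_map]
  refine Rel.bind_same _ fun m' => ?_
  set w : DVM := v.push Reg.adv m' with hw
  have hpw : ParD g α x T S u vv ww w := hp.congr (by simp [hw]) (by simp [hw]) (by simp [hw])
    (by simp [hw]) (by simp [hw]) (by simp [hw])
  have hset : ∀ a, ParD g α x T S u vv ww (w.set .z (.loc .rr) a) := fun a =>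
    hpw.congr (by simp) (by simp) (by simp) (by simp) (by simp) (by simp)
  have hans : ∀ v : DVM, ParD g α x T S u vv ww v → ParD g α x T S u vv ww (instAnswer v) :=
    fun v h => h.congr (fun _ => rfl) rfl (fun _ => rfl) (fun _ => rfl) rfl rfl
  have hid : w .z (.adv 0) = m'.z 0 := by simp [hw, Mem.get]
  have hida : ∀ a, (w.set .z (.loc .rr) a) .z (.adv 0) = m'.z 0 := fun a => by
    rw [← hid]; simp
  have hadv : ∀ a k i, (w.set .z (.loc .rr) a) k (.adv i) = m'.get k i := fun a k i => by
    simp [hw]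
  rw [Function.comp, PMF.bind_map, bhAnswer]
  split_ifs with hmem
  · refine (Rel.bind_left fun a => Rel.pure ?_).mono (zero_le) fun _ _ h => h
    have hz : evalP (w.set .z (.loc .rr) a) = 0 :=
      ((hset a).evalP_eq_zero hS).2 (by rw [hida]; exact hmem)
    refine ⟨u, vv, ww, rfl, hS, hans _ (hset a), Mem.ext_get fun k i => ?_⟩
    rw [advMem_get]
    cases k
    case g => exact (if_pos hz).trans (hadv a .g i)
    case t => exact hadv a .t i
    case z => exact hadv a .z i
    case b =>
      cases i
      · exact decide_eq_false (not_not.2 hz)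
      · exact hadv a .b _
  · have hz : ∀ a, ¬evalP (w.set .z (.loc .rr) a) = 0 := fun a h0 =>
      hmem (by rw [← hida a]; exact ((hset a).evalP_eq_zero hS).1 h0)
    have hzw : evalP w ≠ 0 := fun h0 => hmem (by rw [← hid]; exact (hpw.evalP_eq_zero hS).1 h0)
    obtain ⟨E, hE⟩ := hpw.instKeyList hzw
    rw [bhKeygen_eq, PMF.map_comp]
    refine Rel.map (Rel.unif_add_unitZ E) ?_
    rintro a r rfl
    have hkey : instKeyList (w.set .z (.loc .rr) a) = (simSetup g α S u vv ww).keyFor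
        (simSetup g α S u vv ww).g2 (m'.z 0) (a + E) := by
      rw [hE _ (hset a) (by rw [hida, hid]), hid]
      simp
    refine ⟨u, vv, ww, rfl, hS, hans _ (hset a), Mem.ext_get fun k i => ?_⟩
    rw [advMem_get]
    cases k
    case g =>
      refine (if_neg (hz a)).trans ?_
      rw [hkey]
      exact congrArg (List.getD _ i) (hadv a .g i)
    case t => exact hadv a .t i
    case z => exact hadv a .z i
    case b =>
      cases i
      · exact decide_eq_true (hz a)
      · exact hadv a .b _

/-- The challenger's part of the game before the first query, with parameters `g` and `α`. -/
def simStart (N : ℕ) (P : Prog Γ) (g : Γ.G) (α : Γ.Z) :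
    PMF ((Setup Γ N × Finset Γ.Z) × Mem Γ) :=
  (P.run (Mem.init Γ)).bind fun m =>
  (unif (Fin (N + 1) → Γ.Z)).bind fun u =>
  (unif Γ.Z).bind fun vv =>
  (unif Γ.Z).bind fun ww => PMF.pure ((simSetup g α (targets N m) u vv ww, targets N m),
    m.putG (simSetup g α (targets N m) u vv ww).bhpk)

theorem rel_dStart (P : Prog Γ) (g : Γ.G) (α x : Γ.Z) (T : Γ.GT) :
    Rel 0 (fun v q => SimD g α x T q.1.1 q.1.2 v q.2)
      (dStart P ((layout (2 * N + 2)).view (dbdheInput (N + 1) g α (pw g x) T)))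
      (simStart N P g α) := by
  set v : DVM := (layout (2 * N + 2)).view (dbdheInput (N + 1) g α (pw g x) T) with hv
  have hi : IsInst (N := N) g α x T v := isInst_view_dbdheInput g α x T
  have h0 : v.advMem = Mem.init Γ := by
    refine Mem.ext_get fun k i => ?_
    rw [advMem_get, hv, view_dbdheInput_of_ne (by simp)]
    cases k <;> rfl
  rw [dStart, simStart, runAdv, h0, PMF.bind_map]
  refine Rel.bind_same _ fun m => ?_
  rw [Function.comp, PMF.pure_bind]
  set w : DVM := rhoInit (v.push Reg.adv m) with hw
  have wadv : ∀ k i, w k (.adv i) = m.get k i := fun k i => by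
    rw [hw]
    cases k <;> simp [rhoInit]
  have ha : w.advMem = m := Mem.ext_get fun k i => by rw [advMem_get, wadv]
  have haux : ∀ k, w .z (.aux k) = rho ∅ k := by
    intro k
    rw [rho_empty]
    cases k with
    | zero => rfl
    | succ k =>
      have : w .z (.aux (k + 1)) = v .z (.aux (k + 1)) := by simp [hw, rhoInit]
      rw [this, hv, view_dbdheInput_of_ne (by simp), if_neg (by omega)]
      rfl
  obtain ⟨w', h1, h2, h3⟩ := iter_rhoStep ha haux le_rfl
  rw [h1, PMF.pure_bind]
  refine (rel_iter_sample w' (N + 1)).bind_exact fun v' u ⟨hu, hrest⟩ => ?_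
  rw [PMF.bind_map]
  refine Rel.bind_same _ fun vv => ?_
  rw [Function.comp, PMF.bind_map]
  refine Rel.bind_same _ fun ww => Rel.pure ?_
  have hpad : ∀ k i, v' k (.pad i) = v k (.pad i) := fun k i => by
    rw [hrest _ _ (by simp), h2 _ _ (by simp), hw]
    cases k <;> simp [rhoInit]
  have hadv : ∀ k i, v' k (.adv i) = m.get k i := fun k i => by
    rw [hrest _ _ (by simp), h2 _ _ (by simp), wadv]
  set w₂ : DVM := (v'.set .z (.loc .t0) vv).set .z (.loc .w) ww with hw₂
  have hp : ParD g α x T (targets N m) u vv ww w₂ := by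
    refine ⟨hi.congr (fun i => ?_) ?_, fun k hk => ?_, fun k => ?_, ?_, ?_⟩
    · rw [← hpad]; simp [hw₂]
    · rw [← hpad]; simp [hw₂]
    · rw [← h3 k hk, ← hrest _ _ (by simp)]; simp [hw₂]
    · rw [← hu]; simp [hw₂]
    · simp [hw₂]
    · simp [hw₂]
  refine ⟨u, vv, ww, rfl, card_targets_le m, hp.congr (fun _ => rfl) rfl (fun _ => rfl)
    (fun _ => rfl) rfl rfl, Mem.ext_get fun k i => ?_⟩
  have hadv₂ : ∀ k i, w₂ k (.adv i) = m.get k i := fun k i => by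
    rw [← hadv]; simp [hw₂]
  rw [advMem_get]
  cases k
  case g =>
    have : instDeliver w₂ .g (.adv i) = (instPk w₂).getD i (w₂ .g (.adv i)) := rfl
    rw [this, hp.instPk, hadv₂]
    rfl
  all_goals exact hadv₂ _ i

theorem hash_simSetup (g : Γ.G) (α : Γ.Z) (S : Finset Γ.Z) (u : Fin (N + 1) → Γ.Z) (vv ww : Γ.Z) :
    (simSetup g α S u vv ww).hash S = pw g ww := by
  have h : ∀ k : Fin (N + 1), pw ((simSetup g α S u vv ww).h k) (rho S k) =
      pw g (rho S k * (α ^ (k + 1 : ℕ) + u k)) := fun k => by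
    rw [mul_comm, pw_mul]
    rfl
  simp only [Setup.hash, h]
  rw [← pw_sum, simSetup, ← pw_add, sub_add_cancel]

/-- The game after the setup; the challenge has the randomness `x` and is multiplied by `W`. -/
def finish (B : BHAdversary Γ) (W : Γ.GT) (x : Γ.Z) (q : (Setup Γ N × Finset Γ.Z) × Mem Γ) :
    PMF Bool :=
  (runList (bhStep q.1.1 q.1.2) B.pre q.2).bind fun m =>
  (B.choose.run m).bind fun m =>
  (runList (bhStep q.1.1 q.1.2) B.post
    ((m.putT [m.t 0 * W * pw (Γ.e q.1.1.g1 q.1.1.g2) x]).putG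
      [pw q.1.1.g x, pw (q.1.1.hash q.1.2) x])).bind fun m =>
  (B.guess.run m).map fun m => m.b 0

theorem rel_dChoose {s : Setup Γ N} {S : Finset Γ.Z} {W : Γ.GT} (P : Prog Γ) {v : DVM} {m : Mem Γ}
    (hT : T = W * pw (Γ.e g (pw g x)) (α ^ (N + 2))) (h : SimD g α x T s S v m) :
    Rel 0 (SimD g α x T s S) (dChoose P v) ((P.run m).map fun m =>
      (m.putT [m.t 0 * W * pw (Γ.e s.g1 s.g2) x]).putG [pw s.g x, pw (s.hash S) x]) := by
  obtain ⟨u, vv, ww, rfl, hS, hp, ha⟩ := h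
  rw [dChoose, runAdv, ha, PMF.bind_map]
  refine Rel.map (R := fun a b => a = b) (Rel.refl _ fun _ => rfl) ?_
  rintro m' _ rfl
  set w : DVM := v.push Reg.adv m' with hw
  have hpw : ParD g α x T S u vv ww w := hp.congr (by simp [hw]) (by simp [hw]) (by simp [hw])
    (by simp [hw]) (by simp [hw]) (by simp [hw])
  have hadv : ∀ k i, w k (.adv i) = m'.get k i := fun k i => by simp [hw]
  refine ⟨u, vv, ww, rfl, hS, hpw.congr (fun _ => rfl) rfl (fun _ => rfl) (fun _ => rfl) rfl rfl,
    Mem.ext_get fun k i => ?_⟩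
  rw [advMem_get]
  cases k
  case g =>
    rcases i with _ | _ | i
    · exact hpw.h
    · have : instCt w .g (.adv 1) = pw (inst (N + 2) w) (w .z (.loc .w)) := rfl
      rw [this, hpw.h, hpw.ww, hash_simSetup, ← pw_mul, mul_comm, pw_mul]
      rfl
    · exact hadv .g _
  case t =>
    cases i with
    | zero =>
      have : instCt w .t (.adv 0) = w .t (.adv 0) * w .t (.pad 0) *
        pw (Γ.e (inst 1 w) (inst (N + 2) w)) (w .z (.loc .t0)) := rfl
      -- In base e(g,g) the exponent xα^(N+2) of `T`, up to `W`, and the exponent αxv of the pairing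
      -- add up to that of e(g1,g2)^x, namely α(α^(N+1) + v)x.
      have e1 : Γ.e (simSetup g α S u vv ww).g1 (simSetup g α S u vv ww).g2 =
          pw (Γ.e g g) (α * (α ^ (N + 1) + vv)) := e_pw _ _ _ _
      have e2 : Γ.e g (pw g x) = pw (Γ.e g g) (1 * x) := by rw [← e_pw, pw_one]
      rw [this, hpw.h, hpw.T, hpw.vv, hpw.y 1 (by omega) (by omega), e_pw, hadv, hT, e2]
      refine Eq.trans ?_ (show m'.t 0 * W * pw (Γ.e (simSetup g α S u vv ww).g1
        (simSetup g α S u vv ww).g2) x = _ from rfl)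
      rw [e1, ← pw_mul, ← pw_mul, ← pw_mul]
      simp only [mul_assoc, ← pw_add]
      congr 3
      ring
    | succ i => exact hadv .t _
  case z => exact hadv .z i
  case b => exact hadv .b i

theorem rel_dGuess {s : Setup Γ N} {S : Finset Γ.Z} (P : Prog Γ) {v : DVM} {m : Mem Γ}
    (h : SimD g α x T s S v m) :
    Rel 0 (fun v r => v .b (.pad 0) = r) (dGuess P v) ((P.run m).map fun m => m.b 0) := by
  obtain ⟨u, vv, ww, rfl, hS, hp, ha⟩ := h
  rw [dGuess, runAdv, ha, PMF.bind_map]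
  refine Rel.map (R := fun a b => a = b) (Rel.refl _ fun _ => rfl) ?_
  rintro m' _ rfl
  exact push_adv v m' .b 0

theorem rel_dAll (B : BHAdversary Γ) (g : Γ.G) (α x : Γ.Z) (W : Γ.GT) :
    Rel (B.queries * (Γ.p : ℝ≥0∞)⁻¹) (fun v r => v .b (.pad 0) = r)
      (dAll B ((layout (2 * N + 2)).view (dbdheInput (N + 1) g α (pw g x)
        (W * pw (Γ.e g (pw g x)) (α ^ (N + 2))))))
      ((simStart N B.start g α).bind (finish B W x)) := by
  have e : (B.queries * (Γ.p : ℝ≥0∞)⁻¹) =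
      B.pre.length * (Γ.p : ℝ≥0∞)⁻¹ + B.post.length * (Γ.p : ℝ≥0∞)⁻¹ := by
    rw [BHAdversary.queries, Nat.cast_add, add_mul]
  rw [dAll, e]
  refine (rel_dStart B.start g α x _).bind_exact fun v q hq => ?_
  rw [finish]
  refine Rel.bind (Rel.runList (R := SimD g α x _ q.1.1 q.1.2)
    (fun Q v m h => rel_dQuery Q h) B.pre hq) fun v m hm => ?_
  have : ∀ μ : PMF (Mem Γ), (μ.bind fun m' => (runList (bhStep q.1.1 q.1.2) B.post
    ((m'.putT [m'.t 0 * W * pw (Γ.e q.1.1.g1 q.1.1.g2) x]).putG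
      [pw q.1.1.g x, pw (q.1.1.hash q.1.2) x])).bind fun m => (B.guess.run m).map fun m => m.b 0) =
    (μ.map fun m' => (m'.putT [m'.t 0 * W * pw (Γ.e q.1.1.g1 q.1.1.g2) x]).putG
      [pw q.1.1.g x, pw (q.1.1.hash q.1.2) x]).bind fun m =>
        (runList (bhStep q.1.1 q.1.2) B.post m).bind fun m => (B.guess.run m).map fun m => m.b 0 :=
    fun μ => by rw [PMF.bind_map]; rfl
  rw [this]
  refine (rel_dChoose B.choose rfl hm).bind_exact fun v m hm => ?_
  exact (Rel.bind (Rel.runList (R := SimD g α x _ q.1.1 q.1.2)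
    (fun Q v m h => rel_dQuery Q h) B.post hm) fun v m hm => rel_dGuess B.guess hm).mono
    (add_zero _).le fun _ _ h => h

end Simulation

end AIBBE

end

/-! ### The problem instance against the real-or-random game of BH -/

noncomputable section

namespace AIBBE

open Classical
open scoped ENNReal

variable {Γ : BilinearGroup} {N : ℕ}

section Comparison

/-- The masks act by bijections: u_k translates to a_k, and for given a the masks v and w determine
g2 and z uniformly. Hence the simulated parameters reveal neither S nor the special exponents. -/
theorem simSetup_bind {β : Type} {g : Γ.G} (hg : g ≠ 1) (α : Γ.Z) (S : Finset Γ.Z)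
    (F : Setup Γ N → PMF β) :
    ((unif (Fin (N + 1) → Γ.Z)).bind fun u => (unif Γ.Z).bind fun vv => (unif Γ.Z).bind fun ww =>
      F (simSetup g α S u vv ww)) =
    (unif Γ.G).bind fun g2 => (unif Γ.G).bind fun z => (unif (Fin (N + 1) → Γ.Z)).bind fun a =>
      F ⟨g, g2, z, a, α⟩ := by
  have h1 : ∀ a : Fin (N + 1) → Γ.Z, ((unif Γ.Z).bind fun vv => (unif Γ.Z).bind fun ww =>
      F ⟨g, pw g (α ^ (N + 1) + vv), pw g (ww - ∑ k : Fin (N + 1), rho S k * a k), a, α⟩) =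
      (unif Γ.G).bind fun g2 => (unif Γ.G).bind fun z => F ⟨g, g2, z, a, α⟩ := by
    intro a
    rw [← unif_bind_equiv ((Equiv.addLeft (α ^ (N + 1))).trans (pwEquiv hg))]
    congr 1; funext vv
    rw [← unif_bind_equiv ((Equiv.subRight (∑ k : Fin (N + 1), rho S k * a k)).trans (pwEquiv hg))]
    rfl
  have h2 := unif_bind_equiv (Equiv.addLeft fun k : Fin (N + 1) => α ^ (k + 1 : ℕ)) fun a =>
    (unif Γ.Z).bind fun vv => (unif Γ.Z).bind fun ww =>
      F ⟨g, pw g (α ^ (N + 1) + vv), pw g (ww - ∑ k : Fin (N + 1), rho S k * a k), a, α⟩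
  refine h2.trans ?_
  simp only [h1]
  rw [PMF.bind_comm]
  congr 1; funext g2
  rw [PMF.bind_comm]

/-- The challenger's part of the real-or-random game before the first query. -/
def bhStart (N : ℕ) (P : Prog Γ) : PMF ((Setup Γ N × Finset Γ.Z) × Mem Γ) :=
  (P.run (Mem.init Γ)).bind fun m =>
  (setup Γ N).bind fun s => PMF.pure ((s, targets N m), m.putG s.bhpk)

theorem simStart_bind (P : Prog Γ) :
    ((unif Γ.Gen).bind fun g => (unif Γ.Zˣ).bind fun α => simStart N P g α) = bhStart N P := by
  have h : ∀ (g : Γ.Gen) (α : Γ.Zˣ), simStart N P g α = (P.run (Mem.init Γ)).bind fun m =>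
      (unif Γ.G).bind fun g2 => (unif Γ.G).bind fun z => (unif (Fin (N + 1) → Γ.Z)).bind fun a =>
        PMF.pure (((⟨g, g2, z, a, α⟩ : Setup Γ N), targets N m),
          m.putG (⟨g, g2, z, a, α⟩ : Setup Γ N).bhpk) := by
    intro g α
    rw [simStart]
    congr 1; funext m
    exact simSetup_bind g.2 (α : Γ.Z) (targets N m)
      fun s => PMF.pure ((s, targets N m), m.putG s.bhpk)
  simp only [h]
  have h1 : ∀ g : Γ.Gen, ((unif Γ.Zˣ).bind fun α => (P.run (Mem.init Γ)).bind fun m =>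
      (unif Γ.G).bind fun g2 => (unif Γ.G).bind fun z => (unif (Fin (N + 1) → Γ.Z)).bind fun a =>
        PMF.pure (((⟨g, g2, z, a, α⟩ : Setup Γ N), targets N m),
          m.putG (⟨g, g2, z, a, α⟩ : Setup Γ N).bhpk)) =
      (P.run (Mem.init Γ)).bind fun m => (unif Γ.G).bind fun g2 => (unif Γ.G).bind fun z =>
        (unif (Fin (N + 1) → Γ.Z)).bind fun a => (unif Γ.Zˣ).bind fun α =>
        PMF.pure (((⟨g, g2, z, a, α⟩ : Setup Γ N), targets N m),
          m.putG (⟨g, g2, z, a, α⟩ : Setup Γ N).bhpk) := by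
    intro g
    rw [PMF.bind_comm]; congr 1; funext m
    rw [PMF.bind_comm]; congr 1; funext g2
    rw [PMF.bind_comm]; congr 1; funext z
    rw [PMF.bind_comm]
  simp only [h1]
  rw [PMF.bind_comm, bhStart]
  congr 1; funext m
  have hs : setup Γ N = (unif Γ.Gen).bind fun g => (unif Γ.G).bind fun g2 =>
      (unif Γ.G).bind fun z => (unif (Fin (N + 1) → Γ.Z)).bind fun a =>
      (unitZ Γ).map fun α => ⟨g, g2, z, a, α⟩ := rfl
  rw [hs]
  simp only [PMF.bind_bind, unitZ, PMF.map_comp, PMF.bind_map]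
  rfl

/-- The factor of the challenge ciphertext. -/
def factor (Γ : BilinearGroup) (real : Bool) : PMF Γ.GT := if real then PMF.pure 1 else unif Γ.GT

/-- A uniform message may be written as the chosen message times a uniform factor. Thus both cases
have the same form, with the factor 1 in the real one. -/
theorem bhEncrypt_bind {β : Type} (real : Bool) (s : Setup Γ N) (S : Finset Γ.Z) (M₀ : Γ.GT)
    (F : Γ.GT × Γ.G × Γ.G → PMF β) :
    ((if real then PMF.pure M₀ else unif Γ.GT).bind fun M => (s.bhEncrypt S M).bind F) =
      (factor Γ real).bind fun W => (unitZ Γ).bind fun x =>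
        F (M₀ * W * pw (Γ.e s.g1 s.g2) x, pw s.g x, pw (s.hash S) x) := by
  have h : ∀ M, (s.bhEncrypt S M).bind F = (unitZ Γ).bind fun x =>
      F (M * pw (Γ.e s.g1 s.g2) x, pw s.g x, pw (s.hash S) x) := by
    intro M
    have e : s.bhEncrypt S M = (unitZ Γ).map fun x =>
        (M * pw (Γ.e s.g1 s.g2) x, pw s.g x, pw (s.hash S) x) := rfl
    rw [e, PMF.bind_map]
    rfl
  simp only [h, factor]
  cases real
  · simp only [Bool.false_eq_true, if_false]
    exact (unif_bind_equiv (Equiv.mulLeft M₀) _).symm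
  · simp

/-- The game up to the choice of the message. -/
def untilChoice (N : ℕ) (B : BHAdversary Γ) : PMF ((Setup Γ N × Finset Γ.Z) × Mem Γ) :=
  (bhStart N B.start).bind fun q =>
  (runList (bhStep q.1.1 q.1.2) B.pre q.2).bind fun m => (B.choose.run m).map fun m => (q.1, m)

/-- The game after the challenge. -/
def afterCt (B : BHAdversary Γ) (q : (Setup Γ N × Finset Γ.Z) × Mem Γ) (C : Γ.GT × Γ.G × Γ.G) :
    PMF Bool :=
  (runList (bhStep q.1.1 q.1.2) B.post ((q.2.putT [C.1]).putG [C.2.1, C.2.2])).bind fun m =>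
  (B.guess.run m).map fun m => m.b 0

theorem finish_bind (B : BHAdversary Γ) (W : Γ.GT) (x : Γ.Z) :
    (bhStart N B.start).bind (finish B W x) = (untilChoice N B).bind fun q => afterCt B q
      (q.2.t 0 * W * pw (Γ.e q.1.1.g1 q.1.1.g2) x, pw q.1.1.g x, pw (q.1.1.hash q.1.2) x) := by
  rw [untilChoice, PMF.bind_bind]
  congr 1; funext q
  rw [finish, PMF.bind_bind]
  congr 1; funext m
  rw [PMF.bind_map]
  rfl

theorem bhGame_eq_bind (real : Bool) (B : BHAdversary Γ) :
    bhGame N real B = (untilChoice N B).bind fun q =>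
      (if real then PMF.pure (q.2.t 0) else unif Γ.GT).bind fun M =>
        (q.1.1.bhEncrypt q.1.2 M).bind (afterCt B q) := by
  rw [untilChoice, bhStart, bhGame, PMF.bind_bind, PMF.bind_bind]
  congr 1; funext m
  rw [PMF.bind_bind]
  dsimp only
  congr 1; funext s
  rw [PMF.pure_bind, PMF.bind_bind, bhQueries_eq]
  congr 1; funext m₁
  rw [PMF.bind_map]
  congr 1; funext m₂
  simp only [bhQueries_eq]
  rfl

theorem bhGame_eq (real : Bool) (B : BHAdversary Γ) :
    bhGame N real B = (factor Γ real).bind fun W => (unitZ Γ).bind fun x =>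
      (bhStart N B.start).bind (finish B W x) := by
  simp only [finish_bind, bhGame_eq_bind, bhEncrypt_bind]
  rw [PMF.bind_comm]
  congr 1; funext W
  rw [PMF.bind_comm]

/-- The error of the simulation of the real-or-random game with `q` queries. -/
def simError (Γ : BilinearGroup) (q : ℕ) : ℝ≥0∞ := (Γ.p : ℝ≥0∞)⁻¹ + q * (Γ.p : ℝ≥0∞)⁻¹

theorem rel_dbdheGame {B : BHAdversary Γ} {D : Prog Γ}
    (hD : ∀ m, (D.run m).map (layout (2 * N + 2)).view = dAll B ((layout (2 * N + 2)).view m))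
    (real : Bool) :
    Rel (simError Γ B.queries) (· = ·) (dbdheGame (N + 1) real D) (bhGame N real B) := by
  have h1 : bhGame N real B = (unif Γ.Gen).bind fun g => (unif Γ.Zˣ).bind fun α =>
      (unitZ Γ).bind fun x => (factor Γ real).bind fun W =>
        (simStart N B.start g α).bind (finish B W x) := by
    rw [bhGame_eq, ← simStart_bind]
    simp only [PMF.bind_bind]
    have e : ∀ (g : Γ.Gen) (α : Γ.Zˣ), ((unitZ Γ).bind fun x => (factor Γ real).bind fun W =>
        (simStart N B.start g α).bind (finish B W x)) = (factor Γ real).bind fun W =>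
        (unitZ Γ).bind fun x => (simStart N B.start g α).bind (finish B W x) :=
      fun g α => PMF.bind_comm _ _ _
    simp only [e]
    have e1 : ∀ W, ((unitZ Γ).bind fun x => (unif Γ.Gen).bind fun g => (unif Γ.Zˣ).bind fun α =>
        (simStart N B.start g α).bind (finish B W x)) = (unif Γ.Gen).bind fun g =>
        (unif Γ.Zˣ).bind fun α => (unitZ Γ).bind fun x =>
          (simStart N B.start g α).bind (finish B W x) := by
      intro W
      rw [PMF.bind_comm]; congr 1; funext g
      rw [PMF.bind_comm]
    simp only [e1]
    rw [PMF.bind_comm]; congr 1; funext g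
    rw [PMF.bind_comm]
  rw [h1, dbdheGame]
  refine Rel.bind_same _ fun g => Rel.bind_same _ fun α => ?_
  -- The element h is uniform, hence g^x with uniform x, whereas encryption uses x ≠ 0; this adds
  -- one more error of 1/p.
  rw [← unif_bind_equiv (pwEquiv g.2)]
  refine Rel.bind (Rel.unif_add_unitZ 0) ?_
  rintro x _ rfl
  rw [add_zero]
  -- A uniform `T` is a uniform factor times the true value, so that `W` becomes the factor of the
  -- challenge.
  have h2 : (if real then PMF.pure (pw (Γ.e g (pwEquiv g.2 x)) ((α : Γ.Z) ^ (N + 1 + 1))) else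
      unif Γ.GT) = (factor Γ real).map fun W => W * pw (Γ.e g (pw g x)) ((α : Γ.Z) ^ (N + 2)) := by
    cases real
    · refine (PMF.bind_pure _).symm.trans ?_
      simp only [factor, Bool.false_eq_true, if_false, ← PMF.bind_pure_comp]
      exact (unif_bind_equiv (Equiv.mulRight (pw (Γ.e g (pw g x)) ((α : Γ.Z) ^ (N + 2)))) _).symm
    · simp only [factor, if_true, PMF.pure_map, one_mul]
      rfl
  rw [h2, PMF.bind_map]
  refine Rel.bind_same _ fun W => ?_
  have h3 := rel_dAll (N := N) B g (α : Γ.Z) x W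
  rw [← hD] at h3
  have h4 := Rel.map (Rel.of_map_left h3) (φ := fun m : Mem Γ => m.b 0) (ψ := id)
    (R' := (· = ·)) fun a b h => h
  rw [PMF.map_id] at h4
  exact h4

theorem simError_toReal (Γ : BilinearGroup) (q : ℕ) :
    (simError Γ q).toReal = (q + 1) * (1 / (Γ.p : ℝ)) := by
  have hp : (Γ.p : ℝ≥0∞)⁻¹ ≠ ⊤ := by simp [Γ.prime.out.ne_zero]
  rw [simError, ENNReal.toReal_add hp (ENNReal.mul_ne_top (by simp) hp), ENNReal.toReal_mul]
  simp
  ring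

/-- The Boneh-Hamburg scheme is secure under the decision bilinear Diffie-Hellman exponent
assumption. -/
theorem bhAdv_le (N : ℕ) (B : BHAdversary Γ) : ∃ D : Prog Γ,
    D.cost ≤ (B.size + 2 * N + 6) ^ 60 ∧
      bhAdv N B ≤ dbdheAdv (N + 1) D + 2 * ((B.queries + 1) * (1 / (Γ.p : ℝ))) := by
  obtain ⟨D, hc, hD⟩ := exists_distinguisher N B
  refine ⟨D, hc, ?_⟩
  have ht : simError Γ B.queries ≠ ⊤ := by
    have hp : (Γ.p : ℝ≥0∞)⁻¹ ≠ ⊤ := by simp [Γ.prime.out.ne_zero]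
    exact ENNReal.add_ne_top.2 ⟨hp, ENNReal.mul_ne_top (by simp) hp⟩
  have h1 := (rel_dbdheGame hD true).abs_sub_le ht
  have h2 := (rel_dbdheGame hD false).abs_sub_le ht
  rw [simError_toReal] at h1 h2
  rw [bhAdv, dbdheAdv]
  rw [abs_le] at h1 h2 ⊢
  have h3 := neg_abs_le ((dbdheGame (N + 1) true D true).toReal - (dbdheGame (N + 1) false D true).toReal)
  have h4 := le_abs_self ((dbdheGame (N + 1) true D true).toReal - (dbdheGame (N + 1) false D true).toReal)
  constructor <;> linarith

end Comparison

end AIBBE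

end

noncomputable section

namespace AIBBE

open Filter Topology

/-! ### Asymptotic security -/

section Asymptotic

theorem PolyBounded.of_le {f g : ℕ → ℕ} (hg : PolyBounded g) (h : ∀ n, f n ≤ g n) : PolyBounded f :=
  let ⟨P, hP⟩ := hg
  ⟨P, fun n => (h n).trans (hP n)⟩

theorem PolyBounded.const (c : ℕ) : PolyBounded fun _ => c :=
  ⟨Polynomial.C c, fun n => by simp⟩

theorem PolyBounded.id : PolyBounded fun n => n := ⟨Polynomial.X, fun n => by simp⟩

theorem PolyBounded.add {f g : ℕ → ℕ} (hf : PolyBounded f) (hg : PolyBounded g) :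
    PolyBounded fun n => f n + g n :=
  let ⟨P, hP⟩ := hf
  let ⟨Q, hQ⟩ := hg
  ⟨P + Q, fun n => by rw [Polynomial.eval_add]; exact Nat.add_le_add (hP n) (hQ n)⟩

theorem PolyBounded.mul {f g : ℕ → ℕ} (hf : PolyBounded f) (hg : PolyBounded g) :
    PolyBounded fun n => f n * g n :=
  let ⟨P, hP⟩ := hf
  let ⟨Q, hQ⟩ := hg
  ⟨P * Q, fun n => by rw [Polynomial.eval_mul]; exact Nat.mul_le_mul (hP n) (hQ n)⟩

theorem PolyBounded.pow {f : ℕ → ℕ} (hf : PolyBounded f) (k : ℕ) : PolyBounded fun n => f n ^ k :=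
  let ⟨P, hP⟩ := hf
  ⟨P ^ k, fun n => by rw [Polynomial.eval_pow]; exact Nat.pow_le_pow_left (hP n) k⟩

theorem negligible_mul_inv {f p : ℕ → ℕ} (hf : PolyBounded f) (hp : ∀ n, 2 ^ n < p n) :
    Negligible fun n => (f n : ℝ) * (1 / (p n : ℝ)) := by
  obtain ⟨P, hP⟩ := hf
  have h1 : Negligible fun n => (1 / 2 : ℝ) ^ n := fun k =>
    tendsto_pow_const_mul_const_pow_of_abs_lt_one k (by norm_num [abs_of_pos])
  have h2 := h1.polynomial_mul (P.map (Nat.castRingHom ℝ))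
  refine h2.trans_abs_le fun n => ?_
  have e : (P.map (Nat.castRingHom ℝ)).eval (n : ℝ) = (P.eval n : ℕ) := by
    rw [Polynomial.eval_natCast_map]
    rfl
  have hpn : (2 : ℝ) ^ n < p n := by exact_mod_cast hp n
  have h2n : (0 : ℝ) < 2 ^ n := by positivity
  simp only [e]
  rw [abs_of_nonneg (by positivity), abs_of_nonneg (by positivity), one_div_pow]
  gcongr
  exact hP n

/-- As p ≥ 2, removing the factor 1 - 1/p costs at most a factor 2. The terms in 1/p add up to 2 ·
2(q + 1) + q = 5q + 4, and q is at most the size. -/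
theorem aAdv_le {Γ : BilinearGroup} (N : ℕ) (A : AAdversary Γ) (K : ℕ) : ∃ D : Prog Γ,
    D.cost ≤ ((A.size + N + K + 2) ^ 156 + 2 * N + 6) ^ 60 ∧
      aAdv N A ≤ 2 * dbdheAdv (N + 1) D + ((5 * A.size + 4 : ℕ) : ℝ) * (1 / (Γ.p : ℝ)) +
        A.size / (K + 1) := by
  obtain ⟨B, h1, h2, h3⟩ := exists_reduction N A K
  obtain ⟨D, h4, h5⟩ := bhAdv_le N B
  have h10 := Nat.pow_le_pow_left (Nat.add_le_add_right (Nat.add_le_add_right h2 (2 * N)) 6) 60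
  refine ⟨D, h4.trans h10, ?_⟩
  clear h10 h2 h4
  have h6 := (abs_le.1 (bhAdv_close h3)).1
  have hq : (A.queries : ℝ) ≤ A.size := by
    exact_mod_cast Nat.le_add_left _ _
  have hp : (1 / (Γ.p : ℝ)) ≤ 1 / 2 :=
    one_div_le_one_div_of_le (by norm_num) (by exact_mod_cast Γ.prime.out.two_le)
  have hp0 : 0 ≤ 1 / (Γ.p : ℝ) := by positivity
  have ha : 0 ≤ aAdv N A := abs_nonneg _
  rw [h1] at h5
  have h7 : (1 / 2) * aAdv N A ≤ (1 - 1 / (Γ.p : ℝ)) * aAdv N A :=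
    mul_le_mul_of_nonneg_right (by linarith) ha
  have h8 : (A.queries : ℝ) * (1 / (Γ.p : ℝ)) ≤ A.size * (1 / (Γ.p : ℝ)) :=
    mul_le_mul_of_nonneg_right hq hp0
  have h9 : (A.queries : ℝ) * (1 / ((K : ℝ) + 1)) ≤ A.size / (K + 1) := by
    rw [div_eq_mul_one_div (A.size : ℝ)]
    exact mul_le_mul_of_nonneg_right hq (by positivity)
  push_cast
  linarith

/-- Superpolynomial decay is tested against one power n^k at a time, so K may depend on k. With K =
size · (n+1)^(k+1) the extraction error times n^k is at most 1/(n+1), while the distinguisher still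
has polynomial size. -/
theorem indSidCpaSecure {Γ : ℕ → BilinearGroup} {N : ℕ → ℕ} (hp : ∀ n, 2 ^ n < (Γ n).p)
    (hN : PolyBounded N) (h : DBDHEAssumption Γ fun n => N n + 1) : IndSidCpaSecure Γ N := by
  intro A hA k
  have hsz : PolyBounded fun n => 5 * (A n).size + 4 :=
    ((PolyBounded.const 5).mul hA).add (PolyBounded.const 4)
  have hK : PolyBounded fun n => (A n).size * (n + 1) ^ (k + 1) :=
    hA.mul ((PolyBounded.id.add (PolyBounded.const 1)).pow (k + 1))
  choose D hD hadv using fun n => aAdv_le (N n) (A n) ((A n).size * (n + 1) ^ (k + 1))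
  have hDcost : PolyBounded fun n => (D n).cost :=
    PolyBounded.of_le (((((((hA.add hN).add hK).add (PolyBounded.const 2)).pow 156).add
      ((PolyBounded.const 2).mul hN)).add (PolyBounded.const 6)).pow 60) hD
  have t1 : Tendsto (fun n : ℕ => 2 * ((n : ℝ) ^ k * dbdheAdv (N n + 1) (D n)) +
      (n : ℝ) ^ k * (((5 * (A n).size + 4 : ℕ) : ℝ) * (1 / ((Γ n).p : ℝ))) + 1 / ((n : ℝ) + 1))
      atTop (𝓝 (2 * 0 + 0 + 0)) :=
    (((h D hDcost k).const_mul 2).add (negligible_mul_inv hsz hp k)).add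
      tendsto_one_div_add_atTop_nhds_zero_nat
  rw [mul_zero, add_zero, add_zero] at t1
  refine squeeze_zero (fun n => mul_nonneg (by positivity) (abs_nonneg _)) (fun n => ?_) t1
  have h1 : (n : ℝ) ^ k * ((A n).size / (((A n).size * (n + 1) ^ (k + 1) : ℕ) + 1 : ℝ)) ≤
      1 / ((n : ℝ) + 1) := by
    push_cast
    rw [← mul_div_assoc, div_le_div_iff₀ (by positivity) (by positivity), one_mul]
    have : (n : ℝ) ^ k ≤ (n + 1) ^ k := pow_le_pow_left₀ (by positivity) (by linarith) k
    calc (n : ℝ) ^ k * (A n).size * (n + 1) ≤ (n + 1) ^ k * (A n).size * (n + 1) := by gcongr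
      _ = (A n).size * ((n : ℝ) + 1) ^ (k + 1) := by ring
      _ ≤ _ := by linarith
  have h2 := mul_le_mul_of_nonneg_left (hadv n) (by positivity : (0 : ℝ) ≤ (n : ℝ) ^ k)
  refine h2.trans ?_
  rw [mul_add, mul_add]
  linarith

end Asymptotic

end AIBBE

end

open AIBBE in
theorem mainTheorem9 :
    (∀ (Γ : ℕ → BilinearGroup) (N : ℕ → ℕ), (∀ n, 2 ^ n < (Γ n).p) → PolyBounded N →
      DBDHEAssumption Γ (fun n => N n + 1) → IndSidCpaSecure Γ N) ∧
    (∃ c : ℕ, ∀ (Γ : BilinearGroup) (N : ℕ) (A : AAdversary Γ) (K : ℕ),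
      ∃ B : BHAdversary Γ, B.queries = A.queries ∧ B.size ≤ (A.size + N + K + 2) ^ c ∧
        |bhAdv N B - (1 - 1 / (Γ.p : ℝ)) * aAdv N A| ≤
          (A.queries / 2 : ℝ) * (1 / (K + 1) + 1 / (Γ.p : ℝ))) := by
  refine ⟨?_, 156, fun Γ N A K => ?_⟩
  · exact fun Γ N hp hN h => indSidCpaSecure hp hN h
  · obtain ⟨B, h1, h2, h3⟩ := exists_reduction N A K
    exact ⟨B, h1, h2, bhAdv_close h3⟩
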